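/- Let $F$ be a computable field and let $V_\infty$ be the canonical computable $\aleph_0$-dimensional vector space over $F$, whose vectors are the finitely non-zero $\omega$-sequences of elements of $F$. Let $\mathcal B_\eta$ be the interval Boolean algebra of the rationals $\mathbb Q$ (the Boolean algebra of sets of rationals generated by the left-closed right-open intervals, unbounded ones included), with its standard computable presentation. For a Turing degree $\mathbf d=\deg(D)$, $D\subseteq\omega$, let $GSL_{\mathbf d}$ be the group of all pairs $\langle\mu,\sigma\rangle$ in which $\sigma$ is an automorphism of $F$, $\mu:V_\infty\to V_\infty$ is one-to-one and onto with $\mu(\alpha u+\beta v)=\sigma(\alpha)\mu(u)+\sigma(\beta)\mu(v)$ for all $u,v\in V_\infty$ and $\alpha,\beta\in F$, and both $\mu$ and $\sigma$ are $\mathbf d$-computable; let $Aut_{\mathbf d}(\mathcal B_\eta)$ be the group of all $\mathbf d$-computable automorphisms of $\mathcal B_\eta$. The Turing degree of the isomorphism type of a countable group $G$ is, if it exists, the least element of the set of the Turing degrees of the atomic diagrams of the groups isomorphic to $G$ whose universe is a set of natural numbers. Theorem. For every Turing degree $\mathbf d$, each of the groups $GSL_{\mathbf d}$ and $Aut_{\mathbf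 d}(\mathcal B_\eta)$ has a Turing degree of its isomorphism type, and this degree is $\mathbf d''$, the second Turing jump of $\mathbf d$. -/

import Mathlib

open scoped Computability

/-! ### Turing degrees of sets, and the Turing jump -/

/-- The characteristic function of a set of natural numbers, as an oracle. -/
noncomputable def charFun (D : Set ℕ) : ℕ →. ℕ :=
  ((D.indicator 1 : ℕ → ℕ) : ℕ →. ℕ)

/-- The Turing degree of a set of natural numbers. -/
noncomputable def deg (D : Set ℕ) : TuringDegree :=
  toAntisymmetrization TuringReducible (charFun D)

/-- Programs for oracle computations, one constructor for each clause of `Nat.RecursiveIn`. -/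
inductive OracleCode : Type
  | zero : OracleCode
  | succ : OracleCode
  | left : OracleCode
  | right : OracleCode
  | oracle : OracleCode
  | pair : OracleCode → OracleCode → OracleCode
  | comp : OracleCode → OracleCode → OracleCode
  | prec : OracleCode → OracleCode → OracleCode
  | rfind : OracleCode → OracleCode

namespace OracleCode

/-- The partial function computed by a program with oracle `O`. -/
def eval (O : ℕ →. ℕ) : OracleCode → (ℕ →. ℕ)
  | zero => fun _ => Part.some 0
  | succ => fun n => Part.some (n + 1)
  | left => fun n => Part.some n.unpair.1
  | right => fun n => Part.some n.unpair.2
  | oracle => O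
  | pair c d => fun n => Nat.pair <$> eval O c n <*> eval O d n
  | comp c d => fun n => eval O d n >>= eval O c
  | prec c d => fun p =>
      let (a, n) := Nat.unpair p
      n.rec (eval O c a) fun y IH => do
        let i ← IH
        eval O d (Nat.pair a (Nat.pair y i))
  | rfind c => fun a =>
      Nat.rfind fun n => (fun m => decide (m = 0)) <$> eval O c (Nat.pair a n)

/-- The Gödel number of a program. -/
def number : OracleCode → ℕ
  | zero => Nat.pair 0 0
  | succ => Nat.pair 1 0
  | left => Nat.pair 2 0
  | right => Nat.pair 3 0
  | oracle => Nat.pair 4 0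
  | pair c d => Nat.pair 5 (Nat.pair (number c) (number d))
  | comp c d => Nat.pair 6 (Nat.pair (number c) (number d))
  | prec c d => Nat.pair 7 (Nat.pair (number c) (number d))
  | rfind c => Nat.pair 8 (number c)

end OracleCode

/-- The Turing jump `D'`: the halting set relative to `D`, that is, the set of all Gödel numbers
`e` of programs which halt on input `e` with oracle `D`. -/
def jump (D : Set ℕ) : Set ℕ :=
  {e | ∃ c : OracleCode, c.number = e ∧ (c.eval (charFun D) e).Dom}

/-! ### Degree spectra of groups -/

/-- The atomic diagram of a group whose universe is a set `A` of natural numbers: the set of codes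
of the true atomic sentences `a = b` (tag `0`) and `a * b = c` (tag `1`) with parameters in `A`. -/
def atomicDiagram (A : Set ℕ) [Group A] : Set ℕ :=
  {n | ∃ a b : A, a = b ∧ n = Nat.pair 0 (Nat.pair a b)} ∪
  {n | ∃ a b c : A, a * b = c ∧ n = Nat.pair 1 (Nat.pair a (Nat.pair b c))}

/-- The Turing degree spectrum of a group `G`: the set of the degrees of (the atomic diagrams of)
the groups isomorphic to `G` whose universe is a set of natural numbers. -/
def degreeSpectrum (G : Type*) [Group G] : Set TuringDegree :=
  {a | ∃ (A : Set ℕ) (_ : Group A), Nonempty (G ≃* A) ∧ deg (atomicDiagram A) = a}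

/-- `a` is the Turing degree of the isomorphism type of `G`: the least degree in the degree
spectrum of `G`. -/
def IsDegreeOfIsomorphismType (G : Type*) [Group G] (a : TuringDegree) : Prop :=
  IsLeast (degreeSpectrum G) a

/-! ### Computable presentations and maps computable relative to an oracle -/

/-- `ν` names every element of `α` by at least one natural number, and it is decidable whether two
numbers name the same element. -/
structure IsDecidableNumbering {α : Type*} (ν : ℕ → α) : Prop where
  surjective : Function.Surjective ν
  decidable_eq : ComputablePred fun p : ℕ × ℕ => ν p.1 = ν p.2

/-- A map `f` of a set numbered by `ν` is `D`-computable if some `D`-computable function sends each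
name of `x` to a name of `f x`. -/
def IsComputableMap {α : Type*} (D : Set ℕ) (ν : ℕ → α) (f : α → α) : Prop :=
  ∃ g : ℕ → ℕ, (g : ℕ →. ℕ) ≤ᵀ charFun D ∧ ∀ n, ν (g n) = f (ν n)

/-- The field `F`, presented by the numbering `ν`, is a computable field. -/
structure IsComputableField {F : Type*} [Field F] (ν : ℕ → F) : Prop
    extends IsDecidableNumbering ν where
  add : ∃ f : ℕ → ℕ → ℕ, Computable₂ f ∧ ∀ m n, ν (f m n) = ν m + ν n
  mul : ∃ f : ℕ → ℕ → ℕ, Computable₂ f ∧ ∀ m n, ν (f m n) = ν m * ν n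

theorem IsComputableMap.id {α : Type*} (D : Set ℕ) (ν : ℕ → α) :
    IsComputableMap D ν (fun x => x) :=
  ⟨fun n => n, (Computable.id.partrec).turingReducible, fun _ => rfl⟩

theorem IsComputableMap.comp {α : Type*} {D : Set ℕ} {ν : ℕ → α} {f g : α → α}
    (hf : IsComputableMap D ν f) (hg : IsComputableMap D ν g) :
    IsComputableMap D ν (fun x => f (g x)) := by
  obtain ⟨f', hf', hf⟩ := hf
  obtain ⟨g', hg', hg⟩ := hg
  refine ⟨fun n => f' (g' n), ?_, fun n => by rw [hf, hg]⟩
  have := Nat.RecursiveIn.comp (RecursiveIn.iff_nat.1 hf') (RecursiveIn.iff_nat.1 hg')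
  refine RecursiveIn.iff_nat.2 (this.of_eq fun n => ?_)
  exact Part.bind_some (g' n) (f' : ℕ →. ℕ)

/-- The inverse of a `D`-computable permutation is `D`-computable. -/
theorem IsComputableMap.inv {α : Type*} {D : Set ℕ} {ν : ℕ → α} (hν : IsDecidableNumbering ν)
    {f g : α → α} (hfg : ∀ x, f (g x) = x) (hgf : ∀ x, g (f x) = x)
    (hf : IsComputableMap D ν f) : IsComputableMap D ν g := by
  classical
  obtain ⟨f', hf', hf⟩ := hf
  obtain ⟨e, he, hνe⟩ := ComputablePred.computable_iff.1 hν.decidable_eq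
  replace hνe : ∀ m n, ν m = ν n ↔ e (m, n) = true := fun m n => iff_of_eq (congrFun hνe (m, n))
  let t : ℕ → ℕ := fun p => cond (e p.unpair) 0 1
  have ht : Computable t :=
    Computable.cond (he.comp Computable.unpair) (Computable.const 0) (Computable.const 1)
  have ht' : Nat.RecursiveIn {charFun D} (t : ℕ →. ℕ) :=
    Nat.Partrec.recursiveIn (Partrec.nat_iff.1 ht.partrec)
  have hf'' := RecursiveIn.iff_nat.1 hf'
  have h := Nat.RecursiveIn.rfind
    (Nat.RecursiveIn.comp ht' (Nat.RecursiveIn.pair .left (Nat.RecursiveIn.comp hf'' .right)))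
  have hex : ∀ k, ∃ n, ν (f' n) = ν k := fun k => by
    obtain ⟨n, hn⟩ := hν.surjective (g (ν k))
    exact ⟨n, by rw [hf, hn, hfg]⟩
  refine ⟨fun k => Nat.find (hex k), ?_, fun k => ?_⟩
  · refine RecursiveIn.iff_nat.2 (h.of_eq_tot fun k => ?_)
    have key : ∀ n, Nat.pair <$> (Part.some (Nat.pair k n).unpair.1) <*>
        (Part.some (Nat.pair k n).unpair.2 >>= (f' : ℕ →. ℕ)) >>= (t : ℕ →. ℕ) =
        Part.some (t (Nat.pair k (f' n))) := fun n => by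
      have h1 : (Part.some (Nat.pair k n).unpair.2 >>= (f' : ℕ →. ℕ)) = Part.some (f' n) := by
        rw [Nat.unpair_pair]
        exact Part.bind_some n (f' : ℕ →. ℕ)
      rw [h1, Nat.unpair_pair]
      simp only [Part.map_eq_map, Part.map_some, Seq.seq, Part.bind_some]
      exact Part.bind_some _ (t : ℕ →. ℕ)
    refine Nat.mem_rfind.2 ⟨?_, fun {m} hm => ?_⟩
    · refine (Part.mem_map_iff _).2 ⟨0, ?_, rfl⟩
      have := (hνe _ _).1 (Nat.find_spec (hex k)).symm
      exact (key _).symm ▸ Part.mem_some_iff.2 (by simp [t, this])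
    · refine (Part.mem_map_iff _).2 ⟨1, ?_, rfl⟩
      have : ¬ e (k, f' m) = true := fun h => Nat.find_min (hex k) hm ((hνe _ _).2 h).symm
      exact (key _).symm ▸ Part.mem_some_iff.2 (by simp [t, this])
  · have := Nat.find_spec (hex k)
    rw [← hgf (ν _), ← hf, this]

/-! ### The vector space and its semilinear transformations -/

/-- The standard numbering of the vectors of `V_∞`, the space `ℕ →₀ F` of finitely non-zero
sequences: `n` codes a list of names of elements of `F`, which is extended by zeros. -/
noncomputable def vecNumbering {F : Type*} [Field F] (ν : ℕ → F) (n : ℕ) : ℕ →₀ F :=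
  haveI := Classical.decEq F
  ((Denumerable.ofNat (List ℕ) n).map ν).toFinsupp

theorem vecNumbering_apply {F : Type*} [Field F] (ν : ℕ → F) {z : ℕ} (hz : ν z = 0) (n i : ℕ) :
    vecNumbering ν n i = ν ((Denumerable.ofNat (List ℕ) n).getD i z) := by
  simp only [vecNumbering, List.toFinsupp_apply]
  rw [← hz, List.getD_map]

theorem vecNumbering_isDecidable {F : Type*} [Field F] {ν : ℕ → F} (hν : IsDecidableNumbering ν) :
    IsDecidableNumbering (vecNumbering ν) := by
  classical
  obtain ⟨z, hz⟩ := hν.surjective 0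
  refine ⟨fun v => ?_, ?_⟩
  · choose c hc using hν.surjective
    refine ⟨Encodable.encode ((List.range (v.support.sup Nat.succ)).map fun i => c (v i)), ?_⟩
    ext i
    rw [vecNumbering_apply ν hz, Denumerable.ofNat_encode]
    by_cases hi : i < v.support.sup Nat.succ
    · simp [List.getD_eq_getElem?_getD, hi, hc]
    · have : v i = 0 := by
        by_contra h
        exact hi (Finset.le_sup (f := Nat.succ) (Finsupp.mem_support_iff.2 h))
      simp [List.getD_eq_getElem?_getD, hi, hz, this]
  · obtain ⟨e, he, hνe⟩ := ComputablePred.computable_iff.1 hν.decidable_eq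
    replace hνe : ∀ m n, ν m = ν n ↔ e (m, n) = true :=
      fun m n => iff_of_eq (congrFun hνe (m, n))
    let l : ℕ → List ℕ := Denumerable.ofNat (List ℕ)
    have hl : Computable l := (Primrec.ofNat (List ℕ)).to_comp
    let d : ℕ × ℕ → ℕ × Bool → Bool := fun p q =>
      q.2 && e ((l p.1).getD q.1 z, (l p.2).getD q.1 z)
    have hg : Computable₂ fun (L : List ℕ) (i : ℕ) => L.getD i z := (Primrec.list_getD z).to_comp
    have hd : Computable₂ d := by
      have hi : Computable fun q : (ℕ × ℕ) × (ℕ × Bool) => q.2.1 :=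
        Computable.fst.comp Computable.snd
      exact (Primrec.and.to_comp).comp (Computable.snd.comp Computable.snd)
        (he.comp (Computable.pair
          (hg.comp (hl.comp (Computable.fst.comp Computable.fst)) hi)
          (hg.comp (hl.comp (Computable.snd.comp Computable.fst)) hi)))
    have hlen : Computable fun p : ℕ × ℕ => max (l p.1).length (l p.2).length :=
      (Primrec.nat_max.to_comp).comp
        (Computable.list_length.comp (hl.comp Computable.fst))
        (Computable.list_length.comp (hl.comp Computable.snd))
    let r : ℕ × ℕ → Bool := fun p =>
      Nat.rec (motive := fun _ => Bool) true (fun i b => d p (i, b))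
        (max (l p.1).length (l p.2).length)
    have hr : Computable r := Computable.nat_rec hlen (Computable.const true) hd
    have hall : ∀ (p : ℕ × ℕ) (N : ℕ),
        Nat.rec (motive := fun _ => Bool) true (fun i b => d p (i, b)) N = true ↔
          ∀ i < N, ν ((l p.1).getD i z) = ν ((l p.2).getD i z) := by
      intro p N
      induction N with
      | zero => simp
      | succ N ih =>
        simp only [d, Bool.and_eq_true, Nat.forall_lt_succ_right, ← hνe] at ih ⊢
        rw [ih]
    refine ComputablePred.computable_iff.2 ⟨r, hr, funext fun p => propext ?_⟩
    rw [hall, Finsupp.ext_iff]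
    simp only [vecNumbering_apply ν hz]
    refine ⟨fun h i _ => h i, fun h i => ?_⟩
    by_cases hi : i < max (l p.1).length (l p.2).length
    · exact h i hi
    · rw [not_lt, max_le_iff] at hi
      rw [List.getD_eq_default _ _ hi.1, List.getD_eq_default _ _ hi.2]

/-- `GSL_d` for `d = deg D`: the group of the pairs `(μ, σ)` of a bijection `μ` of `V_∞` and an
automorphism `σ` of `F`, both `D`-computable, such that `μ` is semilinear with respect to `σ`. -/
def GSL {F : Type*} [Field F] (ν : ℕ → F) (hν : IsComputableField ν) (D : Set ℕ) :
    Subgroup (Equiv.Perm (ℕ →₀ F) × (F ≃+* F)) where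
  carrier := {φ |
    (∀ (α β : F) (u v : ℕ →₀ F), φ.1 (α • u + β • v) = φ.2 α • φ.1 u + φ.2 β • φ.1 v) ∧
    IsComputableMap D (vecNumbering ν) φ.1 ∧ IsComputableMap D ν φ.2}
  one_mem' := ⟨fun _ _ _ _ => rfl, IsComputableMap.id D _, IsComputableMap.id D _⟩
  mul_mem' := by
    rintro φ ψ ⟨h1, h2, h3⟩ ⟨h1', h2', h3'⟩
    refine ⟨fun α β u v => ?_, h2.comp h2', h3.comp h3'⟩
    change φ.1 (ψ.1 _) = φ.2 (ψ.2 α) • φ.1 (ψ.1 u) + φ.2 (ψ.2 β) • φ.1 (ψ.1 v)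
    rw [h1', h1]
  inv_mem' := by
    rintro φ ⟨h1, h2, h3⟩
    refine ⟨fun α β u v => ?_, ?_, ?_⟩
    · change φ.1.symm _ = φ.2.symm α • φ.1.symm u + φ.2.symm β • φ.1.symm v
      rw [Equiv.symm_apply_eq, h1]
      simp
    · exact h2.inv (vecNumbering_isDecidable hν.toIsDecidableNumbering)
        φ.1.apply_symm_apply φ.1.symm_apply_apply
    · exact h3.inv hν.toIsDecidableNumbering φ.2.apply_symm_apply φ.2.symm_apply_apply

/-! ### The interval algebra of the rationals -/

/-- `B_η`, the interval algebra of `ℚ`: the Boolean algebra of sets of rationals generated by the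
left-closed right-open intervals, unbounded ones included. -/
def intervalAlgebra : BooleanSubalgebra (Set ℚ) :=
  BooleanSubalgebra.closure
    ({I | ∃ a b : ℚ, I = Set.Ico a b} ∪ {I | ∃ a : ℚ, I = Set.Ici a} ∪ {I | ∃ b : ℚ, I = Set.Iio b})

/-- The rational number with code `(x, y, z)`. -/
def ratOfCode (q : ℕ × ℕ × ℕ) : ℚ := ((q.1 : ℚ) - q.2.1) / (q.2.2 + 1)

/-- The left-closed right-open interval with coded end points; `none` stands for a missing end
point, that is, for `-∞` on the left and for `∞` on the right. -/
def intervalOfCode : Option (ℕ × ℕ × ℕ) × Option (ℕ × ℕ × ℕ) → Set ℚ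
  | (some a, some b) => Set.Ico (ratOfCode a) (ratOfCode b)
  | (some a, none) => Set.Ici (ratOfCode a)
  | (none, some b) => Set.Iio (ratOfCode b)
  | (none, none) => Set.univ

/-- The finite union of the coded intervals of a list. -/
def unionOfCodes (L : List (Option (ℕ × ℕ × ℕ) × Option (ℕ × ℕ × ℕ))) : Set ℚ :=
  {x | ∃ I ∈ L, x ∈ intervalOfCode I}

theorem intervalOfCode_mem (I : Option (ℕ × ℕ × ℕ) × Option (ℕ × ℕ × ℕ)) :
    intervalOfCode I ∈ intervalAlgebra := by
  obtain ⟨_ | a, _ | b⟩ := I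
  · exact BooleanSubalgebra.top_mem
  · exact BooleanSubalgebra.mem_closure_of_mem (Or.inr ⟨_, rfl⟩)
  · exact BooleanSubalgebra.mem_closure_of_mem (Or.inl (Or.inr ⟨_, rfl⟩))
  · exact BooleanSubalgebra.mem_closure_of_mem (Or.inl (Or.inl ⟨_, _, rfl⟩))

theorem unionOfCodes_nil : unionOfCodes [] = ∅ := by
  ext x; simp [unionOfCodes]

theorem unionOfCodes_cons (I : Option (ℕ × ℕ × ℕ) × Option (ℕ × ℕ × ℕ))
    (L : List (Option (ℕ × ℕ × ℕ) × Option (ℕ × ℕ × ℕ))) :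
    unionOfCodes (I :: L) = intervalOfCode I ∪ unionOfCodes L := by
  ext x; simp [unionOfCodes]

theorem unionOfCodes_append (L M : List (Option (ℕ × ℕ × ℕ) × Option (ℕ × ℕ × ℕ))) :
    unionOfCodes (L ++ M) = unionOfCodes L ∪ unionOfCodes M := by
  ext x; simp [unionOfCodes, or_and_right, exists_or]

theorem unionOfCodes_mem (L : List (Option (ℕ × ℕ × ℕ) × Option (ℕ × ℕ × ℕ))) :
    unionOfCodes L ∈ intervalAlgebra := by
  induction L with
  | nil => rw [unionOfCodes_nil]; exact BooleanSubalgebra.bot_mem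
  | cons I L ih =>
    rw [unionOfCodes_cons]
    exact BooleanSubalgebra.sup_mem (intervalOfCode_mem I) ih

/-- The standard numbering of `B_η`: `n` codes a finite list of intervals, and names its union. -/
def intervalNumbering (n : ℕ) : intervalAlgebra :=
  ⟨unionOfCodes
    (Denumerable.ofNat (List (Option (ℕ × ℕ × ℕ) × Option (ℕ × ℕ × ℕ))) n), unionOfCodes_mem _⟩

theorem ratOfCode_surjective : Function.Surjective ratOfCode := by
  intro q
  refine ⟨(q.num.toNat, (-q.num).toNat, q.den - 1), ?_⟩
  have h1 : ((q.num.toNat : ℚ) - ((-q.num).toNat : ℚ)) = q.num := by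
    exact_mod_cast Int.toNat_sub_toNat_neg q.num
  have h2 : ((q.den - 1 : ℕ) : ℚ) + 1 = q.den := by
    exact_mod_cast Nat.succ_pred_eq_of_pos q.den_pos
  simp only [ratOfCode, h1, h2]
  exact Rat.num_div_den q

theorem mem_intervalOfCode (I : Option (ℕ × ℕ × ℕ) × Option (ℕ × ℕ × ℕ)) (x : ℚ) :
    x ∈ intervalOfCode I ↔
      (∀ a ∈ I.1, ratOfCode a ≤ x) ∧ (∀ b ∈ I.2, x < ratOfCode b) := by
  obtain ⟨_ | a, _ | b⟩ := I <;> simp [intervalOfCode]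

theorem exists_unionOfCodes_inter (I J : Option (ℕ × ℕ × ℕ) × Option (ℕ × ℕ × ℕ)) :
    ∃ K, intervalOfCode K = intervalOfCode I ∩ intervalOfCode J := by
  have hl : ∀ o p : Option (ℕ × ℕ × ℕ), ∃ r : Option (ℕ × ℕ × ℕ), ∀ x : ℚ,
      (∀ a ∈ r, ratOfCode a ≤ x) ↔ (∀ a ∈ o, ratOfCode a ≤ x) ∧ ∀ a ∈ p, ratOfCode a ≤ x := by
    rintro (_ | a) (_ | b)
    · exact ⟨none, by simp⟩
    · exact ⟨some b, by simp⟩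
    · exact ⟨some a, by simp⟩
    · rcases le_total (ratOfCode a) (ratOfCode b) with h | h
      · exact ⟨some b, fun x => by simpa using fun h' => h.trans h'⟩
      · exact ⟨some a, fun x => by simpa using fun h' => h.trans h'⟩
  have hr : ∀ o p : Option (ℕ × ℕ × ℕ), ∃ r : Option (ℕ × ℕ × ℕ), ∀ x : ℚ,
      (∀ a ∈ r, x < ratOfCode a) ↔ (∀ a ∈ o, x < ratOfCode a) ∧ ∀ a ∈ p, x < ratOfCode a := by
    rintro (_ | a) (_ | b)
    · exact ⟨none, by simp⟩
    · exact ⟨some b, by simp⟩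
    · exact ⟨some a, by simp⟩
    · rcases le_total (ratOfCode a) (ratOfCode b) with h | h
      · exact ⟨some a, fun x => by simpa using fun h' => h'.trans_le h⟩
      · exact ⟨some b, fun x => by simpa using fun h' => h'.trans_le h⟩
  obtain ⟨a, ha⟩ := hl I.1 J.1
  obtain ⟨b, hb⟩ := hr I.2 J.2
  refine ⟨(a, b), Set.ext fun x => ?_⟩
  simp only [mem_intervalOfCode, Set.mem_inter_iff, ha, hb]
  tauto

theorem range_unionOfCodes_inter {S T : Set ℚ} (hS : S ∈ Set.range unionOfCodes)
    (hT : T ∈ Set.range unionOfCodes) : S ∩ T ∈ Set.range unionOfCodes := by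
  obtain ⟨L, rfl⟩ := hS
  obtain ⟨M, rfl⟩ := hT
  induction L with
  | nil => exact ⟨[], by simp [unionOfCodes_nil]⟩
  | cons I L ih =>
    have h : ∃ N, unionOfCodes N = intervalOfCode I ∩ unionOfCodes M := by
      clear ih
      induction M with
      | nil => exact ⟨[], by simp [unionOfCodes_nil]⟩
      | cons J M ih =>
        obtain ⟨N, hN⟩ := ih
        obtain ⟨K, hK⟩ := exists_unionOfCodes_inter I J
        exact ⟨K :: N, by
          rw [unionOfCodes_cons, unionOfCodes_cons, hN, hK, Set.inter_union_distrib_left]⟩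
    obtain ⟨N, hN⟩ := h
    obtain ⟨P, hP⟩ := ih
    exact ⟨N ++ P, by
      rw [unionOfCodes_cons, unionOfCodes_append, hN, hP, Set.union_inter_distrib_right]⟩

theorem range_unionOfCodes_compl {S : Set ℚ} (hS : S ∈ Set.range unionOfCodes) :
    Sᶜ ∈ Set.range unionOfCodes := by
  obtain ⟨L, rfl⟩ := hS
  induction L with
  | nil => exact ⟨[(none, none)], by simp [unionOfCodes, intervalOfCode]⟩
  | cons I L ih =>
    rw [unionOfCodes_cons, Set.compl_union]
    refine range_unionOfCodes_inter ?_ ih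
    obtain ⟨_ | a, _ | b⟩ := I
    · exact ⟨[], by simp [unionOfCodes, intervalOfCode]⟩
    · exact ⟨[(some b, none)], by ext; simp [unionOfCodes, intervalOfCode]⟩
    · exact ⟨[(none, some a)], by ext; simp [unionOfCodes, intervalOfCode]⟩
    · refine ⟨[(none, some a), (some b, none)], ?_⟩
      ext x
      simp only [unionOfCodes, intervalOfCode, List.mem_cons, List.not_mem_nil, or_false,
        exists_eq_or_imp, exists_eq_left, Set.mem_ofPred_eq, Set.mem_compl_iff, Set.mem_Iio,
        Set.mem_Ici, Set.mem_Ico, not_and_or, not_le, not_lt]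

theorem intervalNumbering_surjective : Function.Surjective intervalNumbering := by
  let B : BooleanSubalgebra (Set ℚ) :=
    { carrier := Set.range unionOfCodes
      supClosed' := by
        rintro _ ⟨L, rfl⟩ _ ⟨M, rfl⟩
        exact ⟨L ++ M, unionOfCodes_append L M⟩
      infClosed' := fun _ hS _ hT => range_unionOfCodes_inter hS hT
      compl_mem' := range_unionOfCodes_compl
      bot_mem' := ⟨[], unionOfCodes_nil⟩ }
  have hB : intervalAlgebra ≤ B := by
    refine BooleanSubalgebra.closure_le.2 ?_
    rintro _ ((⟨a, b, rfl⟩ | ⟨a, rfl⟩) | ⟨b, rfl⟩)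
    · obtain ⟨c, rfl⟩ := ratOfCode_surjective a
      obtain ⟨d, rfl⟩ := ratOfCode_surjective b
      exact ⟨[(some c, some d)], by ext; simp [unionOfCodes, intervalOfCode]⟩
    · obtain ⟨c, rfl⟩ := ratOfCode_surjective a
      exact ⟨[(some c, none)], by ext; simp [unionOfCodes, intervalOfCode]⟩
    · obtain ⟨d, rfl⟩ := ratOfCode_surjective b
      exact ⟨[(none, some d)], by ext; simp [unionOfCodes, intervalOfCode]⟩
  rintro ⟨S, hS⟩
  obtain ⟨L, rfl⟩ := hB hS
  exact ⟨Encodable.encode L, by simp [intervalNumbering]⟩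

/-- The order of the coded rationals. -/
def CodeLE (p q : ℕ × ℕ × ℕ) : Prop :=
  p.1 * (q.2.2 + 1) + q.2.1 * (p.2.2 + 1) ≤ q.1 * (p.2.2 + 1) + p.2.1 * (q.2.2 + 1)

theorem codeLE_iff (p q : ℕ × ℕ × ℕ) : CodeLE p q ↔ ratOfCode p ≤ ratOfCode q := by
  have hp : (0 : ℚ) < p.2.2 + 1 := by positivity
  have hq : (0 : ℚ) < q.2.2 + 1 := by positivity
  rw [ratOfCode, ratOfCode, div_le_div_iff₀ hp hq, CodeLE, ← Nat.cast_le (α := ℚ)]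
  push_cast
  constructor <;> intro h <;> linarith

theorem codeLE_primrec : PrimrecRel CodeLE := by
  have p1 : Primrec fun x : (ℕ × ℕ × ℕ) × (ℕ × ℕ × ℕ) => x.1.1 := Primrec.fst.comp Primrec.fst
  have p2 : Primrec fun x : (ℕ × ℕ × ℕ) × (ℕ × ℕ × ℕ) => x.1.2.1 :=
    Primrec.fst.comp (Primrec.snd.comp Primrec.fst)
  have p3 : Primrec fun x : (ℕ × ℕ × ℕ) × (ℕ × ℕ × ℕ) => x.1.2.2 + 1 :=
    Primrec.succ.comp (Primrec.snd.comp (Primrec.snd.comp Primrec.fst))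
  have q1 : Primrec fun x : (ℕ × ℕ × ℕ) × (ℕ × ℕ × ℕ) => x.2.1 := Primrec.fst.comp Primrec.snd
  have q2 : Primrec fun x : (ℕ × ℕ × ℕ) × (ℕ × ℕ × ℕ) => x.2.2.1 :=
    Primrec.fst.comp (Primrec.snd.comp Primrec.snd)
  have q3 : Primrec fun x : (ℕ × ℕ × ℕ) × (ℕ × ℕ × ℕ) => x.2.2.2 + 1 :=
    Primrec.succ.comp (Primrec.snd.comp (Primrec.snd.comp Primrec.snd))
  exact Primrec.nat_le.comp
    (Primrec.nat_add.comp (Primrec.nat_mul.comp p1 q3) (Primrec.nat_mul.comp q2 p3))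
    (Primrec.nat_add.comp (Primrec.nat_mul.comp q1 p3) (Primrec.nat_mul.comp p2 q3))

/-- The coded interval contains the coded point; the point `none` is `-∞`. -/
def CodeMem (I : Option (ℕ × ℕ × ℕ) × Option (ℕ × ℕ × ℕ)) (e : Option (ℕ × ℕ × ℕ)) : Prop :=
  (I.1 = none ∨ e ≠ none ∧ CodeLE (I.1.getD 0) (e.getD 0)) ∧
  (I.2 = none ∨ e = none ∨ ¬ CodeLE (I.2.getD 0) (e.getD 0))

theorem codeMem_none (I : Option (ℕ × ℕ × ℕ) × Option (ℕ × ℕ × ℕ)) :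
    CodeMem I none ↔ I.1 = none := by
  simp [CodeMem]

theorem codeMem_some (I : Option (ℕ × ℕ × ℕ) × Option (ℕ × ℕ × ℕ)) (p : ℕ × ℕ × ℕ) :
    CodeMem I (some p) ↔ ratOfCode p ∈ intervalOfCode I := by
  obtain ⟨_ | a, _ | b⟩ := I <;> simp [CodeMem, codeLE_iff, intervalOfCode]

theorem codeMem_primrec : PrimrecRel CodeMem := by
  have d : Primrec fun o : Option (ℕ × ℕ × ℕ) => o.getD 0 :=
    Primrec.option_getD.comp Primrec.id (Primrec.const 0)
  have n : PrimrecPred fun o : Option (ℕ × ℕ × ℕ) => o = none :=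
    Primrec.eq.comp Primrec.id (Primrec.const none)
  have a : Primrec fun x : (Option (ℕ × ℕ × ℕ) × Option (ℕ × ℕ × ℕ)) × Option (ℕ × ℕ × ℕ) =>
      x.1.1 := Primrec.fst.comp Primrec.fst
  have b : Primrec fun x : (Option (ℕ × ℕ × ℕ) × Option (ℕ × ℕ × ℕ)) × Option (ℕ × ℕ × ℕ) =>
      x.1.2 := Primrec.snd.comp Primrec.fst
  have e : Primrec fun x : (Option (ℕ × ℕ × ℕ) × Option (ℕ × ℕ × ℕ)) × Option (ℕ × ℕ × ℕ) =>
      x.2 := Primrec.snd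
  exact ((n.comp a).or ((n.comp e).not.and (codeLE_primrec.comp (d.comp a) (d.comp e)))).and
    ((n.comp b).or ((n.comp e).or (codeLE_primrec.comp (d.comp b) (d.comp e)).not))

/-- Two finite unions of intervals are equal iff they have the same end points as elements. -/
theorem unionOfCodes_eq_iff (L M : List (Option (ℕ × ℕ × ℕ) × Option (ℕ × ℕ × ℕ))) :
    unionOfCodes L = unionOfCodes M ↔
      ∀ J ∈ L ++ M, ((∃ I ∈ L, CodeMem I J.1) ↔ ∃ I ∈ M, CodeMem I J.1) ∧
        ((∃ I ∈ L, CodeMem I J.2) ↔ ∃ I ∈ M, CodeMem I J.2) := by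
  classical
  -- the finite set of all end points
  let E : Finset ℚ := (((L ++ M).flatMap fun J => J.1.toList ++ J.2.toList).map ratOfCode).toFinset
  have hE : ∀ J ∈ L ++ M, ∀ p, (p ∈ J.1 ∨ p ∈ J.2) → ratOfCode p ∈ E := by
    intro J hJ p hp
    simp only [E, List.mem_toFinset, List.mem_map, List.mem_flatMap, List.mem_append,
      Option.mem_toList]
    exact ⟨p, ⟨J, List.mem_append.1 hJ, hp⟩, rfl⟩
  have hE' : ∀ q ∈ E, ∃ J ∈ L ++ M, ∃ p, (p ∈ J.1 ∨ p ∈ J.2) ∧ ratOfCode p = q := by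
    intro q hq
    simp only [E, List.mem_toFinset, List.mem_map, List.mem_flatMap, List.mem_append,
      Option.mem_toList] at hq
    obtain ⟨p, ⟨J, hJ, hp⟩, rfl⟩ := hq
    exact ⟨J, List.mem_append.2 hJ, p, hp, rfl⟩
  have hsome : ∀ (N : List (Option (ℕ × ℕ × ℕ) × Option (ℕ × ℕ × ℕ))) p,
      (∃ I ∈ N, CodeMem I (some p)) ↔ ratOfCode p ∈ unionOfCodes N := by
    intro N p
    simp [unionOfCodes, codeMem_some]
  -- a point below all end points lies in the same intervals as `-∞`
  have hbot : ∀ x : ℚ, (∀ q ∈ E, x < q) → ∀ I ∈ L ++ M,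
      (x ∈ intervalOfCode I ↔ CodeMem I none) := by
    intro x hx I hI
    rw [mem_intervalOfCode, codeMem_none]
    constructor
    · intro h
      by_contra hne
      obtain ⟨a, ha⟩ := Option.ne_none_iff_exists'.1 hne
      exact absurd (h.1 a ha) (not_le.2 (hx _ (hE I hI a (Or.inl ha))))
    · intro h
      exact ⟨fun a ha => by simp [h] at ha, fun b hb => hx _ (hE I hI b (Or.inr hb))⟩
  have hL : ∀ I ∈ L, I ∈ L ++ M := fun I h => List.mem_append_left _ h
  have hM : ∀ I ∈ M, I ∈ L ++ M := fun I h => List.mem_append_right _ h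
  have hbotU : ∀ x : ℚ, (∀ q ∈ E, x < q) → ∀ N : List _, (∀ I ∈ N, I ∈ L ++ M) →
      (x ∈ unionOfCodes N ↔ ∃ I ∈ N, CodeMem I none) := by
    intro x hx N hN
    simp only [unionOfCodes, Set.mem_ofPred_eq]
    exact exists_congr fun I => and_congr_right fun hI => hbot x hx I (hN I hI)
  constructor
  · intro h
    have hpt : ∀ e, (∃ I ∈ L, CodeMem I e) ↔ ∃ I ∈ M, CodeMem I e := by
      rintro (_ | p)
      · obtain ⟨x, hx⟩ : ∃ x : ℚ, ∀ q ∈ E, x < q := by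
          obtain ⟨y, hy⟩ := E.bddBelow
          exact ⟨y - 1, fun q hq => (sub_one_lt y).trans_le (hy hq)⟩
        rw [← hbotU x hx L hL, ← hbotU x hx M hM, h]
      · rw [hsome, hsome, h]
    exact fun J _ => ⟨hpt _, hpt _⟩
  · intro h
    ext x
    by_cases hx : ∃ q ∈ E, q ≤ x
    · obtain ⟨e, he, hmax⟩ : ∃ e ∈ E.filter (· ≤ x), ∀ q ∈ E.filter (· ≤ x), q ≤ e := by
        refine Finset.exists_max_image _ _root_.id ?_
        obtain ⟨q, hq, hqx⟩ := hx
        exact ⟨q, Finset.mem_filter.2 ⟨hq, hqx⟩⟩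
      obtain ⟨heE, hex⟩ := Finset.mem_filter.1 he
      have hle : ∀ q ∈ E, (q ≤ x ↔ q ≤ e) := fun q hq =>
        ⟨fun h => hmax q (Finset.mem_filter.2 ⟨hq, h⟩), fun h => h.trans hex⟩
      have hI : ∀ I ∈ L ++ M, (x ∈ intervalOfCode I ↔ e ∈ intervalOfCode I) := by
        intro I hI
        rw [mem_intervalOfCode, mem_intervalOfCode]
        refine and_congr (forall₂_congr fun a ha => hle _ (hE I hI a (Or.inl ha)))
          (forall₂_congr fun b hb => ?_)
        rw [← not_le, ← not_le, hle _ (hE I hI b (Or.inr hb))]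
      have hU : ∀ N : List _, (∀ I ∈ N, I ∈ L ++ M) →
          (x ∈ unionOfCodes N ↔ e ∈ unionOfCodes N) := by
        intro N hN
        simp only [unionOfCodes, Set.mem_ofPred_eq]
        exact exists_congr fun I => and_congr_right fun h => hI I (hN I h)
      rw [hU L hL, hU M hM]
      obtain ⟨J, hJ, p, hp | hp, rfl⟩ := hE' e heE
      · have := (h J hJ).1
        rwa [Option.mem_def.1 hp, hsome, hsome] at this
      · have := (h J hJ).2
        rwa [Option.mem_def.1 hp, hsome, hsome] at this
    · push Not at hx
      rw [hbotU x hx L hL, hbotU x hx M hM]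
      constructor
      · rintro ⟨I, hI, hI'⟩
        have := (h I (hL I hI)).1
        rw [(codeMem_none I).1 hI'] at this
        exact this.1 ⟨I, hI, hI'⟩
      · rintro ⟨I, hI, hI'⟩
        have := (h I (hM I hI)).1
        rw [(codeMem_none I).1 hI'] at this
        exact this.2 ⟨I, hI, hI'⟩

theorem intervalNumbering_isDecidable : IsDecidableNumbering intervalNumbering := by
  refine ⟨intervalNumbering_surjective, ?_⟩
  let C := Option (ℕ × ℕ × ℕ) × Option (ℕ × ℕ × ℕ)
  have hR : PrimrecRel fun (L : List C) (e : Option (ℕ × ℕ × ℕ)) => ∃ I ∈ L, CodeMem I e :=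
    PrimrecRel.exists_mem_list codeMem_primrec
  have hiff : ∀ {p q : C × List C × List C → Prop}, PrimrecPred p → PrimrecPred q →
      PrimrecPred fun x => (p x ↔ q x) := fun {p q} hp hq =>
    ((hp.and hq).or (hp.not.and hq.not)).of_eq fun x => by tauto
  have hl : Primrec fun x : C × List C × List C => x.2.1 := Primrec.fst.comp Primrec.snd
  have hm : Primrec fun x : C × List C × List C => x.2.2 := Primrec.snd.comp Primrec.snd
  have h1 : Primrec fun x : C × List C × List C => x.1.1 := Primrec.fst.comp Primrec.fst
  have h2 : Primrec fun x : C × List C × List C => x.1.2 := Primrec.snd.comp Primrec.fst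
  have hP : PrimrecRel fun (J : C) (x : List C × List C) =>
      ((∃ I ∈ x.1, CodeMem I J.1) ↔ ∃ I ∈ x.2, CodeMem I J.1) ∧
        ((∃ I ∈ x.1, CodeMem I J.2) ↔ ∃ I ∈ x.2, CodeMem I J.2) :=
    (hiff (hR.comp hl h1) (hR.comp hm h1)).and (hiff (hR.comp hl h2) (hR.comp hm h2))
  have ho : Primrec (Denumerable.ofNat (List C)) := Primrec.ofNat (List C)
  have hL : Primrec fun p : ℕ × ℕ => Denumerable.ofNat (List C) p.1 := ho.comp Primrec.fst
  have hM : Primrec fun p : ℕ × ℕ => Denumerable.ofNat (List C) p.2 := ho.comp Primrec.snd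
  have := (PrimrecRel.forall_mem_list hP).comp (Primrec.list_append.comp hL hM)
    (Primrec.pair hL hM)
  refine PrimrecPred.computablePred (this.of_eq fun p => ?_)
  rw [intervalNumbering, intervalNumbering, Subtype.mk.injEq]
  exact (unionOfCodes_eq_iff _ _).symm

/-- `Aut_d(B_η)` for `d = deg D`: the group of the `D`-computable automorphisms of the Boolean
algebra `B_η` (the order automorphisms of a Boolean algebra are its automorphisms). -/
def autIntervalAlgebra (D : Set ℕ) : Subgroup (intervalAlgebra ≃o intervalAlgebra) where
  carrier := {f | IsComputableMap D intervalNumbering f}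
  one_mem' := IsComputableMap.id D _
  mul_mem' := fun hf hg => IsComputableMap.comp hf hg
  inv_mem' := fun {f} hf =>
    IsComputableMap.inv intervalNumbering_isDecidable f.apply_symm_apply f.symm_apply_apply hf

/-! A lower bound on every copy of the group and one copy computable from the second jump meet at
`D''`.

Lower bound. Both groups contain the group of `D`-computable permutations of `ℕ`, which permutes the
coordinates of `V_∞`, respectively the unit intervals `[n, n + 1)` of `ℚ`. There is a `D`-decidable
`R` such that `e ∈ D''` iff the row `{x | R e x}` is finite (`exists_mem_jump_jump_iff_finite`).
Regard `ℕ` as a grid of blocks, each of them a copy of `ℕ`. Let `h` act as the transposition `(0 1)`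
in the blocks that stand for pairs in `R`, and let `g e n` act as `(1 2)` in the blocks of row `e`
from position `n` on. These commute iff `R` has nothing in row `e` from `n` on, so `e ∈ D''` iff `h`
commutes with `g e n` for some `n`. The word `h * g e 0 * h * g e 0` is a 3-cycle in the blocks of
`R` in row `e` and trivial elsewhere. For an infinite row it is conjugate to a fixed element `b` by
a computable permutation; for a finite row its support is finite, and an invariant of the ambient
group excludes conjugacy to `b`. Since `g e n` is a conjugate of `g 0 0` by powers of two fixed
shifts, `e ∈ D''` and `e ∉ D''` both become existential statements about words in finitely many
parameters, and any copy of the group can search for a witness of either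
(`deg_le_of_mem_degreeSpectrum`, `deg_jump_jump_le`).

The invariants. In `GSL` a permutation `P` of finite support moves every vector by an element of a
finite-dimensional coordinate subspace, and semilinear conjugation keeps the differences `P v - v`
within finitely many coordinates (`GSL.not_semiconjBy_ofPerm`). In the interval algebra, consider
the elements below which everything is fixed: for finite support there is a greatest one, for
infinite coinfinite support there is none, because members of the algebra are eventually constant
(`not_semiconjBy_autIntervalAlgebraOfPerm`).

Upper bound. An element is named by a program for it and its inverse. Being a name, and one name
being the product of two others, say that for all `x` finitely many computations halt with results
in a decidable relation. Such conditions are `Π₂` relative to `D`, so `D''` decides them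
(`decidableIn_forall_value`), and the least names form a copy computable from `D''`
(`exists_mem_degreeSpectrum_le_of_names`). -/

section Toolkit

variable {α β γ σ : Type*} [Primcodable α] [Primcodable β] [Primcodable γ] [Primcodable σ]
variable {O : Set (ℕ →. ℕ)}

open Encodable

/-! ### Closure properties of functions and predicates computable relative to oracles. -/

namespace RecursiveIn

theorem comp {f : β →. σ} {g : α → β} (hf : RecursiveIn O f) (hg : ComputableIn O g) :
    RecursiveIn O fun a => f (g a) :=
  (Nat.RecursiveIn.comp hf hg).of_eq fun n => by
    rcases e : decode (α := α) n with - | a <;> simp [encodek]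

end RecursiveIn

namespace ComputableIn

attribute [fun_prop] ComputableIn

attribute [fun_prop] ComputableIn.const

@[fun_prop]
theorem id' : ComputableIn O (fun a : α => a) := ComputableIn.id

@[fun_prop]
theorem comp {f : β → σ} {g : α → β} (hf : ComputableIn O f) (hg : ComputableIn O g) :
    ComputableIn O fun a => f (g a) :=
  RecursiveIn.comp (f := fun b => Part.some (f b)) hf hg

theorem of_eq {f g : α → β} (hf : ComputableIn O f) (h : ∀ a, f a = g a) : ComputableIn O g :=
  (funext h : f = g) ▸ hf

@[fun_prop]
theorem pair {f : α → β} {g : α → γ} (hf : ComputableIn O f) (hg : ComputableIn O g) :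
    ComputableIn O fun a => (f a, g a) :=
  (Nat.RecursiveIn.pair hf hg).of_eq fun n => by
    rcases decode (α := α) n with - | a <;> simp [Seq.seq]

@[fun_prop]
theorem fst' {f : α → β × γ} (hf : ComputableIn O f) : ComputableIn O fun a => (f a).1 :=
  ComputableIn.fst.comp hf

@[fun_prop]
theorem snd' {f : α → β × γ} (hf : ComputableIn O f) : ComputableIn O fun a => (f a).2 :=
  ComputableIn.snd.comp hf

theorem primrec₂ {f : α → β → σ} (h : Primrec₂ f) {g₁ : γ → α} {g₂ : γ → β}
    (h₁ : ComputableIn O g₁) (h₂ : ComputableIn O g₂) :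
    ComputableIn O fun a => f (g₁ a) (g₂ a) :=
  (h.computableIn₂ (O := O)).comp (h₁.pair h₂)

@[fun_prop]
theorem natPair {f g : α → ℕ} (hf : ComputableIn O f) (hg : ComputableIn O g) :
    ComputableIn O fun a => Nat.pair (f a) (g a) := primrec₂ Primrec₂.natPair hf hg

@[fun_prop]
theorem natUnpair {f : α → ℕ} (hf : ComputableIn O f)  :
    ComputableIn O fun a => Nat.unpair (f a) := ComputableIn.unpair.comp hf

@[fun_prop]
theorem natAdd {f g : α → ℕ} (hf : ComputableIn O f) (hg : ComputableIn O g) :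
    ComputableIn O fun a => f a + g a := primrec₂ Primrec.nat_add hf hg

@[fun_prop]
theorem natSub {f g : α → ℕ} (hf : ComputableIn O f) (hg : ComputableIn O g) :
    ComputableIn O fun a => f a - g a := primrec₂ Primrec.nat_sub hf hg

@[fun_prop]
theorem natMul {f g : α → ℕ} (hf : ComputableIn O f) (hg : ComputableIn O g) :
    ComputableIn O fun a => f a * g a := primrec₂ Primrec.nat_mul hf hg

@[fun_prop]
theorem natDiv {f g : α → ℕ} (hf : ComputableIn O f) (hg : ComputableIn O g) :
    ComputableIn O fun a => f a / g a := primrec₂ Primrec.nat_div hf hg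

@[fun_prop]
theorem natMod {f g : α → ℕ} (hf : ComputableIn O f) (hg : ComputableIn O g) :
    ComputableIn O fun a => f a % g a := primrec₂ Primrec.nat_mod hf hg

@[fun_prop]
theorem natMax {f g : α → ℕ} (hf : ComputableIn O f) (hg : ComputableIn O g) :
    ComputableIn O fun a => max (f a) (g a) := primrec₂ Primrec.nat_max hf hg

@[fun_prop]
theorem decideLt {f g : α → ℕ} (hf : ComputableIn O f) (hg : ComputableIn O g) :
    ComputableIn O fun a => decide (f a < g a) :=
  primrec₂ (primrecRel_iff_primrec_decide.1 Primrec.nat_lt) hf hg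

@[fun_prop]
theorem decideLe {f g : α → ℕ} (hf : ComputableIn O f) (hg : ComputableIn O g) :
    ComputableIn O fun a => decide (f a ≤ g a) :=
  primrec₂ (primrecRel_iff_primrec_decide.1 Primrec.nat_le) hf hg

@[fun_prop]
theorem decideEq [DecidableEq β] {f g : α → β} (hf : ComputableIn O f) (hg : ComputableIn O g) :
    ComputableIn O fun a => decide (f a = g a) :=
  primrec₂ (primrecRel_iff_primrec_decide.1 Primrec.eq) hf hg

@[fun_prop]
theorem and {f g : α → Bool} (hf : ComputableIn O f) (hg : ComputableIn O g) :
    ComputableIn O fun a => f a && g a := primrec₂ Primrec.and hf hg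

@[fun_prop]
theorem not {f : α → Bool} (hf : ComputableIn O f) : ComputableIn O fun a => !f a :=
  Primrec.not.computableIn.comp hf

@[fun_prop]
theorem cond {c : α → Bool} {f g : α → σ} (hc : ComputableIn O c)
    (hf : ComputableIn O f) (hg : ComputableIn O g) :
    ComputableIn O fun a => bif c a then f a else g a :=
  (Primrec.cond (Primrec.fst (α := Bool) (β := σ × σ)) (Primrec.fst.comp Primrec.snd)
    (Primrec.snd.comp Primrec.snd)).computableIn.comp (hc.pair (hf.pair hg))

theorem ite {c : α → Prop} [DecidablePred c] {f g : α → σ} (hc : ComputableIn O fun a => decide (c a))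
    (hf : ComputableIn O f) (hg : ComputableIn O g) :
    ComputableIn O fun a => if c a then f a else g a :=
  (hc.cond hf hg).of_eq fun a => by by_cases h : c a <;> simp [h]

theorem nat_rec {f : α → ℕ} {g : α → σ} {h : α → ℕ → σ → σ} (hf : ComputableIn O f)
    (hg : ComputableIn O g) (hh : ComputableIn O fun p : α × ℕ × σ => h p.1 p.2.1 p.2.2) :
    ComputableIn O fun a => (Nat.rec (g a) (h a) (f a) : σ) :=
  ((Nat.RecursiveIn.prec hg hh).comp (Nat.RecursiveIn.pair (Primrec.id.computableIn) hf)).of_eq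
    fun n => by
    rcases e : decode (α := α) n with - | a
    · simp [Seq.seq]
    · simp only [Part.coe_some, Part.bind_some, Part.map_some]
      induction f a <;> simp_all [Seq.seq]

theorem nat_find {p : α → ℕ → Bool} (hp : ComputableIn O fun x : α × ℕ => p x.1 x.2)
    (h : ∀ a, ∃ n, p a n = true) : ComputableIn O fun a => Nat.find (h a) := by
  have hp' : ComputableIn O fun x : α × ℕ => bif p x.1 x.2 then 0 else 1 := by fun_prop
  refine Nat.RecursiveIn.of_eq (Nat.RecursiveIn.comp (Nat.RecursiveIn.rfind hp')
    (Primrec.encode (α := α).computableIn (O := O))) fun n => ?_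
  rcases e : decode (α := α) n with - | a
  · simp
  · simp only [Part.coe_some, Part.bind_some, Part.map_some, Part.bind_eq_bind]
    refine Part.eq_some_iff.2 (Nat.mem_rfind.2 ⟨?_, fun {m} hm => ?_⟩)
    · have := Nat.find_spec (h a)
      simp [this]
    · have := Nat.find_min (h a) hm
      simp [this]

@[fun_prop]
theorem decide_forall_lt {p : α → ℕ → Bool} {f : α → ℕ}
    (hp : ComputableIn O fun x : α × ℕ => p x.1 x.2) (hf : ComputableIn O f) :
    ComputableIn O fun a => decide (∀ i < f a, p a i = true) := by
  refine (nat_rec (g := fun _ => true) (h := fun a i b => b && p a i) hf (by fun_prop)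
    (.and (by fun_prop) (hp.comp (g := fun x : α × ℕ × Bool => (x.1, x.2.1))
      (by fun_prop)))).of_eq fun a => ?_
  induction f a with
  | zero => simp
  | succ n ih =>
    simp only [ih, Nat.forall_lt_succ_right, Bool.decide_and, Bool.decide_eq_true]

theorem map_range {g : α → ℕ → σ} {f : α → ℕ}
    (hg : ComputableIn O fun x : α × ℕ => g x.1 x.2) (hf : ComputableIn O f) :
    ComputableIn O fun a => (List.range (f a)).map (g a) := by
  refine (nat_rec (g := fun _ => []) (h := fun a i l => l ++ [g a i]) hf (by fun_prop)
    (primrec₂ Primrec.list_concat (by fun_prop) (hg.comp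
      (g := fun x : α × ℕ × List σ => (x.1, x.2.1)) (by fun_prop)))).of_eq fun a => ?_
  induction f a with
  | zero => simp
  | succ n ih => simp [ih, List.range_succ]

@[fun_prop]
theorem list_length {f : α → List β} (hf : ComputableIn O f) :
    ComputableIn O fun a => (f a).length :=
  Primrec.list_length.computableIn.comp hf

@[fun_prop]
theorem list_getD {f : α → List β} {g : α → ℕ} (d : β) (hf : ComputableIn O f)
    (hg : ComputableIn O g) : ComputableIn O fun a => (f a).getD (g a) d :=
  primrec₂ (Primrec.list_getD d) hf hg

@[fun_prop]
theorem list_append {f g : α → List β} (hf : ComputableIn O f) (hg : ComputableIn O g) :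
    ComputableIn O fun a => f a ++ g a :=
  primrec₂ Primrec.list_append hf hg

@[fun_prop]
theorem ofNat_comp {σ : Type*} [Denumerable σ] {f : α → ℕ} (hf : ComputableIn O f) :
    ComputableIn O fun a => Denumerable.ofNat σ (f a) :=
  (Primrec.ofNat σ).computableIn.comp hf

@[fun_prop]
theorem encode_comp {f : α → β} (hf : ComputableIn O f) :
    ComputableIn O fun a => Encodable.encode (f a) :=
  Primrec.encode.computableIn.comp hf

theorem of_nat_iff {f : ℕ → ℕ} : ComputableIn O f ↔ Nat.RecursiveIn O (f : ℕ →. ℕ) :=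
  RecursiveIn.iff_nat

end ComputableIn

/-- `p` is decidable relative to the oracles in `O`. -/
def DecidableIn (O : Set (ℕ →. ℕ)) (p : α → Prop) : Prop :=
  ∃ f : α → Bool, ComputableIn O f ∧ ∀ a, f a = true ↔ p a

namespace DecidableIn

variable {p q : α → Prop}

theorem of_iff (hp : DecidableIn O p) (h : ∀ a, p a ↔ q a) : DecidableIn O q := by
  obtain ⟨f, hf, hfp⟩ := hp
  exact ⟨f, hf, fun a => (hfp a).trans (h a)⟩

theorem and (hp : DecidableIn O p) (hq : DecidableIn O q) : DecidableIn O fun a => p a ∧ q a := by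
  obtain ⟨f, hf, hfp⟩ := hp
  obtain ⟨g, hg, hgq⟩ := hq
  exact ⟨fun a => f a && g a, hf.and hg, fun a => by simp [hfp, hgq]⟩

theorem not (hp : DecidableIn O p) : DecidableIn O fun a => ¬ p a := by
  obtain ⟨f, hf, hfp⟩ := hp
  exact ⟨fun a => !f a, hf.not, fun a => by simp [← hfp]⟩

theorem or (hp : DecidableIn O p) (hq : DecidableIn O q) : DecidableIn O fun a => p a ∨ q a :=
  (hp.not.and hq.not).not.of_iff fun a => by tauto

theorem comp {p : β → Prop} (hp : DecidableIn O p) {f : α → β} (hf : ComputableIn O f) :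
    DecidableIn O fun a => p (f a) := by
  obtain ⟨g, hg, hgp⟩ := hp
  exact ⟨fun a => g (f a), hg.comp hf, fun a => hgp (f a)⟩

theorem of_bool {f : α → Bool} (hf : ComputableIn O f) : DecidableIn O fun a => f a = true :=
  ⟨f, hf, fun _ => Iff.rfl⟩

theorem eq [DecidableEq β] {f g : α → β} (hf : ComputableIn O f) (hg : ComputableIn O g) :
    DecidableIn O fun a => f a = g a :=
  ⟨fun a => decide (f a = g a), by fun_prop, fun a => by simp⟩

theorem decide [DecidablePred p] (hp : DecidableIn O p) :
    ComputableIn O fun a => Decidable.decide (p a) := by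
  obtain ⟨f, hf, hfp⟩ := hp
  exact hf.of_eq fun a => by rw [Bool.eq_iff_iff, hfp, decide_eq_true_iff]

theorem forall_lt {p : α → ℕ → Prop} {f : α → ℕ}
    (hp : DecidableIn O fun x : α × ℕ => p x.1 x.2) (hf : ComputableIn O f) :
    DecidableIn O fun a => ∀ i < f a, p a i := by
  obtain ⟨g, hg, hgp⟩ := hp
  exact ⟨fun a => Decidable.decide (∀ i < f a, g (a, i) = true), .decide_forall_lt hg hf,
    fun a => by simp [hgp]⟩

theorem exists_lt {p : α → ℕ → Prop} {f : α → ℕ}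
    (hp : DecidableIn O fun x : α × ℕ => p x.1 x.2) (hf : ComputableIn O f) :
    DecidableIn O fun a => ∃ i < f a, p a i :=
  (forall_lt (p := fun a i => ¬ p a i) hp.not hf).not.of_iff fun a => by simp

theorem _root_.ComputablePred.decidableIn (hp : ComputablePred p) : DecidableIn O p := by
  obtain ⟨f, hf, hp⟩ := ComputablePred.computable_iff.1 hp
  exact ⟨f, hf.computableIn, fun a => by rw [hp]⟩

theorem find {p : α → ℕ → Prop} [∀ a, DecidablePred (p a)]
    (hp : DecidableIn O fun x : α × ℕ => p x.1 x.2)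
    (h : ∀ a, ∃ n, p a n) : ComputableIn O fun a => Nat.find (h a) := by
  obtain ⟨g, hg, hgp⟩ := hp
  have h' : ∀ a, ∃ n, g (a, n) = true := fun a => (h a).imp fun n hn => (hgp (a, n)).2 hn
  refine (ComputableIn.nat_find hg h').of_eq fun a => ?_
  exact Nat.find_congr' fun {n} => hgp (a, n)

/-- A choice function for a decidable relation can be computed by an unbounded search. -/
theorem exists_choice {p : α → ℕ → Prop} (hp : DecidableIn O fun x : α × ℕ => p x.1 x.2)
    (h : ∀ a, ∃ n, p a n) : ∃ f : α → ℕ, ComputableIn O f ∧ ∀ a, p a (f a) := by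
  classical
  exact ⟨_, hp.find h, fun a => Nat.find_spec (h a)⟩

end DecidableIn

theorem ComputableIn.ite' {p : α → Prop} [DecidablePred p] {f g : α → σ} (hp : DecidableIn O p)
    (hf : ComputableIn O f) (hg : ComputableIn O g) :
    ComputableIn O fun a => if p a then f a else g a :=
  hp.decide.ite hf hg

theorem charFun_computableIn_iff {A : Set ℕ} :
    ComputableIn O (A.indicator 1 : ℕ → ℕ) ↔ DecidableIn O fun n => n ∈ A := by
  classical
  refine ⟨fun h => ⟨fun n => decide (A.indicator 1 n = 1), by fun_prop, fun n => by
    by_cases hn : n ∈ A <;> simp [hn]⟩, fun h => (ComputableIn.ite' h (.const 1) (.const 0)).of_eq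
    fun n => by by_cases hn : n ∈ A <;> simp [hn]⟩

theorem decidableIn_charFun (A : Set ℕ) : DecidableIn {charFun A} fun n => n ∈ A :=
  charFun_computableIn_iff.1 (RecursiveIn.oracle (O := {charFun A}) _ rfl)

theorem deg_le_deg_iff {A B : Set ℕ} : deg A ≤ deg B ↔ DecidableIn {charFun B} fun n => n ∈ A :=
  charFun_computableIn_iff

end Toolkit

theorem ComputableIn.rfind {O : Set (ℕ →. ℕ)} {f : ℕ → ℕ → Bool}
    (hf : ComputableIn O fun x : ℕ × ℕ => f x.1 x.2) :
    Nat.RecursiveIn O fun a => Nat.rfind fun n => Part.some (f a n) := by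
  have hf' : ComputableIn O fun n : ℕ => bif f n.unpair.1 n.unpair.2 then 0 else 1 :=
    .cond (hf.comp (by fun_prop : ComputableIn O fun n : ℕ => n.unpair)) (.const 0) (.const 1)
  refine (Nat.RecursiveIn.rfind (ComputableIn.of_nat_iff.1 hf')).of_eq fun a => ?_
  congr 1
  funext n
  refine (Part.map_some _ _).trans ?_
  simp only [Nat.unpair_pair]
  cases f a n <;> rfl

/-! ### Program numbers, halting and the jump. -/

namespace OracleCode

theorem number_injective : Function.Injective number := by
  intro c
  induction c with
  | zero | succ | left | right | oracle =>
    intro d h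
    cases d <;> simp only [number, Nat.pair_eq_pair] at h <;> first | rfl | omega
  | pair _ _ ih₁ ih₂ | comp _ _ ih₁ ih₂ | prec _ _ ih₁ ih₂ =>
    intro d h
    cases d <;> simp only [number, Nat.pair_eq_pair] at h <;> try omega
    rw [ih₁ h.2.1, ih₂ h.2.2]
  | rfind _ ih =>
    intro d h
    cases d <;> simp only [number, Nat.pair_eq_pair] at h <;> try omega
    rw [ih h.2]

theorem exists_eval_eq {f O : ℕ →. ℕ} (hf : Nat.RecursiveIn {O} f) :
    ∃ c : OracleCode, c.eval O = f := by
  induction hf with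
  | zero => exact ⟨zero, rfl⟩
  | succ => exact ⟨succ, rfl⟩
  | left => exact ⟨left, rfl⟩
  | right => exact ⟨right, rfl⟩
  | oracle g hg => exact ⟨oracle, (Set.mem_singleton_iff.1 hg).symm⟩
  | pair _ _ h₁ h₂ =>
    obtain ⟨c, rfl⟩ := h₁
    obtain ⟨d, rfl⟩ := h₂
    exact ⟨pair c d, rfl⟩
  | comp _ _ h₁ h₂ =>
    obtain ⟨c, rfl⟩ := h₁
    obtain ⟨d, rfl⟩ := h₂
    exact ⟨comp c d, rfl⟩
  | prec _ _ h₁ h₂ =>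
    obtain ⟨c, rfl⟩ := h₁
    obtain ⟨d, rfl⟩ := h₂
    exact ⟨prec c d, rfl⟩
  | rfind _ h =>
    obtain ⟨c, rfl⟩ := h
    exact ⟨rfind c, rfl⟩

theorem recursiveIn_eval (O : ℕ →. ℕ) (c : OracleCode) : Nat.RecursiveIn {O} (c.eval O) := by
  induction c with
  | zero => exact .zero
  | succ => exact .succ
  | left => exact .left
  | right => exact .right
  | oracle => exact .oracle _ rfl
  | pair _ _ h₁ h₂ => exact .pair h₁ h₂
  | comp _ _ h₁ h₂ => exact .comp h₁ h₂
  | prec _ _ h₁ h₂ => exact .prec h₁ h₂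
  | rfind _ h => exact .rfind h

theorem eval_comp (O : ℕ →. ℕ) (c d : OracleCode) (n : ℕ) :
    (comp c d).eval O n = (d.eval O n).bind fun m => c.eval O m := rfl

/-- A program with constant output `n`. -/
def const : ℕ → OracleCode
  | 0 => zero
  | n + 1 => comp succ (const n)

@[simp]
theorem eval_const (O : ℕ →. ℕ) (n m : ℕ) : (const n).eval O m = Part.some n := by
  induction n with
  | zero => rfl
  | succ n ih => simp [const, eval, ih]

theorem computableIn_number_const (O : Set (ℕ →. ℕ)) : ComputableIn O fun n => (const n).number := by
  refine (ComputableIn.nat_rec (O := O) (f := fun n : ℕ => n) (g := fun _ => Nat.pair 0 0)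
    (h := fun _ _ i => Nat.pair 6 (Nat.pair (Nat.pair 1 0) i)) (by fun_prop) (by fun_prop)
    (by fun_prop)).of_eq fun n => ?_
  induction n with
  | zero => rfl
  | succ n ih => simp [const, number, ih]

/-- The program with number `e` halts on the input `x`. -/
def Halts (D : Set ℕ) (e x : ℕ) : Prop :=
  ∃ c : OracleCode, c.number = e ∧ (c.eval (charFun D) x).Dom

theorem halts_number {D : Set ℕ} {c : OracleCode} {x : ℕ} :
    Halts D c.number x ↔ (c.eval (charFun D) x).Dom :=
  ⟨fun ⟨_, h, hc⟩ => number_injective h ▸ hc, fun h => ⟨c, rfl, h⟩⟩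

/-- The jump only asks about a program run on its own number. Precomposing with the constant program
for `x` makes that input irrelevant, so halting at an arbitrary input reduces to membership in the
jump. -/
theorem halts_iff_mem_jump {D : Set ℕ} {e x : ℕ} :
    Halts D e x ↔ Nat.pair 6 (Nat.pair e (const x).number) ∈ jump D := by
  constructor
  · rintro ⟨c, rfl, h⟩
    exact ⟨comp c (const x), rfl, by
      rw [eval_comp, eval_const, Part.bind_some]
      exact h⟩
  · rintro ⟨d, hd, h⟩
    cases d <;> simp only [number, Nat.pair_eq_pair] at hd <;> try omega
    obtain ⟨-, h₁, h₂⟩ := hd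
    rw [number_injective h₂, eval_comp, eval_const, Part.bind_some] at h
    exact ⟨_, h₁, h⟩

theorem decidableIn_halts (D : Set ℕ) :
    DecidableIn {charFun (jump D)} fun p : ℕ × ℕ => Halts D p.1 p.2 := by
  have h := computableIn_number_const {charFun (jump D)}
  refine ((decidableIn_charFun (jump D)).comp (f := fun p : ℕ × ℕ =>
    Nat.pair 6 (Nat.pair p.1 (const p.2).number)) ?_).of_iff fun p => halts_iff_mem_jump.symm
  have h' : ComputableIn {charFun (jump D)} fun p : ℕ × ℕ => (const p.2).number :=
    h.comp ComputableIn.snd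
  fun_prop

/-- A co-enumerable relation is decidable relative to the jump. -/
theorem decidableIn_jump_forall {D : Set ℕ} {p : ℕ → ℕ → Prop}
    (hp : DecidableIn {charFun D} fun x : ℕ × ℕ => p x.1 x.2) :
    DecidableIn {charFun (jump D)} fun e => ∀ x, p e x := by
  obtain ⟨f, hf, hfp⟩ := hp
  -- The program searches for a counterexample; the universal statement holds iff it does not halt.
  obtain ⟨c, hc⟩ := exists_eval_eq (ComputableIn.rfind (f := fun a n => !f (a, n)) hf.not)
  refine ((decidableIn_halts D).comp (f := fun e : ℕ => (c.number, e))
    (by fun_prop)).not.of_iff fun e => ?_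
  have hc' : c.eval (charFun D) e = Nat.rfind fun x => Part.some (!f (e, x)) := congrFun hc e
  rw [halts_number, hc', not_iff_comm, not_forall]
  refine Iff.trans ?_ Nat.rfind_dom.symm
  refine exists_congr fun x => ?_
  have h : f (e, x) = true ↔ p e x := hfp (e, x)
  rw [← h]
  simp

end OracleCode

/-! ### The use principle, and simulation of oracle programs by ordinary ones. -/

namespace OracleCode

section Use

theorem mem_eval_rfind {O : ℕ →. ℕ} {c : OracleCode} {n y : ℕ} :
    y ∈ (rfind c).eval O n ↔ (∃ b ∈ c.eval O (Nat.pair n y), b = 0) ∧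
      ∀ m < y, ∃ b ∈ c.eval O (Nat.pair n m), b ≠ 0 := by
  refine Nat.mem_rfind.trans (and_congr ?_ (forall_congr' fun m => forall_congr' fun _ => ?_))
  · refine (Part.mem_map_iff _).trans (exists_congr fun b => and_congr_right fun _ => ?_)
    simp
  · refine (Part.mem_map_iff _).trans (exists_congr fun b => and_congr_right fun _ => ?_)
    simp

/-- A halting computation only consults answers that are defined, so enlarging a partial oracle
cannot change its result. This is what lets a finite piece of an oracle stand in for the whole. -/
theorem eval_mono {O O' : ℕ →. ℕ} (h : ∀ n y, y ∈ O n → y ∈ O' n) (c : OracleCode) :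
    ∀ n y, y ∈ c.eval O n → y ∈ c.eval O' n := by
  induction c with
  | zero | succ | left | right => exact fun n y hy => hy
  | oracle => exact h
  | pair c d ihc ihd =>
    intro n y hy
    simp only [eval, Seq.seq, Part.map_eq_map, Part.mem_bind_iff, Part.mem_map_iff] at hy ⊢
    obtain ⟨f, ⟨a, ha, rfl⟩, b, hb, rfl⟩ := hy
    exact ⟨_, ⟨a, ihc _ _ ha, rfl⟩, b, ihd _ _ hb, rfl⟩
  | comp c d ihc ihd =>
    intro n y hy
    obtain ⟨a, ha, hy⟩ := Part.mem_bind_iff.1 hy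
    exact Part.mem_bind_iff.2 ⟨a, ihd _ _ ha, ihc _ _ hy⟩
  | prec c d ihc ihd =>
    intro n
    simp only [eval]
    induction n.unpair.2 with
    | zero => exact ihc _
    | succ m ih =>
      intro y hy
      obtain ⟨a, ha, hy⟩ := Part.mem_bind_iff.1 hy
      exact Part.mem_bind_iff.2 ⟨a, ih _ ha, ihd _ _ hy⟩
  | rfind c ih =>
    intro n y hy
    rw [mem_eval_rfind] at hy ⊢
    exact ⟨hy.1.imp fun a ha => ⟨ih _ _ ha.1, ha.2⟩,
      fun m hm => (hy.2 m hm).imp fun a ha => ⟨ih _ _ ha.1, ha.2⟩⟩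

/-- The use principle: a halting computation asks only finitely many questions. -/
theorem exists_use (O : ℕ → ℕ →. ℕ) (hO : ∀ i j, i ≤ j → ∀ n y, y ∈ O i n → y ∈ O j n)
    {O' : ℕ →. ℕ} (h : ∀ n y, y ∈ O' n → ∃ i, y ∈ O i n) (c : OracleCode) :
    ∀ n y, y ∈ c.eval O' n → ∃ i, y ∈ c.eval (O i) n := by
  have mono : ∀ (c : OracleCode) {i j}, i ≤ j → ∀ n y, y ∈ c.eval (O i) n → y ∈ c.eval (O j) n :=
    fun c i j hij => eval_mono (hO i j hij) c
  induction c with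
  | zero | succ | left | right => exact fun n y hy => ⟨0, hy⟩
  | oracle => exact h
  | pair c d ihc ihd =>
    intro n y hy
    simp only [eval, Seq.seq, Part.map_eq_map, Part.mem_bind_iff, Part.mem_map_iff] at hy ⊢
    obtain ⟨f, ⟨a, ha, rfl⟩, b, hb, rfl⟩ := hy
    obtain ⟨i, hi⟩ := ihc _ _ ha
    obtain ⟨j, hj⟩ := ihd _ _ hb
    exact ⟨max i j, _, ⟨a, mono c (le_max_left _ _) _ _ hi, rfl⟩, b,
      mono d (le_max_right _ _) _ _ hj, rfl⟩
  | comp c d ihc ihd =>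
    intro n y hy
    obtain ⟨a, ha, hy⟩ := Part.mem_bind_iff.1 hy
    obtain ⟨i, hi⟩ := ihd _ _ ha
    obtain ⟨j, hj⟩ := ihc _ _ hy
    exact ⟨max i j, Part.mem_bind_iff.2 ⟨a, mono d (le_max_left _ _) _ _ hi,
      mono c (le_max_right _ _) _ _ hj⟩⟩
  | prec c d ihc ihd =>
    intro n
    -- Monotonicity is needed for every shorter recursion. It is stated at the input with second
    -- component `m`, so that it survives the induction on the length.
    have mono' : ∀ m {i j}, i ≤ j → ∀ y,
        y ∈ (prec c d).eval (O i) (Nat.pair n.unpair.1 m) →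
        y ∈ (prec c d).eval (O j) (Nat.pair n.unpair.1 m) := fun m i j hij => mono _ hij _
    simp only [eval, Nat.unpair_pair] at mono' ⊢
    induction n.unpair.2 with
    | zero => exact ihc _
    | succ m ih =>
      intro y hy
      obtain ⟨a, ha, hy⟩ := Part.mem_bind_iff.1 hy
      obtain ⟨i, hi⟩ := ih _ ha
      obtain ⟨j, hj⟩ := ihd _ _ hy
      exact ⟨max i j, Part.mem_bind_iff.2 ⟨a, mono' m (le_max_left _ _) _ hi,
        mono d (le_max_right _ _) _ _ hj⟩⟩
  | rfind c ih =>
    intro n y hy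
    obtain ⟨⟨a, ha, ha'⟩, hm⟩ := mem_eval_rfind.1 hy
    -- Each test up to the result `y` has its own stage. The clause `b = 0 ↔ m = y` treats the final
    -- test and the earlier ones alike, and the supremum of these finitely many stages serves all of
    -- them.
    have key : ∀ m, ∃ i, m ≤ y → ∃ b, b ∈ c.eval (O i) (Nat.pair n m) ∧
        (b = 0 ↔ m = y) := fun m => by
      rcases lt_trichotomy m y with h | h | h
      · obtain ⟨b, hb, hb'⟩ := hm m h
        obtain ⟨i, hi⟩ := ih _ _ hb
        exact ⟨i, fun _ => ⟨b, hi, by simp [h.ne, hb']⟩⟩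
      · subst h
        obtain ⟨i, hi⟩ := ih _ _ ha
        exact ⟨i, fun _ => ⟨a, hi, by simp [ha']⟩⟩
      · exact ⟨0, fun h' => absurd h' (not_le.2 h)⟩
    choose i hi using key
    have hle : ∀ m ≤ y, i m ≤ (Finset.range (y + 1)).sup i := fun m hm =>
      Finset.le_sup (f := i) (Finset.mem_range.2 (Nat.lt_succ_of_le hm))
    refine ⟨(Finset.range (y + 1)).sup i, mem_eval_rfind.2 ⟨?_, fun m hmy => ?_⟩⟩
    · obtain ⟨b, hb, hb'⟩ := hi y le_rfl
      exact ⟨b, mono c (hle y le_rfl) _ _ hb, hb'.2 rfl⟩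
    · obtain ⟨b, hb, hb'⟩ := hi m hmy.le
      exact ⟨b, mono c (hle m hmy.le) _ _ hb, fun h => hmy.ne (hb'.1 h)⟩

end Use

open Nat.Partrec (Code)

/-- The ordinary program that simulates an oracle program, the program `k` answering the
questions to the oracle. -/
def toCode (k : Code) : OracleCode → Code
  | zero => .zero
  | succ => .succ
  | left => .left
  | right => .right
  | oracle => k
  | pair c d => .pair (toCode k c) (toCode k d)
  | comp c d => .comp (toCode k c) (toCode k d)
  | prec c d => .prec (toCode k c) (toCode k d)
  -- `Code.rfind'` starts its search at the second component of the input, here set to `0`.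
  | rfind c => .comp (.rfind' (toCode k c)) (.pair .id .zero)

theorem eval_toCode (k : Code) (c : OracleCode) : (toCode k c).eval = c.eval k.eval := by
  induction c with
  | zero | succ | left | right | oracle => rfl
  | pair c d ihc ihd => simp only [toCode, Code.eval, eval, ihc, ihd]; rfl
  | comp c d ihc ihd => simp only [toCode, Code.eval, eval, ihc, ihd]; rfl
  | prec c d ihc ihd => simp only [toCode, Code.eval, eval, ihc, ihd]; rfl
  | rfind c ih =>
    funext n
    simp [toCode, Code.eval, eval, ih, Seq.seq, pure, PFun.pure, Part.map_id']

open Classical in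
/-- The program with a given number. -/
noncomputable def ofNumber (e : ℕ) : Option OracleCode :=
  if h : ∃ c : OracleCode, c.number = e then some h.choose else none

theorem ofNumber_eq_some {e : ℕ} {c : OracleCode} : ofNumber e = some c ↔ c.number = e := by
  unfold ofNumber
  split_ifs with h
  · rw [Option.some_inj]
    exact ⟨fun h' => h' ▸ h.choose_spec, fun h' => number_injective (h.choose_spec.trans h'.symm)⟩
  · exact ⟨fun h' => by simp at h', fun h' => absurd ⟨c, h'⟩ h⟩

/-- One step of the computation of `toCode` on numbers of programs; `x`, `y` and `z` are the
results for the components of `a` and for `a` itself. -/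
def toCodeStep (k : Code) (t a : ℕ) (x y z : Option Code) : Option Code :=
  bif decide (t = 0) then (bif decide (a = 0) then some .zero else none) else
  bif decide (t = 1) then (bif decide (a = 0) then some .succ else none) else
  bif decide (t = 2) then (bif decide (a = 0) then some .left else none) else
  bif decide (t = 3) then (bif decide (a = 0) then some .right else none) else
  bif decide (t = 4) then (bif decide (a = 0) then some k else none) else
  bif decide (t = 5) then x.bind fun c => y.map fun d => .pair c d else
  bif decide (t = 6) then x.bind fun c => y.map fun d => .comp c d else
  bif decide (t = 7) then x.bind fun c => y.map fun d => .prec c d else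
  bif decide (t = 8) then z.map fun c => .comp (.rfind' c) (.pair .id .zero) else none

@[fun_prop]
theorem computableIn_toCodeStep {α : Type*} [Primcodable α] {O : Set (ℕ →. ℕ)} {k : α → Code}
    {t a : α → ℕ} {x y z : α → Option Code} (hk : ComputableIn O k) (ht : ComputableIn O t)
    (ha : ComputableIn O a) (hx : ComputableIn O x) (hy : ComputableIn O y)
    (hz : ComputableIn O z) :
    ComputableIn O fun i => toCodeStep (k i) (t i) (a i) (x i) (y i) (z i) := by
  have h : ∀ {f : Code → Code → Code}, Primrec₂ f →
      ComputableIn O fun i => (x i).bind fun c => (y i).map fun d => f c d :=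
    fun {f} hf => ComputableIn.comp (f := fun x : Option Code × Option Code =>
      x.1.bind fun c => x.2.map fun d => f c d) (Primrec.computableIn <|
      Primrec.option_bind Primrec.fst <| Primrec.option_map (Primrec.snd.comp Primrec.fst)
        (hf.comp (Primrec.snd.comp Primrec.fst) Primrec.snd)) (hx.pair hy)
  have h₁ := h Code.primrec₂_pair
  have h₂ := h Code.primrec₂_comp
  have h₃ := h Code.primrec₂_prec
  have h₄ : ComputableIn O fun i =>
      (z i).map fun c => Code.comp (.rfind' c) (.pair .id .zero) :=
    ComputableIn.comp (f := fun z : Option Code =>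
      z.map fun c => Code.comp (.rfind' c) (.pair .id .zero))
      (Primrec.computableIn <| Primrec.option_map Primrec.id <|
      Code.primrec₂_comp.comp (Code.primrec_rfind'.comp Primrec.snd) (Primrec.const _)) hz
  have hs : ComputableIn O fun i => some (k i) := Primrec.option_some.computableIn.comp hk
  unfold toCodeStep
  fun_prop

theorem lt_pair_of_pos {t a : ℕ} (ht : 1 ≤ t) : a < Nat.pair t a := by
  unfold Nat.pair
  split_ifs <;> nlinarith

/-- This is the recursion equation for the translation on numbers: the tag `t` determines the
constructor and `a` its arguments. Numbers that belong to no program must yield `none`, hence the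
separate cases `a ≠ 0` for the constructors without arguments. -/
theorem toCodeStep_eq (k : Code) (t a : ℕ) :
    toCodeStep k t a ((ofNumber a.unpair.1).map (toCode k)) ((ofNumber a.unpair.2).map (toCode k))
      ((ofNumber a).map (toCode k)) = (ofNumber (Nat.pair t a)).map (toCode k) := by
  have key : ∀ (o : Option OracleCode) (x : Option Code),
      (∀ c : OracleCode, o = some c ↔ c.number = Nat.pair t a) →
      x = o.map (toCode k) → x = (ofNumber (Nat.pair t a)).map (toCode k) := by
    rintro o x ho rfl
    congr 1
    ext c
    rw [ho, ofNumber_eq_some]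
  have hpair : ∀ x y, Nat.pair x y = a ↔ x = a.unpair.1 ∧ y = a.unpair.2 := fun x y => by
    rw [← Nat.pair_eq_pair, Nat.pair_unpair]
  have hbin : ∀ f : OracleCode → OracleCode → OracleCode,
      (∀ c, (∃ d e, d.number = a.unpair.1 ∧ e.number = a.unpair.2 ∧ f d e = c) ↔
        c.number = Nat.pair t a) → ∀ c, ((ofNumber a.unpair.1).bind fun d =>
          (ofNumber a.unpair.2).map (f d)) = some c ↔ c.number = Nat.pair t a := by
    intro f hf c
    rw [← hf]
    simp [Option.bind_eq_some_iff, ofNumber_eq_some]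
  unfold toCodeStep
  simp only [Bool.cond_decide]
  split_ifs with h₀ ha h₁ ha h₂ ha h₃ ha h₄ ha h₅ h₆ h₇ h₈
  · exact key (some .zero) _ (fun c => by cases c <;> simp [number, Nat.pair_eq_pair, *]) rfl
  · exact key none _ (fun c => by cases c <;> simp [number, Nat.pair_eq_pair, *, Ne.symm ha]) rfl
  · exact key (some .succ) _ (fun c => by cases c <;> simp [number, Nat.pair_eq_pair, *]) rfl
  · exact key none _ (fun c => by cases c <;> simp [number, Nat.pair_eq_pair, *, Ne.symm ha]) rfl
  · exact key (some .left) _ (fun c => by cases c <;> simp [number, Nat.pair_eq_pair, *]) rfl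
  · exact key none _ (fun c => by cases c <;> simp [number, Nat.pair_eq_pair, *, Ne.symm ha]) rfl
  · exact key (some .right) _ (fun c => by cases c <;> simp [number, Nat.pair_eq_pair, *]) rfl
  · exact key none _ (fun c => by cases c <;> simp [number, Nat.pair_eq_pair, *, Ne.symm ha]) rfl
  · exact key (some .oracle) _ (fun c => by cases c <;> simp [number, Nat.pair_eq_pair, *]) rfl
  · exact key none _ (fun c => by cases c <;> simp [number, Nat.pair_eq_pair, *, Ne.symm ha]) rfl
  · refine key _ _ (hbin .pair fun c => by
      cases c <;> simp [number, Nat.pair_eq_pair, hpair, h₅]) ?_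
    cases ofNumber a.unpair.1 <;> cases ofNumber a.unpair.2 <;> rfl
  · refine key _ _ (hbin .comp fun c => by
      cases c <;> simp [number, Nat.pair_eq_pair, hpair, h₆]) ?_
    cases ofNumber a.unpair.1 <;> cases ofNumber a.unpair.2 <;> rfl
  · refine key _ _ (hbin .prec fun c => by
      cases c <;> simp [number, Nat.pair_eq_pair, hpair, h₇]) ?_
    cases ofNumber a.unpair.1 <;> cases ofNumber a.unpair.2 <;> rfl
  · refine key ((ofNumber a).map .rfind) _ (fun c => ?_) ?_
    · cases c <;> simp [number, Nat.pair_eq_pair, h₈, ofNumber_eq_some]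
    · cases ofNumber a <;> rfl
  · exact key none _ (fun c => by cases c <;> simp [number, Nat.pair_eq_pair] <;> omega) rfl

/-- Course-of-values recursion on the program number: the components of a compound program have
smaller numbers, so their translations are found in the list of earlier values. -/
theorem computableIn_toCode {O : Set (ℕ →. ℕ)} :
    ComputableIn O fun x : Code × ℕ => (ofNumber x.2).map (toCode x.1) := by
  let g : Code → List (Option Code) → Option Code := fun k l =>
    toCodeStep k l.length.unpair.1 l.length.unpair.2
      (l.getD l.length.unpair.2.unpair.1 none)
      (l.getD l.length.unpair.2.unpair.2 none) (l.getD l.length.unpair.2 none)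
  have hg : ComputableIn ∅ fun x : Code × List (Option Code) => some (g x.1 x.2) :=
    Primrec.option_some.computableIn.comp (by fun_prop)
  have := Computable.nat_strong_rec (fun (k : Code) e => (ofNumber e).map (toCode k))
    (g := fun k l => some (g k l)) (recursiveIn_empty_iff.1 hg) fun k n => ?_
  · exact this.computableIn
  have hget : ∀ i < n, ((List.range n).map fun e => (ofNumber e).map (toCode k)).getD i none =
      (ofNumber i).map (toCode k) := fun i hi => by
    simp [List.getD_eq_getElem?_getD, hi]
  obtain ⟨t, a, rfl⟩ : ∃ t a, n = Nat.pair t a := ⟨_, _, (Nat.pair_unpair n).symm⟩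
  simp only [g, List.length_map, List.length_range, Nat.unpair_pair]
  rw [← toCodeStep_eq, Option.some_inj]
  -- For tag `0` the argument need not be smaller than the number, but then the step ignores the
  -- earlier values.
  rcases Nat.eq_zero_or_pos t with rfl | ht
  · simp [toCodeStep]
  · rw [hget _ (lt_pair_of_pos ht), hget _ ((Nat.unpair_left_le _).trans_lt (lt_pair_of_pos ht)),
      hget _ ((Nat.unpair_right_le _).trans_lt (lt_pair_of_pos ht))]

end OracleCode

/-! ### A normal form for the jump. -/

namespace OracleCode

open Nat.Partrec (Code)

/-- Halting relative to an oracle, in terms of a computable relation on the initial segments of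
the oracle. -/
theorem exists_mem_jump_iff : ∃ S : ℕ → List ℕ → ℕ → Bool,
    (∀ O : Set (ℕ →. ℕ), ComputableIn O fun x : ℕ × List ℕ × ℕ => S x.1 x.2.1 x.2.2) ∧
    ∀ (E : Set ℕ) (e : ℕ), e ∈ jump E ↔ ∃ l t, S e l t = true ∧
      l = (List.range l.length).map (E.indicator 1) := by
  -- The function looks up an entry of a coded list and diverges past its end. Curried with `l`, its
  -- program is therefore the partial oracle given by the initial segment `l`.
  have hp : Partrec fun n : ℕ =>
      (((Denumerable.ofNat (List ℕ) n.unpair.1)[n.unpair.2]? : Option ℕ) : Part ℕ) :=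
    Computable.ofOption <| Computable.list_getElem?.comp
      ((Computable.ofNat _).comp (Computable.fst.comp Computable.unpair))
      (Computable.snd.comp Computable.unpair)
  obtain ⟨k, hk⟩ := Code.exists_code.1 (Partrec.nat_iff.1 hp)
  have heval : ∀ (l : List ℕ) n, (k.curry (Encodable.encode l)).eval n = (l[n]? : Option ℕ) := by
    intro l n
    rw [Code.eval_curry, hk]
    simp
  refine ⟨fun e l t => (((ofNumber e).map (toCode (k.curry (Encodable.encode l)))).bind
    fun C => C.evaln t e).isSome, fun O => ?_, fun E e => ⟨?_, ?_⟩⟩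
  · have h₁ : ComputableIn O fun x : ℕ × List ℕ × ℕ =>
        (ofNumber x.1).map (toCode (k.curry (Encodable.encode x.2.1))) :=
      (computableIn_toCode (O := O)).comp (g := fun x : ℕ × List ℕ × ℕ =>
        (k.curry (Encodable.encode x.2.1), x.1)) <| ComputableIn.pair
        (.primrec₂ Code.primrec₂_curry (by fun_prop) (by fun_prop)) (by fun_prop)
    have h₂ : ComputableIn O fun x : Option Code × ℕ × ℕ =>
        (x.1.bind fun C => C.evaln x.2.1 x.2.2).isSome := Primrec.computableIn <|
      Primrec.option_isSome.comp <| Primrec.option_bind Primrec.fst <| Primrec₂.mk <|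
        Code.primrec_evaln.comp <| Primrec.pair (Primrec.pair (Primrec.fst.comp
          (Primrec.snd.comp Primrec.fst)) Primrec.snd) (Primrec.snd.comp
          (Primrec.snd.comp Primrec.fst))
    exact h₂.comp (h₁.pair (by fun_prop : ComputableIn O fun x : ℕ × List ℕ × ℕ => (x.2.2, x.1)))
  · rintro ⟨c, hc, h⟩
    obtain ⟨y, hy⟩ := Part.dom_iff_mem.1 h
    let pre : ℕ → List ℕ := fun i => (List.range i).map (E.indicator 1)
    have h₁ : ∀ i j, i ≤ j → ∀ n y : ℕ,
        y ∈ (((pre i)[n]? : Option ℕ) : Part ℕ) →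
        y ∈ (((pre j)[n]? : Option ℕ) : Part ℕ) := by
      intro i j hij n y hy
      simp only [pre, Part.mem_coe, Option.mem_def, List.getElem?_eq_some_iff, List.length_map,
        List.length_range] at hy ⊢
      obtain ⟨h, hy⟩ := hy
      exact ⟨h.trans_le hij, by simpa using hy⟩
    have h₂ : ∀ n y, y ∈ charFun E n →
        ∃ i, y ∈ (((pre i)[n]? : Option ℕ) : Part ℕ) := by
      intro n y hy
      refine ⟨n + 1, ?_⟩
      have := Part.mem_some_iff.1 hy
      simp [pre, this]
    -- The initial segments of `E` increase to the whole oracle, so one of them already supports the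
    -- halting computation.
    obtain ⟨i, hi⟩ := exists_use
      (fun i n => (((List.range i).map (E.indicator 1 : ℕ → ℕ))[n]? : Option ℕ)) h₁ h₂ c _ _ hy
    have hC : y ∈ (toCode (k.curry (Encodable.encode
        ((List.range i).map (E.indicator 1 : ℕ → ℕ)))) c).eval e := by
      rw [eval_toCode]
      rwa [show Code.eval _ = _ from funext (heval _)]
    obtain ⟨t, ht⟩ := Code.evaln_complete.1 hC
    refine ⟨(List.range i).map (E.indicator 1), t, ?_, by simp⟩
    dsimp only
    rw [ofNumber_eq_some.2 hc]
    exact Option.isSome_iff_exists.2 ⟨y, ht⟩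
  · rintro ⟨l, t, h, hl⟩
    obtain ⟨y, hy⟩ := Option.isSome_iff_exists.1 h
    simp only [Option.bind_eq_some_iff, Option.map_eq_some_iff, ofNumber_eq_some] at hy
    obtain ⟨_, ⟨c, hc, rfl⟩, hy⟩ := hy
    refine ⟨c, hc, Part.dom_iff_mem.2 ⟨y, ?_⟩⟩
    have := Code.evaln_sound hy
    rw [eval_toCode, show Code.eval _ = _ from funext (heval _)] at this
    -- Conversely `l` agrees with `E` wherever it is defined, so the simulated computation is also
    -- one with oracle `E`.
    refine eval_mono (fun n z hz => Part.mem_some_iff.2 ?_) c _ _ this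
    simp only [Part.mem_coe, Option.mem_def, List.getElem?_eq_some_iff] at hz
    obtain ⟨hn, rfl⟩ := hz
    conv_lhs => rw [List.getElem_of_eq hl]
    simp

/-- The jump is enumerable relative to `E`: a witness `w` codes the length of an initial segment of
`E` and a number of steps that suffices with it. -/
theorem exists_enumeration_jump (E : Set ℕ) : ∃ K : ℕ → ℕ → Prop,
    DecidableIn {charFun E} (fun x : ℕ × ℕ => K x.1 x.2) ∧ ∀ e, e ∈ jump E ↔ ∃ w, K e w := by
  obtain ⟨S, hS, hSE⟩ := exists_mem_jump_iff
  have hE : ComputableIn {charFun E} (E.indicator 1 : ℕ → ℕ) :=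
    charFun_computableIn_iff.2 (decidableIn_charFun E)
  refine ⟨fun e w => S e ((List.range w.unpair.1).map (E.indicator 1)) w.unpair.2 = true,
    .of_bool ?_, fun e => ?_⟩
  · have : ComputableIn {charFun E} fun x : ℕ × ℕ =>
        (List.range x.2.unpair.1).map (E.indicator 1 : ℕ → ℕ) :=
      .map_range (g := fun _ i => E.indicator 1 i) (hE.comp .snd) (by fun_prop)
    exact (hS _).comp (g := fun x : ℕ × ℕ =>
      (x.1, (List.range x.2.unpair.1).map (E.indicator 1 : ℕ → ℕ), x.2.unpair.2)) (by fun_prop)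
  · rw [hSE]
    constructor
    · rintro ⟨l, t, h, hl⟩
      exact ⟨Nat.pair l.length t, by simpa [← hl] using h⟩
    · rintro ⟨w, hw⟩
      exact ⟨_, _, hw, by simp⟩

end OracleCode

/-! ### Reduction of the second jump to finiteness. -/

open OracleCode in
/-- The second jump of `D` is many-one reducible to the finiteness of `D`-decidable sets. -/
theorem exists_mem_jump_jump_iff_finite (D : Set ℕ) : ∃ R : ℕ → ℕ → Prop,
    DecidableIn {charFun D} (fun x : ℕ × ℕ => R x.1 x.2) ∧
    ∀ e, e ∈ jump (jump D) ↔ {x | R e x}.Finite := by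
  obtain ⟨S, hS, hSE⟩ := exists_mem_jump_iff
  obtain ⟨K, hK, hKD⟩ := exists_enumeration_jump D
  -- A candidate `w` consists of a guessed initial segment of `D'`, a step count, and a bound on the
  -- enumeration witnesses for its ones. Its zeros can only be refuted, by an enumeration found
  -- before stage `s`. So `P` decreases in `s`, and `e ∈ D''` iff some candidate is never refuted.
  let P : ℕ → List ℕ × ℕ × ℕ → ℕ → Prop := fun e w s => S e w.1 w.2.1 = true ∧
    ∀ i < w.1.length, (w.1.getD i 0 = 1 ∧ ∃ v < w.2.2, K i v) ∨
      (w.1.getD i 0 = 0 ∧ ∀ v < s, ¬ K i v)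
  have hP : DecidableIn {charFun D} fun x : ℕ × (List ℕ × ℕ × ℕ) × ℕ => P x.1 x.2.1 x.2.2 := by
    refine .and (.of_bool ((hS _).comp (g := fun x : ℕ × (List ℕ × ℕ × ℕ) × ℕ =>
      (x.1, x.2.1.1, x.2.1.2.1)) (by fun_prop))) (.forall_lt (.or (.and ?_ ?_) (.and ?_ ?_))
      (by fun_prop))
    · exact .eq (by fun_prop) (by fun_prop)
    · exact .exists_lt (hK.comp (f := fun y : ((ℕ × (List ℕ × ℕ × ℕ) × ℕ) × ℕ) × ℕ =>
        (y.1.2, y.2)) (by fun_prop)) (by fun_prop)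
    · exact .eq (by fun_prop) (by fun_prop)
    · exact .forall_lt (hK.comp (f := fun y : ((ℕ × (List ℕ × ℕ × ℕ) × ℕ) × ℕ) × ℕ =>
        (y.1.2, y.2)) (by fun_prop)).not (by fun_prop)
  have hmono : ∀ {e w s t}, s ≤ t → P e w t → P e w s := fun hst h =>
    ⟨h.1, fun i hi => (h.2 i hi).imp id fun h' => ⟨h'.1, fun v hv => h'.2 v (hv.trans_le hst)⟩⟩
  have hmem : ∀ e, e ∈ jump (jump D) ↔ ∃ w, ∀ s, P e w s := by
    intro e
    rw [hSE]
    constructor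
    · rintro ⟨l, t, h, hl⟩
      have hget : ∀ i < l.length, l.getD i 0 = (jump D).indicator 1 i := by
        intro i hi
        rw [hl]
        simp [List.getD_eq_getElem?_getD, hi]
      have hw : ∀ i, ∃ w, i ∈ jump D → K i w := fun i => by
        by_cases h : i ∈ jump D
        · exact ((hKD i).1 h).imp fun w hw _ => hw
        · exact ⟨0, fun h' => absurd h' h⟩
      choose w hw using hw
      refine ⟨(l, t, (Finset.range l.length).sup w + 1), fun s => ⟨h, fun i hi => ?_⟩⟩
      dsimp only at hi ⊢
      rw [hget i hi]
      by_cases h : i ∈ jump D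
      · exact Or.inl ⟨by simp [h], w i, Nat.lt_succ_of_le (Finset.le_sup (Finset.mem_range.2 hi)),
          hw i h⟩
      · exact Or.inr ⟨by simp [h], fun v _ hv => h ((hKD i).2 ⟨v, hv⟩)⟩
    · rintro ⟨⟨l, t, u⟩, h⟩
      refine ⟨l, t, (h 0).1, List.ext_getElem (by simp) fun i hi _ => ?_⟩
      have hget : l.getD i 0 = l[i] := by simp [List.getD_eq_getElem?_getD, hi]
      rw [List.getElem_map, List.getElem_range, ← hget]
      by_cases hv : ∃ v, K i v
      · obtain ⟨v, hv⟩ := hv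
        have hi' : i ∈ jump D := (hKD i).2 ⟨v, hv⟩
        rcases (h (v + 1)).2 i hi with h' | h'
        · simpa [hi'] using h'.1
        · exact absurd hv (h'.2 v (Nat.lt_succ_self v))
      · have hi' : i ∉ jump D := fun h => hv ((hKD i).1 h)
        rcases (h 0).2 i hi with ⟨-, v, -, h'⟩ | h'
        · exact absurd ⟨v, h'⟩ hv
        · simpa [hi'] using h'.1
  -- All candidates up to `w` are refuted by stage `s`.
  let Q : ℕ → ℕ → ℕ → Prop := fun e w s => ∀ v < w + 1, ¬ P e (Denumerable.ofNat _ v) s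
  have hQ : DecidableIn {charFun D} fun x : ℕ × ℕ × ℕ => Q x.1 x.2.1 x.2.2 :=
    .forall_lt (hP.comp (f := fun y : (ℕ × ℕ × ℕ) × ℕ =>
      (y.1.1, Denumerable.ofNat _ y.2, y.1.2.2)) (by fun_prop)).not (by fun_prop)
  -- The row of `e` is the graph of the function from `w` to the least stage that refutes everything
  -- up to `w`. Its domain lies below any surviving candidate, and is all of `ℕ` if there is none.
  refine ⟨fun e x => Q e x.unpair.1 x.unpair.2 ∧ ∀ s < x.unpair.2, ¬ Q e x.unpair.1 s,
    .and (hQ.comp (f := fun x : ℕ × ℕ => (x.1, x.2.unpair.1, x.2.unpair.2)) (by fun_prop))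
    (.forall_lt (hQ.comp (f := fun y : (ℕ × ℕ) × ℕ => (y.1.1, y.1.2.unpair.1, y.2))
      (by fun_prop)).not (by fun_prop)), fun e => ?_⟩
  rw [hmem]
  constructor
  · rintro ⟨w, hw⟩
    refine Set.Finite.of_finite_image (f := fun x : ℕ => x.unpair.1)
      ((Set.finite_Iio (Encodable.encode w)).subset ?_) ?_
    · rintro _ ⟨x, hx, rfl⟩
      by_contra h
      rw [Set.mem_Iio, not_lt] at h
      exact hx.1 (Encodable.encode w) (Nat.lt_succ_of_le h) (by rw [Denumerable.ofNat_encode]; exact hw _)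
    -- Minimality of the stage leaves at most one element for each `w`, so finiteness passes from
    -- the first coordinates to the row.
    · intro x hx y hy hxy
      dsimp only at hxy
      rw [← Nat.pair_unpair x, ← Nat.pair_unpair y, hxy]
      congr 1
      rcases lt_trichotomy x.unpair.2 y.unpair.2 with h | h | h
      · exact absurd (hxy ▸ hx.1) (hy.2 _ h)
      · exact h
      · exact absurd (hxy ▸ hy.1) (hx.2 _ h)
  · intro hfin
    by_contra hne
    push Not at hne
    have hex : ∀ w, ∃ s, Q e w s := by
      intro w
      have : ∀ v, ∃ s, ¬ P e (Denumerable.ofNat _ v) s := fun v => hne _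
      choose f hf using this
      exact ⟨(Finset.range (w + 1)).sup f, fun v hv h =>
        hf v (hmono (Finset.le_sup (Finset.mem_range.2 hv)) h)⟩
    classical
    refine Set.infinite_of_injective_forall_mem (f := fun w => Nat.pair w (Nat.find (hex w)))
      (fun v w h => (Nat.pair_eq_pair.1 h).1) (fun w => ?_) hfin
    simp only [Set.mem_ofPred_eq, Nat.unpair_pair]
    exact ⟨Nat.find_spec (hex w), fun s hs => Nat.find_min (hex w) hs⟩

/-! ### Computing in a copy of a group. -/

section DegreeSpectrum

variable {A : Set ℕ} [Group A]

theorem mem_iff_mem_atomicDiagram {n : ℕ} :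
    n ∈ A ↔ Nat.pair 0 (Nat.pair n n) ∈ atomicDiagram A := by
  constructor
  · exact fun h => Or.inl ⟨⟨n, h⟩, ⟨n, h⟩, rfl, rfl⟩
  · rintro (⟨a, b, -, h⟩ | ⟨a, b, c, -, h⟩)
    · simp only [Nat.pair_eq_pair, true_and] at h
      exact h.1 ▸ a.2
    · simp [Nat.pair_eq_pair] at h

theorem mul_eq_iff_mem_atomicDiagram {a b : A} {n : ℕ} :
    Nat.pair 1 (Nat.pair a (Nat.pair b n)) ∈ atomicDiagram A ↔ n = (a * b : A) := by
  constructor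
  · rintro (⟨_, _, -, h⟩ | ⟨a', b', c, h', h⟩)
    · simp [Nat.pair_eq_pair] at h
    · simp only [Nat.pair_eq_pair, true_and, Subtype.coe_inj] at h
      obtain ⟨rfl, rfl, rfl⟩ := h
      rw [h']
  · rintro rfl
    exact Or.inr ⟨a, b, a * b, rfl, rfl⟩

variable (A) in
theorem decidableIn_mem_universe : DecidableIn {charFun (atomicDiagram A)} fun n => n ∈ A :=
  ((decidableIn_charFun (atomicDiagram A)).comp
    (f := fun n : ℕ => Nat.pair 0 (Nat.pair n n)) (by fun_prop)).of_iff
    fun _ => mem_iff_mem_atomicDiagram.symm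

variable (A) in
theorem exists_computableIn_mul : ∃ m : ℕ × ℕ → ℕ,
    ComputableIn {charFun (atomicDiagram A)} m ∧ ∀ a b : A, m (a, b) = (a * b : A) := by
  have hA := decidableIn_mem_universe A
  -- Outside the universe every value is accepted, which makes the search for a product total.
  let p : ℕ × ℕ → ℕ → Prop := fun x n =>
    (¬ x.1 ∈ A ∨ ¬ x.2 ∈ A) ∨ Nat.pair 1 (Nat.pair x.1 (Nat.pair x.2 n)) ∈ atomicDiagram A
  have hp : DecidableIn {charFun (atomicDiagram A)} fun x : (ℕ × ℕ) × ℕ => p x.1 x.2 :=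
    ((hA.comp (f := fun x : (ℕ × ℕ) × ℕ => x.1.1) (by fun_prop)).not.or
      (hA.comp (f := fun x : (ℕ × ℕ) × ℕ => x.1.2) (by fun_prop)).not).or
      ((decidableIn_charFun _).comp (f := fun x : (ℕ × ℕ) × ℕ =>
        Nat.pair 1 (Nat.pair x.1.1 (Nat.pair x.1.2 x.2))) (by fun_prop))
  have hex : ∀ x, ∃ n, p x n := by
    rintro ⟨a, b⟩
    by_cases ha : a ∈ A
    · by_cases hb : b ∈ A
      · exact ⟨_, Or.inr ((mul_eq_iff_mem_atomicDiagram (a := ⟨a, ha⟩) (b := ⟨b, hb⟩)).2 rfl)⟩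
      · exact ⟨0, Or.inl (Or.inr hb)⟩
    · exact ⟨0, Or.inl (Or.inl ha)⟩
  obtain ⟨m, hm, hmul⟩ := DecidableIn.exists_choice hp hex
  refine ⟨m, hm, fun a b => ?_⟩
  have := hmul (a, b)
  simp only [p, Subtype.coe_prop, not_true_eq_false, or_self, false_or] at this
  exact mul_eq_iff_mem_atomicDiagram.1 this

/-- If membership in `J` is expressed in a group by the vanishing of some commutator in a sequence
of words, and non-membership by the conjugacy of a word to a fixed element, then `J` is computable
in every copy of the group. -/
theorem deg_le_of_mem_degreeSpectrum {G : Type*} [Group G] {J : Set ℕ} (s s' y y' g h b : G)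
    (hmem : ∀ e, e ∈ J ↔ ∃ n, Commute h (s ^ e * y ^ n * g * y' ^ n * s' ^ e))
    (hnmem : ∀ e, e ∉ J ↔ ∃ x, SemiconjBy x (h * (s ^ e * g * s' ^ e) * h * (s ^ e * g * s' ^ e)) b)
    {a : TuringDegree} (ha : a ∈ degreeSpectrum G) : deg J ≤ a := by
  obtain ⟨A, _, ⟨φ⟩, rfl⟩ := ha
  rw [deg_le_deg_iff]
  obtain ⟨m, hm, hmul⟩ := exists_computableIn_mul A
  have hA := decidableIn_mem_universe A
  set O : Set (ℕ →. ℕ) := {charFun (atomicDiagram A)}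
  -- Only the images of the finitely many parameters and the identity are built in as constants;
  -- powers come from iterated multiplication, uniformly in the exponent.
  let pw : G → ℕ → ℕ := fun c n => Nat.rec (((1 : A) : ℕ)) (fun _ i => m (i, (φ c : A))) n
  have hpw : ∀ c, ComputableIn O (pw c) := fun c =>
    .nat_rec (h := fun _ _ i => m (i, (φ c : A))) (by fun_prop) (by fun_prop) (by fun_prop)
  have hpow : ∀ c n, pw c n = (φ (c ^ n) : A) := fun c n => by
    induction n with
    | zero => simp [pw]
    | succ n ih =>
      change m (pw c n, _) = _
      rw [ih, hmul, pow_succ, map_mul]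
  have hmul' : ∀ c d : G, m ((φ c : A), (φ d : A)) = (φ (c * d) : A) := fun c d => by
    rw [hmul, map_mul]
  let u : ℕ → ℕ → ℕ := fun e n =>
    m (m (m (m (pw s e, pw y n), (φ g : A)), pw y' n), pw s' e)
  have hu : ∀ e n, u e n = (φ (s ^ e * y ^ n * g * y' ^ n * s' ^ e) : A) := fun e n => by
    simp only [u, hpow, hmul']
  have hu' : ComputableIn O fun x : ℕ × ℕ => u x.1 x.2 := by
    have := hpw s; have := hpw y; have := hpw y'; have := hpw s'
    fun_prop
  let v : ℕ → ℕ := fun e => m (m (m ((φ h : A), u e 0), (φ h : A)), u e 0)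
  have hv : ∀ e, v e = (φ (h * (s ^ e * g * s' ^ e) * h * (s ^ e * g * s' ^ e)) : A) := fun e => by
    simp only [v, hu, hmul', pow_zero, mul_one]
  have hu₀ : ComputableIn O fun e => u e 0 :=
    hu'.comp (g := fun e : ℕ => (e, 0)) (by fun_prop)
  have hv' : ComputableIn O v := by fun_prop
  have hP : DecidableIn O fun x : ℕ × ℕ => m ((φ h : A), u x.1 x.2) = m (u x.1 x.2, (φ h : A)) :=
    .eq (by fun_prop) (by fun_prop)
  have hQ : DecidableIn O fun x : ℕ × ℕ => x.2 ∈ A ∧ m (x.2, v x.1) = m ((φ b : A), x.2) :=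
    (hA.comp (by fun_prop)).and (.eq (by fun_prop) (by fun_prop))
  have hP' : ∀ e n, m ((φ h : A), u e n) = m (u e n, (φ h : A)) ↔
      Commute h (s ^ e * y ^ n * g * y' ^ n * s' ^ e) := fun e n => by
    rw [hu, hmul', hmul', Subtype.coe_inj, φ.apply_eq_iff_eq]
    rfl
  have hQ' : ∀ e, (∃ z, z ∈ A ∧ m (z, v e) = m ((φ b : A), z)) ↔ e ∉ J := fun e => by
    rw [hnmem]
    constructor
    · rintro ⟨z, hz, h⟩
      obtain ⟨x, hx⟩ := φ.surjective ⟨z, hz⟩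
      obtain rfl : z = (φ x : A) := by rw [hx]
      rw [hv, hmul', hmul', Subtype.coe_inj, φ.apply_eq_iff_eq] at h
      exact ⟨x, h⟩
    · rintro ⟨x, hx⟩
      exact ⟨(φ x : A), (φ x).2, by rw [hv, hmul', hmul', hx.eq]⟩
  have hex : ∀ e, ∃ z, m ((φ h : A), u e z) = m (u e z, (φ h : A)) ∨
      z ∈ A ∧ m (z, v e) = m ((φ b : A), z) := fun e => by
    by_cases he : e ∈ J
    · exact ((hmem e).1 he).imp fun n hn => Or.inl ((hP' e n).2 hn)
    · exact ((hQ' e).2 he).imp fun n hn => Or.inr hn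
  -- Every `e` has a witness of one of the two kinds, so the search ends. Testing whether the number
  -- found witnesses commutation then decides `e ∈ J`.
  obtain ⟨f, hf, hf'⟩ := DecidableIn.exists_choice (hP.or hQ) hex
  refine (hP.comp (f := fun e => (e, f e)) (by fun_prop)).of_iff fun e => ?_
  constructor
  · exact fun h => (hmem e).2 ⟨_, (hP' e (f e)).1 h⟩
  · intro he
    exact (hf' e).resolve_right fun h => (hQ' e).1 ⟨_, h⟩ he

end DegreeSpectrum

/-! ### Computable permutations of countable sets. -/

section ComputablePerm

variable {α β : Type*} [Primcodable α] [Primcodable β] {O : Set (ℕ →. ℕ)}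

/-- The permutations which are computable relative to `O`, together with their inverses. -/
def computablePerm (O : Set (ℕ →. ℕ)) (α : Type*) [Primcodable α] : Subgroup (Equiv.Perm α) where
  carrier := {f | ComputableIn O f ∧ ComputableIn O f.symm}
  one_mem' := ⟨ComputableIn.id', ComputableIn.id'⟩
  mul_mem' := fun hf hg => ⟨hf.1.comp hg.1, hg.2.comp hf.2⟩
  inv_mem' := fun hf => ⟨hf.2, hf.1⟩

/-- The computable permutations of a denumerable type act on its codes. -/
def computablePermNat (O : Set (ℕ →. ℕ)) (α : Type*) [Denumerable α] :
    computablePerm O α →* computablePerm O ℕ :=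
  (((Denumerable.eqv α).permCongrHom.toMonoidHom).comp (computablePerm O α).subtype).codRestrict _
    fun f => by
      have h₁ := f.2.1
      have h₂ := f.2.2
      exact ⟨(by fun_prop : ComputableIn O fun n => Encodable.encode (f.1 (Denumerable.ofNat α n))),
        (by fun_prop : ComputableIn O fun n => Encodable.encode (f.1.symm (Denumerable.ofNat α n)))⟩

theorem computablePermNat_apply {δ : Type*} [Denumerable δ] (f : computablePerm O δ) (n : ℕ) :
    (computablePermNat O δ f).1 n = Encodable.encode (f.1 (Denumerable.ofNat δ n)) := rfl

theorem computablePermNat_injective {δ : Type*} [Denumerable δ] :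
    Function.Injective (computablePermNat O δ) := fun f g h => by
  ext x
  have : (computablePermNat O δ f).1 (Encodable.encode x) =
    (computablePermNat O δ g).1 (Encodable.encode x) := by rw [h]
  simpa [computablePermNat_apply] using this

theorem computableIn_count {p : ℕ → Prop} [DecidablePred p] (hp : DecidableIn O p) :
    ComputableIn O (Nat.count p) := by
  have hp' : ComputableIn O fun x : ℕ × ℕ × ℕ => if p x.2.1 then 1 else 0 :=
    .ite' (hp.comp (f := fun x : ℕ × ℕ × ℕ => x.2.1) (by fun_prop)) (.const _) (.const _)
  refine (ComputableIn.nat_rec (f := fun n : ℕ => n) (g := fun _ => 0)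
    (h := fun _ i c => c + if p i then 1 else 0) (by fun_prop) (by fun_prop)
    (by fun_prop)).of_eq fun n => ?_
  induction n with
  | zero => simp
  | succ n ih => simp only [Nat.count_succ, ← ih]

theorem computableIn_nth {p : ℕ → Prop} (hp : DecidableIn O p) (hinf : {n | p n}.Infinite) :
    ComputableIn O (Nat.nth p) := by
  classical
  have hc := computableIn_count hp
  have hp' : DecidableIn O fun x : ℕ × ℕ => p x.2 ∧ Nat.count p x.2 = x.1 :=
    (hp.comp (by fun_prop)).and (.eq (by fun_prop) (by fun_prop))
  obtain ⟨f, hf, hf'⟩ := hp'.exists_choice (p := fun k n => p n ∧ Nat.count p n = k)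
    fun k => ⟨_, Nat.nth_mem_of_infinite hinf k, Nat.count_nth_of_infinite hinf k⟩
  exact hf.of_eq fun k => by
    conv_rhs => rw [← (hf' k).2]
    rw [Nat.nth_count (hf' k).1]

/-- A decidable infinite coinfinite set is carried to the even numbers by a computable bijection. -/
theorem exists_perm_iff_even {p : ℕ → Prop} (hp : DecidableIn O p)
    (hinf : {n | p n}.Infinite) (hinf' : {n | ¬ p n}.Infinite) : ∃ f : ℕ ≃ ℕ, ComputableIn O f ∧
      ComputableIn O f.symm ∧ ∀ n, p n ↔ Even (f n) := by
  classical
  have h₁ := computableIn_count hp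
  have h₂ := computableIn_count hp.not
  have h₃ := computableIn_nth hp hinf
  have h₄ := computableIn_nth hp.not hinf'
  -- The `k`-th element of the set goes to `2 * k` and the `k`-th element of its complement to `2 *
  -- k + 1`.
  refine ⟨⟨fun n => if p n then 2 * Nat.count p n else 2 * Nat.count (fun n => ¬ p n) n + 1,
    fun m => if m % 2 = 0 then Nat.nth p (m / 2) else Nat.nth (fun n => ¬ p n) (m / 2),
    fun n => ?_, fun m => ?_⟩, .ite' hp (by fun_prop) (by fun_prop),
    .ite (by fun_prop) (by fun_prop) (by fun_prop), fun n => ?_⟩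
  · by_cases h : p n
    · simp [h, Nat.nth_count (p := p) h]
    · have : (2 * Nat.count (fun n => ¬ p n) n + 1) / 2 = Nat.count (fun n => ¬ p n) n := by omega
      simp only [h, if_false, Nat.mul_add_mod_self_left, this]
      exact Nat.nth_count (p := fun n => ¬ p n) h
  · rcases Nat.even_or_odd' m with ⟨k, rfl | rfl⟩
    · simp [Nat.nth_mem_of_infinite hinf k, Nat.count_nth_of_infinite hinf]
    · have h := Nat.nth_mem_of_infinite hinf' k
      have hk : (2 * k + 1) / 2 = k := by omega
      simp only [Nat.mul_add_mod_self_left, hk]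
      simp only [Nat.one_mod, one_ne_zero, if_false, h, Nat.add_right_cancel_iff]
      rw [Nat.count_nth_of_infinite hinf']
  · by_cases h : p n <;> simp [h]

theorem exists_equiv_iff_even {δ : Type*} [Denumerable δ] {p : δ → Prop} (hp : DecidableIn O p)
    (hinf : {x | p x}.Infinite) (hinf' : {x | ¬ p x}.Infinite) : ∃ f : δ ≃ ℕ, ComputableIn O f ∧
      ComputableIn O f.symm ∧ ∀ x, p x ↔ Even (f x) := by
  have hs : ∀ q : δ → Prop, {x | q x}.Infinite → {n | q (Denumerable.ofNat δ n)}.Infinite :=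
    fun q hq => hq.preimage (f := (Denumerable.eqv δ).symm) (by
      rw [(Denumerable.eqv δ).symm.surjective.range_eq]; exact Set.subset_univ _)
  obtain ⟨f, h₁, h₂, h₃⟩ := exists_perm_iff_even
    (hp.comp (f := fun n => Denumerable.ofNat δ n) (by fun_prop)) (hs _ hinf) (hs _ hinf')
  refine ⟨(Denumerable.eqv δ).trans f,
    (by fun_prop : ComputableIn O fun a : δ => f (Encodable.encode a)),
    (by fun_prop : ComputableIn O fun n => Denumerable.ofNat δ (f.symm n)), fun x => ?_⟩
  rw [Equiv.trans_apply, ← h₃]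
  simp [Denumerable.eqv]

/-- A decidable infinite coinfinite set is carried to any other by a computable permutation. -/
theorem exists_mem_computablePerm {δ : Type*} [Denumerable δ] {p q : δ → Prop}
    (hp : DecidableIn O p) (hp₁ : {x | p x}.Infinite) (hp₂ : {x | ¬ p x}.Infinite)
    (hq : DecidableIn O q) (hq₁ : {x | q x}.Infinite) (hq₂ : {x | ¬ q x}.Infinite) :
    ∃ f ∈ computablePerm O δ, ∀ x, p x ↔ q (f x) := by
  obtain ⟨f, h₁, h₂, h₃⟩ := exists_equiv_iff_even hp hp₁ hp₂
  obtain ⟨g, h₁', h₂', h₃'⟩ := exists_equiv_iff_even hq hq₁ hq₂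
  exact ⟨f.trans g.symm, ⟨h₂'.comp h₁, h₂.comp h₁'⟩, fun x => by simp [h₃, h₃']⟩

end ComputablePerm

/-! ### Permutations of blocks and inside blocks. -/

section BlockPerm

variable {α : Type*}

/-- The permutation of `α × ℕ` which acts on the first coordinate only. -/
def blockPerm (f : Equiv.Perm α) : Equiv.Perm (α × ℕ) := f.prodCongr 1

/-- The permutation of `α × ℕ` which acts by `c` on the fibres over the set defined by `p`. -/
def slotPerm (p : α → Prop) [DecidablePred p] (c : Equiv.Perm ℕ) : Equiv.Perm (α × ℕ) :=
  (1 : Equiv.Perm α).prodShear fun x => if p x then c else 1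

theorem blockPerm_apply (f : Equiv.Perm α) (x : α × ℕ) : blockPerm f x = (f x.1, x.2) := rfl

theorem slotPerm_apply (p : α → Prop) [DecidablePred p] (c : Equiv.Perm ℕ) (x : α × ℕ) :
    slotPerm p c x = (x.1, if p x.1 then c x.2 else x.2) := by
  by_cases h : p x.1 <;> simp [slotPerm, h]

theorem blockPerm_mul (f g : Equiv.Perm α) : blockPerm (f * g) = blockPerm f * blockPerm g := rfl

theorem blockPerm_pow (f : Equiv.Perm α) (n : ℕ) : blockPerm (f ^ n) = blockPerm f ^ n := by
  induction n with
  | zero => rfl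
  | succ n ih => rw [pow_succ, pow_succ, blockPerm_mul, ih]

theorem semiconjBy_blockPerm {p q : α → Prop} [DecidablePred p] [DecidablePred q]
    {f : Equiv.Perm α} (h : ∀ x, p x ↔ q (f x)) (c : Equiv.Perm ℕ) :
    SemiconjBy (blockPerm f) (slotPerm p c) (slotPerm q c) := by
  ext x <;> simp [slotPerm_apply, blockPerm_apply, h]

/-- On a common fibre the two maps act as `c` and `d`, which do not commute; on every other fibre
one of them is trivial. Commutation thus detects disjointness of the two sets. -/
theorem commute_slotPerm_iff {p q : α → Prop} [DecidablePred p] [DecidablePred q]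
    {c d : Equiv.Perm ℕ} (h : ¬ Commute c d) :
    Commute (slotPerm p c) (slotPerm q d) ↔ ∀ x, ¬ (p x ∧ q x) := by
  constructor
  · rintro hcomm x ⟨hp, hq⟩
    refine h (Equiv.ext fun n => ?_)
    have := congrArg Prod.snd (Equiv.congr_fun hcomm.eq (x, n))
    simpa [slotPerm_apply, hp, hq] using this
  · intro h
    ext x
    · simp [slotPerm_apply]
    · have := h x.1
      by_cases hp : p x.1 <;> by_cases hq : q x.1 <;> simp_all [slotPerm_apply]

/-- On a fibre outside the intersection the word collapses to `c * c`, to `d * d` or to `1`, all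
trivial. So a group word produces the intersection of two sets. -/
theorem slotPerm_mul_mul_mul {p q : α → Prop} [DecidablePred p] [DecidablePred q]
    [DecidablePred fun x => p x ∧ q x]
    {c d : Equiv.Perm ℕ} (hc : c * c = 1) (hd : d * d = 1) :
    slotPerm p c * slotPerm q d * slotPerm p c * slotPerm q d =
      slotPerm (fun x => p x ∧ q x) (c * d * c * d) := by
  have hc' : ∀ n, c (c n) = n := fun n => Equiv.congr_fun hc n
  have hd' : ∀ n, d (d n) = n := fun n => Equiv.congr_fun hd n
  ext x
  · simp [slotPerm_apply]
  · by_cases hp : p x.1 <;> by_cases hq : q x.1 <;> simp [slotPerm_apply, hp, hq, hc', hd']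

theorem slotPerm_symm (p : α → Prop) [DecidablePred p] (c : Equiv.Perm ℕ) :
    (slotPerm p c).symm = slotPerm p c.symm := by
  refine Equiv.ext fun x => ?_
  rw [Equiv.symm_apply_eq, slotPerm_apply, slotPerm_apply]
  by_cases h : p x.1 <;> simp [h]

variable [Primcodable α] {O : Set (ℕ →. ℕ)}

theorem blockPerm_mem {f : Equiv.Perm α} (hf : f ∈ computablePerm O α) :
    blockPerm f ∈ computablePerm O (α × ℕ) := by
  have h₁ := hf.1
  have h₂ := hf.2
  exact ⟨(by fun_prop : ComputableIn O fun x : α × ℕ => (f x.1, x.2)),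
    (by fun_prop : ComputableIn O fun x : α × ℕ => (f.symm x.1, x.2))⟩

theorem slotPerm_mem {p : α → Prop} [DecidablePred p] {c : Equiv.Perm ℕ} (hp : DecidableIn O p)
    (hc : c ∈ computablePerm O ℕ) : slotPerm p c ∈ computablePerm O (α × ℕ) := by
  have key : ∀ {c : Equiv.Perm ℕ}, ComputableIn O c → ComputableIn O (slotPerm p c) := fun {c} hc =>
    (((ComputableIn.fst (O := O)).pair (.ite' (hp.comp (f := fun x : α × ℕ => x.1) (by fun_prop))
      (hc.comp .snd) .snd)).of_eq fun x => (slotPerm_apply p c x).symm)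
  exact ⟨key hc.1, by rw [slotPerm_symm]; exact key hc.2⟩

theorem prodCongr_mem {β : Type*} [Primcodable β] {f : Equiv.Perm α} {g : Equiv.Perm β}
    (hf : f ∈ computablePerm O α) (hg : g ∈ computablePerm O β) :
    f.prodCongr g ∈ computablePerm O (α × β) := by
  have h₁ := hf.1
  have h₂ := hf.2
  have h₃ := hg.1
  have h₄ := hg.2
  exact ⟨(by fun_prop : ComputableIn O fun x : α × β => (f x.1, g x.2)),
    (by fun_prop : ComputableIn O fun x : α × β => (f.symm x.1, g.symm x.2))⟩

theorem swap_mem [DecidableEq α] (a b : α) : Equiv.swap a b ∈ computablePerm O α := by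
  have : ComputableIn O (Equiv.swap a b) :=
    (ComputableIn.ite (c := fun x => x = a) (by fun_prop) (.const b)
      (.ite (c := fun x => x = b) (by fun_prop) (.const a) .id'))
  exact ⟨this, by rw [Equiv.symm_swap]; exact this⟩

/-- The permutation with the single orbit `…, 3, 1, 0, 2, 4, …`. -/
def zigzag : Equiv.Perm ℕ where
  toFun n := if n % 2 = 0 then n + 2 else if n = 1 then 0 else n - 2
  invFun n := if n % 2 = 1 then n + 2 else if n = 0 then 1 else n - 2
  left_inv n := by grind
  right_inv n := by grind

theorem zigzag_mem : zigzag ∈ computablePerm O ℕ :=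
  ⟨.ite (by fun_prop) (by fun_prop) (.ite (by fun_prop) (by fun_prop) (by fun_prop)),
    .ite (by fun_prop) (by fun_prop) (.ite (by fun_prop) (by fun_prop) (by fun_prop))⟩

/-- The odd numbers supply the negative half of the orbit, so the one-sided shift of the even
numbers is part of a permutation. This is why rows and positions are coded by even numbers below. -/
theorem zigzag_pow (n k : ℕ) : (zigzag ^ n) (2 * k) = 2 * (k + n) := by
  induction n with
  | zero => rfl
  | succ n ih =>
    rw [pow_succ', Equiv.Perm.mul_apply, ih]
    simp [zigzag]
    ring

end BlockPerm

theorem prodCongr_one_pow {β : Type*} (f : Equiv.Perm α) (n : ℕ) :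
    f.prodCongr (1 : Equiv.Perm β) ^ n = (f ^ n).prodCongr 1 := by
  induction n with
  | zero => rfl
  | succ n ih => rw [pow_succ, ih, pow_succ]; rfl

theorem one_prodCongr_pow {β : Type*} (f : Equiv.Perm α) (n : ℕ) :
    Equiv.prodCongr (1 : Equiv.Perm β) f ^ n = Equiv.prodCongr 1 (f ^ n) := by
  induction n with
  | zero => rfl
  | succ n ih => rw [pow_succ, ih, pow_succ]; rfl

theorem infinite_setOf_ofNat {δ : Type*} [Denumerable δ] {p : δ → Prop} (h : {x | p x}.Infinite) :
    {n | p (Denumerable.ofNat δ n)}.Infinite :=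
  h.preimage (f := (Denumerable.eqv δ).symm) (by
    rw [(Denumerable.eqv δ).symm.surjective.range_eq]; exact Set.subset_univ _)

theorem finite_setOf_ofNat {δ : Type*} [Denumerable δ] {p : δ → Prop} (h : {x | p x}.Finite) :
    {n | p (Denumerable.ofNat δ n)}.Finite :=
  h.preimage (f := (Denumerable.eqv δ).symm) (Denumerable.eqv δ).symm.injective.injOn

theorem computablePermNat_apply_eq_iff {δ : Type*} [Denumerable δ] {O : Set (ℕ →. ℕ)}
    (f : computablePerm O δ) (n : ℕ) :
    (computablePermNat O δ f).1 n = n ↔ f.1 (Denumerable.ofNat δ n) = Denumerable.ofNat δ n := by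
  rw [computablePermNat_apply]
  exact ((Denumerable.eqv δ).eq_symm_apply).symm

/-! ### Coding the second jump into groups that contain the computable permutations. -/

open Classical in
/-- A group which contains the `D`-computable permutations of `ℕ`, in such a way that permutations
of finite support are not conjugate to permutations with infinite coinfinite support, computes the
second jump of `D`. -/
theorem deg_jump_jump_le {G : Type*} [Group G] {D : Set ℕ}
    (Φ : computablePerm {charFun D} ℕ →* G) (hΦ : Function.Injective Φ)
    (hconj : ∀ f f' x, SemiconjBy x (Φ f) (Φ f') → {n | f.1 n ≠ n}.Finite →
      {n | f'.1 n ≠ n}.Infinite → {n | f'.1 n = n}.Infinite → False)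
    {a : TuringDegree} (ha : a ∈ degreeSpectrum G) : deg (jump (jump D)) ≤ a := by
  obtain ⟨R, hR, hRJ⟩ := exists_mem_jump_jump_iff_finite D
  let Ψ := Φ.comp (computablePermNat {charFun D} ((ℕ × ℕ) × ℕ))
  have hΨ : Function.Injective Ψ := hΦ.comp computablePermNat_injective
  let c : Equiv.Perm ℕ := Equiv.swap 0 1
  let d : Equiv.Perm ℕ := Equiv.swap 1 2
  have hcd : ¬ Commute c d := fun h => by
    have := Equiv.congr_fun h.eq 0
    simp [c, d, Equiv.swap_apply_def] at this
  have hc : c ∈ computablePerm {charFun D} ℕ := swap_mem 0 1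
  have hd : d ∈ computablePerm {charFun D} ℕ := swap_mem 1 2
  have hcdcd : c * d * c * d ∈ computablePerm {charFun D} ℕ :=
    mul_mem (mul_mem (mul_mem hc hd) hc) hd
  -- The pair `(e, m)` is represented by the block `(2 * e, 2 * m)`. Blocks with an odd coordinate
  -- make room for `zigzag` and keep the sets in use coinfinite.
  let p : ℕ × ℕ → Prop := fun x => (x.1 % 2 = 0 ∧ x.2 % 2 = 0) ∧ R (x.1 / 2) (x.2 / 2)
  let q : ℕ → ℕ → ℕ × ℕ → Prop := fun e n x => x.1 = 2 * e ∧ x.2 % 2 = 0 ∧ 2 * n ≤ x.2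
  have hp : DecidableIn {charFun D} p := ((DecidableIn.eq (by fun_prop) (by fun_prop)).and
    (.eq (by fun_prop) (by fun_prop))).and (hR.comp (f := fun x : ℕ × ℕ => (x.1 / 2, x.2 / 2))
      (by fun_prop))
  have hq : ∀ e n, DecidableIn {charFun D} (q e n) := fun e n => (DecidableIn.eq (by fun_prop)
    (by fun_prop)).and ((DecidableIn.eq (by fun_prop) (by fun_prop)).and
    ((DecidableIn.of_bool (by fun_prop : ComputableIn {charFun D} fun x : ℕ × ℕ =>
      decide (2 * n ≤ x.2))).of_iff fun x => by simp))
  have hpq : ∀ e n x, p x ∧ q e n x ↔ ∃ m ≥ n, x = (2 * e, 2 * m) ∧ R e m := by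
    rintro e n ⟨i, j⟩
    constructor
    · rintro ⟨⟨⟨-, -⟩, h⟩, h₁, h₂, h₃⟩
      dsimp only at h h₁ h₂ h₃
      subst h₁
      rw [Nat.mul_div_cancel_left _ two_pos] at h
      exact ⟨j / 2, by omega, by rw [Prod.mk.injEq]; omega, h⟩
    · rintro ⟨m, hm, h, hR⟩
      rw [Prod.mk.injEq] at h
      obtain ⟨rfl, rfl⟩ := h
      exact ⟨⟨by simp, by simpa using hR⟩, rfl, by simp, by simpa using hm⟩
  let s : computablePerm {charFun D} ((ℕ × ℕ) × ℕ) :=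
    ⟨_, blockPerm_mem (prodCongr_mem zigzag_mem (one_mem (computablePerm {charFun D} ℕ)))⟩
  let y : computablePerm {charFun D} ((ℕ × ℕ) × ℕ) :=
    ⟨_, blockPerm_mem (prodCongr_mem (one_mem (computablePerm {charFun D} ℕ)) zigzag_mem)⟩
  let h : computablePerm {charFun D} ((ℕ × ℕ) × ℕ) := ⟨_, slotPerm_mem hp hc⟩
  let g : ℕ → ℕ → computablePerm {charFun D} ((ℕ × ℕ) × ℕ) :=
    fun e n => ⟨_, slotPerm_mem (hq e n) hd⟩
  let k : ℕ → computablePerm {charFun D} ((ℕ × ℕ) × ℕ) :=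
    fun e => ⟨_, slotPerm_mem (hp.and (hq e 0)) hcdcd⟩
  let b : computablePerm {charFun D} ((ℕ × ℕ) × ℕ) := ⟨_, slotPerm_mem (hq 0 0) hcdcd⟩
  -- The shift `s` changes the row and `y` the position. Conjugation by `s ^ e * y ^ n` carries the
  -- even half-row `2 * 0 ≤ x.2` of row `0` onto the half-row of row `2 * e` that starts at `2 * n`.
  have hg : ∀ e n, s ^ e * y ^ n * g 0 0 * y⁻¹ ^ n * s⁻¹ ^ e = g e n := by
    intro e n
    have hu : (s ^ e * y ^ n).1 = blockPerm ((zigzag ^ e).prodCongr (zigzag ^ n)) := by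
      change (blockPerm _) ^ e * (blockPerm _) ^ n = _
      rw [← blockPerm_pow, ← blockPerm_pow, ← blockPerm_mul, prodCongr_one_pow, one_prodCongr_pow]
      rfl
    have hsemi : SemiconjBy (s ^ e * y ^ n) (g 0 0) (g e n) := by
      refine Subtype.ext ?_
      change (s ^ e * y ^ n).1 * (g 0 0).1 = (g e n).1 * (s ^ e * y ^ n).1
      rw [hu]
      refine semiconjBy_blockPerm (fun x => ?_) d
      refine and_congr ?_ ?_
      · change _ ↔ (zigzag ^ e) x.1 = 2 * e
        have := zigzag_pow e 0
        rw [mul_zero, zero_add] at this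
        rw [← this, (zigzag ^ e).apply_eq_iff_eq]
        simp
      · change _ ↔ (zigzag ^ n) x.2 % 2 = 0 ∧ 2 * n ≤ (zigzag ^ n) x.2
        constructor
        · rintro ⟨hx, -⟩
          obtain ⟨m, hm⟩ : ∃ m, x.2 = 2 * m := ⟨x.2 / 2, by omega⟩
          rw [hm, zigzag_pow]
          omega
        · rintro ⟨h₁, h₂⟩
          have hm : (zigzag ^ n) x.2 = 2 * (((zigzag ^ n) x.2 / 2 - n) + n) := by omega
          rw [← zigzag_pow, (zigzag ^ n).apply_eq_iff_eq] at hm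
          omega
    rw [inv_pow, inv_pow, mul_assoc _ (y ^ n)⁻¹, ← mul_inv_rev, hsemi.eq, mul_inv_cancel_right]
  have hk : ∀ e, h * g e 0 * h * g e 0 = k e := fun e =>
    Subtype.ext (slotPerm_mul_mul_mul (Equiv.swap_mul_self 0 1) (Equiv.swap_mul_self 1 2))
  refine deg_le_of_mem_degreeSpectrum (Ψ s) (Ψ s⁻¹) (Ψ y) (Ψ y⁻¹) (Ψ (g 0 0)) (Ψ h) (Ψ b)
    (fun e => ?_) (fun e => ?_) ha
  · rw [hRJ]
    have : ∀ n, Commute (Ψ h) (Ψ s ^ e * Ψ y ^ n * Ψ (g 0 0) * Ψ y⁻¹ ^ n * Ψ s⁻¹ ^ e) ↔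
        ∀ m ≥ n, ¬ R e m := by
      intro n
      simp only [← map_pow, ← map_mul, hg]
      have h₁ : Commute (Ψ h) (Ψ (g e n)) ↔ Commute h.1 (g e n).1 := by
        rw [commute_iff_eq, ← map_mul, ← map_mul, hΨ.eq_iff, Subtype.ext_iff]
        rfl
      rw [h₁, commute_slotPerm_iff hcd]
      simp only [hpq, not_exists]
      exact ⟨fun h m hm hR => h _ m ⟨hm, rfl, hR⟩, fun h x m hm => h m hm.1 hm.2.2⟩
    simp only [this]
    constructor
    · intro hfin
      obtain ⟨n, hn⟩ := hfin.bddAbove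
      exact ⟨n + 1, fun m hm hR => absurd (hn hR) (by omega)⟩
    · rintro ⟨n, hn⟩
      exact (Set.finite_Iio n).subset fun m hm => not_le.1 fun h => hn m h hm
  · have hk' : Ψ h * (Ψ s ^ e * Ψ (g 0 0) * Ψ s⁻¹ ^ e) * Ψ h * (Ψ s ^ e * Ψ (g 0 0) * Ψ s⁻¹ ^ e) =
        Ψ (k e) := by
      have := hg e 0
      rw [pow_zero, pow_zero, mul_one, mul_one] at this
      simp only [← map_pow, ← map_mul, this, hk]
    rw [hk', hRJ]
    have hb₁ : {x | q 0 0 x}.Infinite :=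
      Set.infinite_of_injective_forall_mem (f := fun n : ℕ => (0, 2 * n))
        (fun m n h => by simpa using h) fun n => by simp [q]
    have hb₂ : {x | ¬ q 0 0 x}.Infinite :=
      Set.infinite_of_injective_forall_mem (f := fun n : ℕ => (1, n))
        (fun m n h => by simpa using h) fun n => by simp [q]
    constructor
    · intro hinf
      have hk₁ : {x | p x ∧ q e 0 x}.Infinite := by
        simp only [hpq]
        refine ((Set.Infinite.image (f := fun n : ℕ => (2 * e, 2 * n)) ?_ hinf)).mono ?_
        · exact (fun m _ n _ h => by simpa using h)
        · rintro _ ⟨m, hm, rfl⟩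
          exact ⟨m, by simp, rfl, hm⟩
      have hk₂ : {x | ¬ (p x ∧ q e 0 x)}.Infinite :=
        Set.infinite_of_injective_forall_mem (f := fun n : ℕ => (1, n))
          (fun m n h => by simpa using h) fun n => by simp [p]
      -- If the row is infinite, both 3-cycles live over decidable infinite coinfinite sets of
      -- blocks, and a computable permutation of the blocks conjugates one into the other.
      obtain ⟨f, hf, hfpq⟩ := exists_mem_computablePerm (hp.and (hq e 0)) hk₁ hk₂ (hq 0 0) hb₁ hb₂
      refine ⟨Ψ ⟨_, blockPerm_mem hf⟩, SemiconjBy.map (y := b) (Subtype.ext ?_) Ψ⟩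
      exact semiconjBy_blockPerm hfpq _
    · rintro ⟨x, hx⟩ hfin
      -- The word moves `0` and fixes everything from `3` on. Over a finite row the support is then
      -- finite, while `b` moves infinitely many points and fixes infinitely many.
      have hc₀ : (c * d * c * d) 0 ≠ 0 := by simp [c, d, Equiv.swap_apply_def]
      have hc₃ : ∀ j, 3 ≤ j → (c * d * c * d) j = j := fun j hj => by
        have h₁ : c j = j := Equiv.swap_apply_of_ne_of_ne (by omega) (by omega)
        have h₂ : d j = j := Equiv.swap_apply_of_ne_of_ne (by omega) (by omega)
        simp [h₁, h₂]
      refine hconj _ _ x hx ?_ ?_ ?_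
      · simp only [ne_eq, computablePermNat_apply_eq_iff]
        refine finite_setOf_ofNat (p := fun x => ¬ (k e).1 x = x) (((hfin.image fun n : ℕ =>
          (2 * e, 2 * n)).prod (Set.finite_Iio 3)).subset fun x hx => ?_)
        change ¬ slotPerm (fun x => p x ∧ q e 0 x) _ _ = _ at hx
        rw [slotPerm_apply] at hx
        split_ifs at hx with hx'
        · obtain ⟨m, -, hm, hR⟩ := (hpq e 0 x.1).1 hx'
          refine ⟨⟨m, hR, hm.symm⟩, not_le.1 fun hx₃ => hx (Prod.ext rfl (hc₃ _ hx₃))⟩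
        · exact absurd rfl hx
      · simp only [ne_eq, computablePermNat_apply_eq_iff]
        refine infinite_setOf_ofNat (p := fun x => ¬ b.1 x = x) ((hb₁.image
          (f := fun y => (y, 0)) fun y _ z _ h => (Prod.mk.inj h).1).mono ?_)
        rintro _ ⟨y, hy, rfl⟩ hy'
        have := congrArg Prod.snd ((slotPerm_apply _ _ (y, 0)).symm.trans hy')
        exact hc₀ ((if_pos hy).symm.trans this)
      · simp only [computablePermNat_apply_eq_iff]
        refine infinite_setOf_ofNat (p := fun x => b.1 x = x) ((hb₂.image
          (f := fun y => (y, 0)) fun y _ z _ h => (Prod.mk.inj h).1).mono ?_)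
        rintro _ ⟨y, hy, rfl⟩
        exact (slotPerm_apply _ _ _).trans (Prod.ext rfl (if_neg hy))

theorem ComputableIn.exists_bound {O : Set (ℕ →. ℕ)} {f : ℕ → ℕ} (hf : ComputableIn O f) :
    ∃ N : ℕ → ℕ, ComputableIn O N ∧ ∀ m, ∀ i < m, f i < N m := by
  refine ⟨_, .nat_rec (f := fun m : ℕ => m) (g := fun _ => 0) (h := fun _ i M => max M (f i + 1))
    (by fun_prop) (by fun_prop) (by fun_prop), fun m => ?_⟩
  induction m with
  | zero => simp
  | succ m ih =>
    intro i hi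
    rcases Nat.lt_succ_iff_lt_or_eq.1 hi with hi | rfl
    · exact lt_max_of_lt_left (ih i hi)
    · exact lt_max_of_lt_right (Nat.lt_succ_self _)

/-! ### Computable permutations as semilinear transformations. -/

section SemilinearGroup

variable {F : Type*} [Field F] {ν : ℕ → F} {D : Set ℕ}

theorem GSL.map_add {hν : IsComputableField ν} (φ : GSL ν hν D) (u v : ℕ →₀ F) :
    φ.1.1 (u + v) = φ.1.1 u + φ.1.1 v := by
  have := φ.2.1 1 1 u v
  simpa using this

theorem GSL.map_smul {hν : IsComputableField ν} (φ : GSL ν hν D) (α : F) (v : ℕ →₀ F) :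
    φ.1.1 (α • v) = φ.1.2 α • φ.1.1 v := by
  have := φ.2.1 α 0 v 0
  simpa using this

/-- A semilinear transformation as a homomorphism of the additive group. -/
noncomputable def GSL.toAddMonoidHom {hν : IsComputableField ν} (φ : GSL ν hν D) : (ℕ →₀ F) →+ (ℕ →₀ F) :=
  AddMonoidHom.mk' φ.1.1 (GSL.map_add φ)

/-- By semilinearity `φ v` is a combination of the images of the basis vectors in the support of
`v`, so a nonzero coordinate must come from one of these. -/
theorem GSL.exists_apply_single_ne_zero {hν : IsComputableField ν} (φ : GSL ν hν D)
    {v : ℕ →₀ F} {i : ℕ} (h : φ.1.1 v i ≠ 0) : ∃ j ∈ v.support, φ.1.1 (Finsupp.single j 1) i ≠ 0 := by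
  by_contra! hall
  have hv : v = ∑ j ∈ v.support, v j • Finsupp.single j (1 : F) := by
    conv_lhs => rw [← v.sum_single]
    simp [Finsupp.sum]
  refine h ?_
  have h₁ : φ.1.1 v = ∑ j ∈ v.support, φ.1.1 (v j • Finsupp.single j (1 : F)) := by
    conv_lhs => rw [hv]
    exact map_sum (GSL.toAddMonoidHom φ) _ _
  rw [h₁, Finsupp.finsetSum_apply]
  exact Finset.sum_eq_zero fun j hj => by rw [GSL.map_smul φ, Finsupp.smul_apply, hall j hj, smul_zero]

theorem isComputableMap_equivMapDomain (hν : IsComputableField ν) {f : Equiv.Perm ℕ}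
    (hf : f ∈ computablePerm {charFun D} ℕ) :
    IsComputableMap D (vecNumbering ν) (Finsupp.equivMapDomain f) := by
  obtain ⟨z, hz⟩ := hν.surjective 0
  have hf₁ : ComputableIn {charFun D} f := hf.1
  have hf₂ : ComputableIn {charFun D} f.symm := hf.2
  let l : ℕ → List ℕ := Denumerable.ofNat (List ℕ)
  obtain ⟨N, hN, hlt⟩ := ComputableIn.exists_bound hf₁
  -- The bound `N` exceeds the images of all positions of the list. Beyond it `f.symm j` falls off
  -- the end of the old list, where the entry is zero.
  refine ⟨fun n => Encodable.encode ((List.range (N (l n).length)).map fun j =>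
    (l n).getD (f.symm j) z), ?_, fun n => ?_⟩
  · have h : ComputableIn {charFun D} fun n => (List.range (N (l n).length)).map fun j =>
        (l n).getD (f.symm j) z :=
      .map_range (g := fun n j => (l n).getD (f.symm j) z) (by fun_prop) (by fun_prop)
    exact (by fun_prop : ComputableIn {charFun D} fun n =>
      Encodable.encode ((List.range (N (l n).length)).map fun j => (l n).getD (f.symm j) z))
  · ext i
    rw [Finsupp.equivMapDomain_apply, vecNumbering_apply ν hz, vecNumbering_apply ν hz,
      Denumerable.ofNat_encode]
    congr 1
    rcases lt_or_ge i (N (l n).length) with hi | hi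
    · simp [List.getD_eq_getElem?_getD, hi, l]
    · rw [List.getD_eq_default _ _ (by simpa using hi), List.getD_eq_default]
      by_contra h
      have := hlt _ _ (not_le.1 h)
      rw [Equiv.apply_symm_apply] at this
      exact absurd this hi.not_gt

/-- The computable permutations of the coordinates are semilinear transformations. -/
noncomputable def GSL.ofPerm (hν : IsComputableField ν) : computablePerm {charFun D} ℕ →* GSL ν hν D where
  toFun f := ⟨((Finsupp.domLCongr (R := F) (M := F) f.1).toEquiv, 1), fun α β u v => by
      exact Finsupp.ext fun i => rfl, isComputableMap_equivMapDomain hν f.2, IsComputableMap.id D ν⟩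
  map_one' := by
    refine Subtype.ext (Prod.ext (Equiv.ext fun v => ?_) rfl)
    exact Finsupp.equivMapDomain_refl v
  map_mul' f g := by
    refine Subtype.ext (Prod.ext (Equiv.ext fun v => ?_) (one_mul 1).symm)
    exact Finsupp.equivMapDomain_trans g.1 f.1 v

theorem GSL.ofPerm_apply (hν : IsComputableField ν) (f : computablePerm {charFun D} ℕ)
    (v : ℕ →₀ F) (i : ℕ) : (GSL.ofPerm hν f).1.1 v i = v (f.1.symm i) := rfl

theorem GSL.ofPerm_injective (hν : IsComputableField ν) :
    Function.Injective (GSL.ofPerm (D := D) hν) := by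
  intro f g h
  refine Subtype.ext (Equiv.ext fun n => ?_)
  have h₁ := GSL.ofPerm_apply hν f (Finsupp.single n 1) (f.1 n)
  rw [h, GSL.ofPerm_apply, Equiv.symm_apply_apply, Finsupp.single_eq_same] at h₁
  by_contra hne
  rw [Finsupp.single_eq_of_ne] at h₁
  · exact zero_ne_one h₁
  · exact fun h => hne ((Equiv.symm_apply_eq _).1 h)

/-- The difference `f v - v` is supported on the finitely many points moved by `f`, so its image
under `φ` is supported in a fixed finite set. If `φ v` is the `n`-th basis vector and `f'` moves
`n`, that image is `f' (φ v) - φ v`, whose `n`-th coordinate is `-1`. Hence only finitely many `n`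
can be moved by `f'`. -/
theorem GSL.not_semiconjBy_ofPerm {hν : IsComputableField ν} (f f' : computablePerm {charFun D} ℕ)
    (φ : GSL ν hν D) (h : SemiconjBy φ (GSL.ofPerm hν f) (GSL.ofPerm hν f'))
    (hf : {n | f.1 n ≠ n}.Finite) (hf' : {n | f'.1 n ≠ n}.Infinite) : False := by
  refine hf' ((hf.biUnion fun j _ => (φ.1.1 (Finsupp.single j 1)).support.finite_toSet).subset
    fun n hn => ?_)
  have hcomm : ∀ v, φ.1.1 ((GSL.ofPerm hν f).1.1 v) = (GSL.ofPerm hν f').1.1 (φ.1.1 v) :=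
    fun v => congrArg (fun ψ : GSL ν hν D => ψ.1.1 v) h.eq
  obtain ⟨v, hv⟩ := φ.1.1.surjective (Finsupp.single n 1)
  have hsub : φ.1.1 ((GSL.ofPerm hν f).1.1 v - v) n ≠ 0 := by
    have : φ.1.1 ((GSL.ofPerm hν f).1.1 v - v) =
        φ.1.1 ((GSL.ofPerm hν f).1.1 v) - φ.1.1 v := map_sub (GSL.toAddMonoidHom φ) _ _
    rw [this, hcomm, hv, Finsupp.sub_apply, GSL.ofPerm_apply, Finsupp.single_eq_same,
      Finsupp.single_eq_of_ne]
    · simp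
    · intro h
      rw [Equiv.symm_apply_eq] at h
      exact hn h.symm
  obtain ⟨j, hj, hj'⟩ := GSL.exists_apply_single_ne_zero φ hsub
  refine Set.mem_biUnion (x := j) ?_ (by simpa using hj')
  intro hfj
  rw [Finsupp.mem_support_iff, Finsupp.sub_apply, GSL.ofPerm_apply,
    (Equiv.symm_apply_eq f.1).2 hfj.symm, sub_self] at hj
  exact hj rfl

end SemilinearGroup

/-! ### Permuting the unit intervals of the rationals. -/

section FloorPerm

/-- A permutation of the natural numbers, acting on the rationals by permuting the intervals
`[n, n + 1)`. -/
def floorPermFun (f : ℕ → ℕ) (x : ℚ) : ℚ :=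
  if x < 0 then x else f ⌊x⌋₊ + (x - ⌊x⌋₊)

theorem floorPermFun_of_neg (f : ℕ → ℕ) {x : ℚ} (hx : x < 0) : floorPermFun f x = x := if_pos hx

theorem floorPermFun_of_mem (f : ℕ → ℕ) {x : ℚ} {n : ℕ} (hx : x ∈ Set.Ico (n : ℚ) (n + 1)) :
    floorPermFun f x = f n + (x - n) := by
  have h0 : 0 ≤ x := n.cast_nonneg.trans hx.1
  have : ⌊x⌋₊ = n := (Nat.floor_eq_iff h0).2 hx
  rw [floorPermFun, if_neg h0.not_gt, this]

theorem floorPermFun_mem (f : ℕ → ℕ) {x : ℚ} {n : ℕ} (hx : x ∈ Set.Ico (n : ℚ) (n + 1)) :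
    floorPermFun f x ∈ Set.Ico (f n : ℚ) (f n + 1) := by
  rw [floorPermFun_of_mem f hx]
  exact ⟨by linarith [hx.1], by linarith [hx.2]⟩

theorem neg_or_exists_mem_Ico (x : ℚ) : x < 0 ∨ ∃ n : ℕ, x ∈ Set.Ico (n : ℚ) (n + 1) := by
  rcases lt_or_ge x 0 with h | h
  · exact .inl h
  · exact .inr ⟨⌊x⌋₊, Nat.floor_le h, Nat.lt_floor_add_one x⟩

theorem floorPermFun_comp (f g : ℕ → ℕ) (x : ℚ) :
    floorPermFun f (floorPermFun g x) = floorPermFun (fun n => f (g n)) x := by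
  rcases neg_or_exists_mem_Ico x with h | ⟨n, h⟩
  · simp only [floorPermFun_of_neg _ h]
  · rw [floorPermFun_of_mem f (floorPermFun_mem g h), floorPermFun_of_mem g h,
      floorPermFun_of_mem _ h]
    ring

theorem floorPermFun_eq_self {f : ℕ → ℕ} {x : ℚ} (h : ∀ n : ℕ, x ∈ Set.Ico (n : ℚ) (n + 1) → f n = n) :
    floorPermFun f x = x := by
  rcases neg_or_exists_mem_Ico x with hx | ⟨n, hx⟩
  · exact floorPermFun_of_neg _ hx
  · rw [floorPermFun_of_mem f hx, h n hx]
    ring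

/-- The code of the rational `k + max 0 (min 1 (q - j))`. -/
def clampCode (k j : ℕ) (q : ℕ × ℕ × ℕ) : ℕ × ℕ × ℕ :=
  (k * (q.2.2 + 1) + (q.1 - (q.2.1 + j * (q.2.2 + 1)) -
    (q.1 - (q.2.1 + j * (q.2.2 + 1)) - (q.2.2 + 1))), 0, q.2.2)

/-- Truncated subtraction does the clamping: it gives the maximum with `0`, and `u - (u - w)` is the
minimum of `u` and `w`. -/
theorem ratOfCode_clampCode (k j : ℕ) (q : ℕ × ℕ × ℕ) :
    ratOfCode (clampCode k j q) = k + max 0 (min 1 (ratOfCode q - j)) := by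
  obtain ⟨x, y, z⟩ := q
  have hz : (0 : ℚ) < z + 1 := by positivity
  have hq : ratOfCode (x, y, z) - j = ((x : ℚ) - (y + j * (z + 1) : ℕ)) / (z + 1) := by
    simp only [ratOfCode]
    push_cast
    field_simp
    ring
  rw [hq]
  have hc : ratOfCode (clampCode k j (x, y, z)) = k + ((x - (y + j * (z + 1)) -
    (x - (y + j * (z + 1)) - (z + 1)) : ℕ) : ℚ) / (z + 1) := by
    simp only [ratOfCode, clampCode]
    push_cast
    field_simp
    ring
  rw [hc]
  congr 1
  generalize y + j * (z + 1) = w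
  rcases le_total x w with h | h
  · rw [max_eq_left]
    · simp [Nat.sub_eq_zero_of_le h]
    · refine min_le_of_right_le (div_nonpos_of_nonpos_of_nonneg ?_ hz.le)
      have : (x : ℚ) ≤ w := by exact_mod_cast h
      linarith
  · obtain ⟨d, rfl⟩ := Nat.exists_eq_add_of_le h
    rw [max_eq_right (le_min zero_le_one (div_nonneg (by simp) hz.le)), Nat.add_sub_cancel_left]
    rcases le_total d (z + 1) with h | h
    · rw [min_eq_right]
      · simp [Nat.sub_eq_zero_of_le h]
      · rw [div_le_one hz]
        have : (d : ℚ) ≤ (z + 1 : ℕ) := by exact_mod_cast h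
        push_cast at this ⊢
        linarith
    · have : d - (d - (z + 1)) = z + 1 := by omega
      rw [this, min_eq_left]
      · push_cast
        exact div_self hz.ne'
      · rw [le_div_iff₀ hz]
        have : ((z + 1 : ℕ) : ℚ) ≤ d := by exact_mod_cast h
        push_cast at this ⊢
        linarith

/-- Clamping has no effect on this comparison because `x - k` lies in `[0, 1)`. So the clamped code
is the end point `q` transported from `[j, j + 1)` to `[k, k + 1)`. -/
theorem ratOfCode_clampCode_le_iff {k : ℕ} (j : ℕ) (q : ℕ × ℕ × ℕ) {x : ℚ}
    (hx : x ∈ Set.Ico (k : ℚ) (k + 1)) :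
    ratOfCode (clampCode k j q) ≤ x ↔ ratOfCode q ≤ j + (x - k) := by
  rw [ratOfCode_clampCode, ← le_sub_iff_add_le', max_le_iff, min_le_iff]
  have h₁ : 0 ≤ x - k := sub_nonneg.2 hx.1
  have h₂ : ¬ 1 ≤ x - k := by linarith [hx.2]
  simp only [h₁, h₂, true_and, false_or, sub_le_iff_le_add']

theorem le_ratOfCode_clampCode (k j : ℕ) (q : ℕ × ℕ × ℕ) : (k : ℚ) ≤ ratOfCode (clampCode k j q) := by
  rw [ratOfCode_clampCode]
  simp

theorem ratOfCode_clampCode_le (k j : ℕ) (q : ℕ × ℕ × ℕ) : ratOfCode (clampCode k j q) ≤ k + 1 := by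
  rw [ratOfCode_clampCode]
  simp

/-- A list of codes for the image of an interval under the action of a permutation with inverse
`g`, where `N` bounds the images of the numbers below the end points. -/
def imageCodes (g : ℕ → ℕ) (N : ℕ) (I : Option (ℕ × ℕ × ℕ) × Option (ℕ × ℕ × ℕ)) :
    List (Option (ℕ × ℕ × ℕ) × Option (ℕ × ℕ × ℕ)) :=
  [(I.1, some ((I.2.getD 0).1 - ((I.2.getD 0).1 - (I.2.getD 0).2.1), (I.2.getD 0).2)),
    (some (N, 0, 0), I.2.map fun _ => 0)] ++
  (List.range N).map fun k =>
    (some (clampCode k (g k) (I.1.getD 0)), some (clampCode k (g k) (I.2.getD (g k + 1, 0, 0))))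

theorem ratOfCode_min (q : ℕ × ℕ × ℕ) :
    ratOfCode (q.1 - (q.1 - q.2.1), q.2) = min (ratOfCode q) 0 := by
  have hz : (0 : ℚ) < q.2.2 + 1 := by positivity
  rcases le_total q.1 q.2.1 with h | h
  · rw [min_eq_left]
    · simp [ratOfCode, Nat.sub_eq_zero_of_le h]
    · refine div_nonpos_of_nonpos_of_nonneg ?_ hz.le
      have : (q.1 : ℚ) ≤ q.2.1 := by exact_mod_cast h
      linarith
  · rw [min_eq_right]
    · simp [ratOfCode, Nat.sub_sub_self h]
    · refine div_nonneg ?_ hz.le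
      have : (q.2.1 : ℚ) ≤ q.1 := by exact_mod_cast h
      linarith

theorem ratOfCode_zero : ratOfCode 0 = 0 := by simp [ratOfCode]

theorem ratOfCode_natCast (n : ℕ) : ratOfCode (n, 0, 0) = n := by simp [ratOfCode]

theorem ratOfCode_le (q : ℕ × ℕ × ℕ) : ratOfCode q ≤ q.1 := by
  have hz : (1 : ℚ) ≤ q.2.2 + 1 := by simp
  rw [ratOfCode, div_le_iff₀ (by positivity)]
  have : (q.1 : ℚ) ≤ q.1 * (q.2.2 + 1) := le_mul_of_one_le_right (by simp) hz
  have : (0 : ℚ) ≤ q.2.1 := by simp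
  linarith

/-- The preimage splits into three pieces. Below zero nothing moves, so the interval is cut off at
`0`. For `k < N` the part in `[k, k + 1)` is a single interval with transported end points. From `N`
on, `g k` exceeds both end points, since a rational is at most the first entry of its code; so
everything there belongs to the preimage if the right end point is missing, and nothing otherwise.
The defaults fit: for nonnegative points a missing left end point may be replaced by `0`, and in the
`k`-th piece a missing right one by `g k + 1`. -/
theorem unionOfCodes_imageCodes {g : ℕ → ℕ} {N : ℕ}
    {I : Option (ℕ × ℕ × ℕ) × Option (ℕ × ℕ × ℕ)}
    (hN : ∀ k, N ≤ k → (I.1.getD 0).1 + (I.2.getD 0).1 ≤ g k) :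
    unionOfCodes (imageCodes g N I) = floorPermFun g ⁻¹' intervalOfCode I := by
  ext x
  simp only [unionOfCodes, imageCodes, Set.mem_ofPred_eq, List.mem_append, List.mem_cons,
    List.not_mem_nil, or_false, List.mem_map, List.mem_range, or_and_right, exists_or,
    exists_eq_left, Set.mem_preimage, exists_exists_and_eq_and]
  obtain ⟨a, b⟩ := I
  rcases neg_or_exists_mem_Ico x with hx | ⟨k, hx⟩
  · have h₁ : ∀ k : ℕ, ¬ (k : ℚ) ≤ x := fun k h => absurd (k.cast_nonneg.trans h) hx.not_ge
    have h₂ : ¬ ∃ k < N, x ∈ intervalOfCode (some (clampCode k (g k) (a.getD 0)),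
        some (clampCode k (g k) (b.getD (g k + 1, 0, 0)))) := by
      rintro ⟨k, -, h⟩
      exact h₁ k ((le_ratOfCode_clampCode ..).trans (((mem_intervalOfCode _ _).1 h).1 _ rfl))
    have h₃ : ¬ x ∈ intervalOfCode (some (N, 0, 0), b.map fun _ => 0) := fun h =>
      h₁ N (by simpa [ratOfCode_natCast] using ((mem_intervalOfCode _ _).1 h).1 _ rfl)
    rw [or_iff_left h₂, or_iff_left h₃, floorPermFun_of_neg _ hx, mem_intervalOfCode,
      mem_intervalOfCode]
    refine and_congr_right fun _ => ?_
    rcases b with - | b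
    · simp [hx, ratOfCode]
    · simp only [Option.mem_def, Option.some.injEq, forall_eq', Option.getD_some, ratOfCode_min,
        lt_min_iff, hx, and_true]
  · have h0 : 0 ≤ x := k.cast_nonneg.trans hx.1
    have h₁ : ¬ x ∈ intervalOfCode
        (a, some ((b.getD 0).1 - ((b.getD 0).1 - (b.getD 0).2.1), (b.getD 0).2)) := fun h => by
      have := ((mem_intervalOfCode _ _).1 h).2 _ rfl
      rw [ratOfCode_min] at this
      exact absurd (this.trans_le (min_le_right _ _)) h0.not_gt
    have h₂ : (∃ k < N, x ∈ intervalOfCode (some (clampCode k (g k) (a.getD 0)),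
        some (clampCode k (g k) (b.getD (g k + 1, 0, 0))))) ↔
        k < N ∧ ratOfCode (a.getD 0) ≤ g k + (x - k) ∧
          g k + (x - k) < ratOfCode (b.getD (g k + 1, 0, 0)) := by
      simp only [mem_intervalOfCode, Option.mem_def, Option.some.injEq, forall_eq']
      rw [← not_le (a := ratOfCode (b.getD _)), ← ratOfCode_clampCode_le_iff _ _ hx,
        ← ratOfCode_clampCode_le_iff _ _ hx, not_le]
      refine ⟨?_, fun h => ⟨k, h⟩⟩
      rintro ⟨j, hj, h₁, h₂⟩
      have h₃ : x ∈ Set.Ico (j : ℚ) (j + 1) :=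
        ⟨(le_ratOfCode_clampCode ..).trans h₁, h₂.trans_le (ratOfCode_clampCode_le ..)⟩
      have : j = k := ((Nat.floor_eq_iff h0).2 h₃).symm.trans ((Nat.floor_eq_iff h0).2 hx)
      subst this
      exact ⟨hj, h₁, h₂⟩
    have hy : (0 : ℚ) ≤ g k + (x - k) := add_nonneg (Nat.cast_nonneg _) (sub_nonneg.2 hx.1)
    have h₃ : x ∈ intervalOfCode (some (N, 0, 0), b.map fun _ => 0) ↔ N ≤ k ∧ b = none := by
      simp only [mem_intervalOfCode, Option.mem_def, Option.some.injEq, forall_eq',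
        ratOfCode_natCast]
      refine and_congr ⟨fun h => ?_, fun h => (Nat.cast_le.2 h).trans hx.1⟩ ?_
      · have := h.trans_lt hx.2
        exact Nat.lt_succ_iff.1 (by exact_mod_cast this)
      · rcases b with - | b
        · simp
        · simp [ratOfCode_zero, h0]
    rw [or_assoc, or_iff_right h₁, h₂, h₃, floorPermFun_of_mem g hx, mem_intervalOfCode]
    have ha : (∀ p ∈ a, ratOfCode p ≤ g k + (x - k)) ↔ ratOfCode (a.getD 0) ≤ g k + (x - k) := by
      rcases a with - | a
      · simp [ratOfCode_zero, hy]
      · simp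
    have hb : (∀ p ∈ b, g k + (x - k) < ratOfCode p) ↔
        g k + (x - k) < ratOfCode (b.getD (g k + 1, 0, 0)) := by
      rcases b with - | b
      · simp only [Option.not_mem_none, false_imp_iff, implies_true, Option.getD_none, true_iff]
        rw [ratOfCode_natCast]
        push_cast
        linarith [hx.2]
      · simp
    simp only at ha hb ⊢
    rw [ha, hb]
    rcases lt_or_ge k N with h | h
    · simp [h, h.not_ge]
    · simp only [h, h.not_gt, true_and, false_and, or_false]
      have hNk := hN k h
      have hle : ((a.getD 0).1 : ℚ) + (b.getD 0).1 ≤ g k := by exact_mod_cast hNk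
      have h₄ : ratOfCode (a.getD 0) ≤ g k + (x - k) := by
        have := ratOfCode_le (a.getD 0)
        have : (0 : ℚ) ≤ (b.getD 0).1 := Nat.cast_nonneg _
        linarith [hx.1]
      simp only [h₄, true_and]
      rcases b with - | b
      · simp only [Option.getD_none, true_iff, ratOfCode_natCast]
        push_cast
        linarith [hx.2]
      · simp only [reduceCtorEq, Option.getD_some, false_iff, not_lt]
        have := ratOfCode_le b
        have : (0 : ℚ) ≤ (a.getD 0).1 := Nat.cast_nonneg _
        simp only [Option.getD_some] at hle
        linarith [hx.1]

end FloorPerm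

/-! ### Computable permutations as automorphisms of the interval algebra. -/

section FloorPermComputable

variable {α β σ : Type*} [Primcodable α] [Primcodable β] [Primcodable σ] {O : Set (ℕ →. ℕ)}

@[fun_prop]
theorem ComputableIn.option_getD {f : α → Option β} {g : α → β} (hf : ComputableIn O f)
    (hg : ComputableIn O g) : ComputableIn O fun a => (f a).getD (g a) :=
  primrec₂ Primrec.option_getD hf hg

@[fun_prop]
theorem ComputableIn.option_some {f : α → β} (hf : ComputableIn O f) :
    ComputableIn O fun a => some (f a) :=
  Primrec.option_some.computableIn.comp hf

theorem ComputableIn.list_flatMap {g : β → List σ} (hg : ComputableIn O g) :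
    ComputableIn O fun l : List β => l.flatMap g := by
  rcases isEmpty_or_nonempty β with h | ⟨⟨d⟩⟩
  · exact (ComputableIn.const []).of_eq fun l => by
      rcases l with - | ⟨b, l⟩
      · rfl
      · exact isEmptyElim b
  · refine (ComputableIn.nat_rec (f := fun l : List β => l.length) (g := fun _ => [])
      (h := fun l i m => m ++ g (l.getD i d)) (by fun_prop) (by fun_prop) (by fun_prop)).of_eq
      fun l => ?_
    have h : ∀ n ≤ l.length, (Nat.rec [] (fun i m => m ++ g (l.getD i d)) n : List σ) =
        (l.take n).flatMap g := fun n => by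
      induction n with
      | zero => simp
      | succ n ih =>
        intro hn
        rw [List.take_succ_eq_append_getElem hn, List.flatMap_append, ← ih (by omega)]
        simp [List.getElem?_eq_getElem hn]
    rw [h _ le_rfl, List.take_length]

theorem computableIn_imageCodes {g : ℕ → ℕ} (hg : ComputableIn O g) {N : α → ℕ}
    (hN : ComputableIn O N) {I : α → Option (ℕ × ℕ × ℕ) × Option (ℕ × ℕ × ℕ)}
    (hI : ComputableIn O I) : ComputableIn O fun a => imageCodes g (N a) (I a) := by
  have hc : ComputableIn O fun x : ℕ × ℕ × ℕ × ℕ × ℕ => clampCode x.1 x.2.1 x.2.2 := by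
    unfold clampCode
    fun_prop
  have hm : ComputableIn O fun o : Option (ℕ × ℕ × ℕ) => o.map fun _ => (0 : ℕ × ℕ × ℕ) :=
    (Primrec.option_map Primrec.id (Primrec.const _).to₂).computableIn
  have h₁ : ComputableIn O fun a => (List.range (N a)).map fun k =>
      (some (clampCode k (g k) ((I a).1.getD 0)),
        some (clampCode k (g k) ((I a).2.getD (g k + 1, 0, 0)))) :=
    .map_range (g := fun a k => (some (clampCode k (g k) ((I a).1.getD 0)),
        some (clampCode k (g k) ((I a).2.getD (g k + 1, 0, 0)))))
      (.pair (.option_some (hc.comp (g := fun x : α × ℕ => (x.2, g x.2, (I x.1).1.getD 0))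
        (by fun_prop))) (.option_some (hc.comp
          (g := fun x : α × ℕ => (x.2, g x.2, (I x.1).2.getD (g x.2 + 1, 0, 0))) (by fun_prop)))) hN
  have h₂ : ComputableIn O fun a => (some (N a, 0, 0), (I a).2.map fun _ => (0 : ℕ × ℕ × ℕ)) :=
    .pair (by fun_prop) (hm.comp (by fun_prop))
  exact .list_append (.primrec₂ Primrec.list_cons (by fun_prop)
    (.primrec₂ Primrec.list_cons h₂ (.const []))) h₁

/-- The image of a finite union is obtained interval by interval. The cut-off for one interval is
computable: it bounds the values of `f` below the sum of the two end point numerators, so beyond it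
`f.symm` is at least that sum. -/
theorem exists_computableIn_image {f : Equiv.Perm ℕ} (hf : f ∈ computablePerm O ℕ) :
    ∃ h : ℕ → ℕ, ComputableIn O h ∧ ∀ n, ((intervalNumbering (h n) : intervalAlgebra) : Set ℚ) =
      floorPermFun f.symm ⁻¹' (intervalNumbering n : intervalAlgebra) := by
  have hf₂ : ComputableIn O f.symm := hf.2
  obtain ⟨N, hN, hlt⟩ := ComputableIn.exists_bound hf.1
  let c : Option (ℕ × ℕ × ℕ) × Option (ℕ × ℕ × ℕ) →
    List (Option (ℕ × ℕ × ℕ) × Option (ℕ × ℕ × ℕ)) :=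
      fun I => imageCodes f.symm (N ((I.1.getD 0).1 + (I.2.getD 0).1)) I
  have hc : ComputableIn O c := computableIn_imageCodes hf₂ (by fun_prop) (by fun_prop)
  refine ⟨fun n => Encodable.encode ((Denumerable.ofNat (List _) n).flatMap c),
    .encode_comp (hc.list_flatMap.comp (Primrec.ofNat (List _)).computableIn), fun n => ?_⟩
  have hc' : ∀ I, unionOfCodes (c I) = floorPermFun f.symm ⁻¹' intervalOfCode I := fun I =>
    unionOfCodes_imageCodes fun k hk => by
      by_contra! h
      have := hlt _ _ h
      rw [Equiv.apply_symm_apply] at this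
      exact absurd this hk.not_gt
  simp only [intervalNumbering, Denumerable.ofNat_encode]
  induction Denumerable.ofNat (List (Option (ℕ × ℕ × ℕ) × Option (ℕ × ℕ × ℕ))) n with
  | nil => simp [unionOfCodes_nil]
  | cons I L ih =>
    rw [List.flatMap_cons, unionOfCodes_append, ih, hc', unionOfCodes_cons, Set.preimage_union]

theorem preimage_floorPermFun_mem {f : Equiv.Perm ℕ} (hf : f ∈ computablePerm O ℕ) {S : Set ℚ}
    (hS : S ∈ intervalAlgebra) : floorPermFun f.symm ⁻¹' S ∈ intervalAlgebra := by
  obtain ⟨h, -, hh⟩ := exists_computableIn_image hf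
  obtain ⟨n, hn⟩ := intervalNumbering_surjective ⟨S, hS⟩
  have := hh n
  rw [hn] at this
  rw [← this]
  exact Subtype.property _

variable {D : Set ℕ}

/-- The computable permutations of the natural numbers act on the interval algebra of `ℚ`. -/
def autIntervalAlgebraOfPerm (D : Set ℕ) : computablePerm {charFun D} ℕ →* autIntervalAlgebra D where
  toFun f := ⟨{
      toFun := fun S => ⟨floorPermFun f.1.symm ⁻¹' S, preimage_floorPermFun_mem f.2 S.2⟩
      invFun := fun S => ⟨floorPermFun f.1 ⁻¹' S, preimage_floorPermFun_mem (f⁻¹).2 S.2⟩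
      left_inv := fun S => Subtype.ext (Set.ext fun x => by
        simp only [Set.mem_preimage, floorPermFun_comp, Equiv.symm_apply_apply]
        rw [floorPermFun_eq_self fun _ _ => rfl])
      right_inv := fun S => Subtype.ext (Set.ext fun x => by
        simp only [Set.mem_preimage, floorPermFun_comp, Equiv.apply_symm_apply]
        rw [floorPermFun_eq_self fun _ _ => rfl])
      map_rel_iff' := fun {S T} => by
        refine Function.Surjective.preimage_subset_preimage_iff fun x =>
          ⟨floorPermFun f.1 x, ?_⟩
        simp only [floorPermFun_comp, Equiv.symm_apply_apply]
        exact floorPermFun_eq_self fun _ _ => rfl }, by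
    obtain ⟨h, hh, hn⟩ := exists_computableIn_image f.2
    exact ⟨h, hh, fun n => Subtype.ext (hn n)⟩⟩
  map_one' := by
    refine Subtype.ext (OrderIso.ext (funext fun S => Subtype.ext (Set.ext fun x => ?_)))
    change floorPermFun (fun n => n) x ∈ (S : Set ℚ) ↔ _
    rw [floorPermFun_eq_self fun _ _ => rfl]
    rfl
  map_mul' f g := by
    refine Subtype.ext (OrderIso.ext (funext fun S => Subtype.ext (Set.ext fun x => ?_)))
    change floorPermFun (fun n => g.1.symm (f.1.symm n)) x ∈ (S : Set ℚ) ↔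
      floorPermFun g.1.symm (floorPermFun f.1.symm x) ∈ (S : Set ℚ)
    rw [floorPermFun_comp]

theorem coe_autIntervalAlgebraOfPerm (f : computablePerm {charFun D} ℕ) (S : intervalAlgebra) :
    ((autIntervalAlgebraOfPerm D f).1 S : Set ℚ) = floorPermFun f.1.symm ⁻¹' S := rfl

/-- The interval `[n, n + 1)`, as an element of the interval algebra. -/
def unitIco (n : ℕ) : intervalAlgebra :=
  ⟨Set.Ico (n : ℚ) (n + 1), BooleanSubalgebra.mem_closure_of_mem (Or.inl (Or.inl ⟨_, _, rfl⟩))⟩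

theorem coe_unitIco (n : ℕ) : (unitIco n : Set ℚ) = Set.Ico (n : ℚ) (n + 1) := rfl

/-- The elements which are fixed together with all smaller ones. -/
def hereditarilyFixed (φ : intervalAlgebra ≃o intervalAlgebra) : Set intervalAlgebra :=
  {S | ∀ T ≤ S, φ T = T}

/-- Having a greatest hereditarily fixed element is expressed by the order and the automorphism
alone, so it is invariant under conjugation in the full automorphism group. -/
theorem isGreatest_hereditarilyFixed_of_semiconjBy {φ ψ x : intervalAlgebra ≃o intervalAlgebra}
    (h : SemiconjBy x φ ψ) {S : intervalAlgebra} (hS : IsGreatest (hereditarilyFixed φ) S) :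
    IsGreatest (hereditarilyFixed ψ) (x S) := by
  have hx : ∀ T, x (φ T) = ψ (x T) := fun T => DFunLike.congr_fun h.eq T
  refine ⟨fun T hT => ?_, fun S' hS' => ?_⟩
  · obtain ⟨T, rfl⟩ := x.surjective T
    rw [← hx, hS.1 T (x.le_iff_le.1 hT)]
  · obtain ⟨S', rfl⟩ := x.surjective S'
    refine x.monotone (hS.2 fun T hT => x.injective ?_)
    rw [hx, hS' _ (x.monotone hT)]

/-- If `S` meets a moved interval, its part in that interval is carried to a different unit interval
and is not fixed. If it meets none, every point of `S` is fixed. -/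
theorem mem_hereditarilyFixed {f : computablePerm {charFun D} ℕ} {S : intervalAlgebra} :
    S ∈ hereditarilyFixed (autIntervalAlgebraOfPerm D f).1 ↔
      ∀ n, f.1 n ≠ n → Disjoint (S : Set ℚ) (Set.Ico (n : ℚ) (n + 1)) := by
  constructor
  · refine fun h n hn => Set.disjoint_left.2 fun x hx hxn => hn ?_
    have h₁ := congrArg (fun T : intervalAlgebra => (T : Set ℚ)) (h (S ⊓ unitIco n) inf_le_left)
    have h₂ : x ∈ floorPermFun f.1.symm ⁻¹' ((S ⊓ unitIco n : intervalAlgebra) : Set ℚ) := by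
      rw [← coe_autIntervalAlgebraOfPerm]
      exact h₁.symm ▸ ⟨hx, hxn⟩
    have h₃ := floorPermFun_mem f.1.symm hxn
    have h0 := (Nat.cast_nonneg (α := ℚ) _).trans h₃.1
    have := ((Nat.floor_eq_iff h0).2 h₃).symm.trans ((Nat.floor_eq_iff h0).2 h₂.2)
    exact ((Equiv.symm_apply_eq _).1 this).symm
  · refine fun h T hT => Subtype.ext (Set.ext fun x => ?_)
    rw [coe_autIntervalAlgebraOfPerm, Set.mem_preimage]
    have key : ∀ y : ℚ, y ∈ (T : Set ℚ) → floorPermFun f.1 y = y := fun y hy =>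
      floorPermFun_eq_self fun n hyn => by
        by_contra hn
        exact Set.disjoint_left.1 (h n hn) (hT hy) hyn
    have hinv : floorPermFun f.1 (floorPermFun f.1.symm x) = x := by
      simp only [floorPermFun_comp, Equiv.apply_symm_apply]
      exact floorPermFun_eq_self fun _ _ => rfl
    have hinv' : floorPermFun f.1.symm (floorPermFun f.1 x) = x := by
      simp only [floorPermFun_comp, Equiv.symm_apply_apply]
      exact floorPermFun_eq_self fun _ _ => rfl
    constructor
    · intro hx
      have := key _ hx
      rw [hinv] at this
      rwa [this]
    · intro hx
      rw [key x hx] at hinv'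
      rwa [hinv']

theorem autIntervalAlgebraOfPerm_injective :
    Function.Injective (autIntervalAlgebraOfPerm D) := by
  refine (injective_iff_map_eq_one _).2 fun f hf => Subtype.ext (Equiv.ext fun n => ?_)
  by_contra hn
  have h : unitIco n ∈ hereditarilyFixed (autIntervalAlgebraOfPerm D f).1 := fun T _ => by
    rw [hf]
    rfl
  exact Set.disjoint_left.1 (mem_hereditarilyFixed.1 h n hn)
    (by simp [coe_unitIco] : (n : ℚ) ∈ (unitIco n : Set ℚ)) (by simp)

/-- The complement of the union of the finitely many moved intervals is the greatest such element.
-/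
theorem exists_isGreatest_hereditarilyFixed {f : computablePerm {charFun D} ℕ}
    (hf : {n | f.1 n ≠ n}.Finite) :
    ∃ S, IsGreatest (hereditarilyFixed (autIntervalAlgebraOfPerm D f).1) S := by
  have hmem : ∀ x : ℚ, x ∈ ((hf.toFinset.sup unitIco : intervalAlgebra) : Set ℚ) ↔
      ∃ n, f.1 n ≠ n ∧ x ∈ Set.Ico (n : ℚ) (n + 1) := fun x => by
    have : ∀ s : Finset ℕ, x ∈ ((s.sup unitIco : intervalAlgebra) : Set ℚ) ↔
        ∃ n ∈ s, x ∈ Set.Ico (n : ℚ) (n + 1) := fun s => by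
      induction s using Finset.induction_on with
      | empty => simp
      | insert a s _ ih =>
        rw [Finset.sup_insert, Finset.exists_mem_insert, ← ih]
        rfl
    simpa using this hf.toFinset
  refine ⟨(hf.toFinset.sup unitIco)ᶜ, mem_hereditarilyFixed.2 fun n hn => ?_, fun S hS x hx => ?_⟩
  · rw [Set.disjoint_left]
    intro x hx hxn
    exact hx ((hmem x).2 ⟨n, hn, hxn⟩)
  · intro hx'
    obtain ⟨n, hn, hxn⟩ := (hmem x).1 hx'
    exact Set.disjoint_left.1 (mem_hereditarilyFixed.1 hS n hn) hx hxn

theorem intervalAlgebra_eventually_const (S : intervalAlgebra) :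
    (∀ᶠ x in Filter.atTop, x ∈ (S : Set ℚ)) ∨ ∀ᶠ x in Filter.atTop, x ∉ (S : Set ℚ) := by
  obtain ⟨n, rfl⟩ := intervalNumbering_surjective S
  simp only [intervalNumbering]
  induction Denumerable.ofNat (List (Option (ℕ × ℕ × ℕ) × Option (ℕ × ℕ × ℕ))) n with
  | nil => simp [unionOfCodes_nil]
  | cons I L ih =>
    rw [unionOfCodes_cons]
    rcases ih with ih | ih
    · exact .inl (ih.mono fun x hx => .inr hx)
    · obtain ⟨a, b⟩ := I
      rcases b with - | b
      · left
        filter_upwards [Filter.eventually_ge_atTop (ratOfCode (a.getD 0))] with x hx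
        refine .inl ((mem_intervalOfCode _ _).2 ⟨fun p hp => ?_, by simp⟩)
        obtain rfl : a = some p := hp
        exact hx
      · right
        filter_upwards [Filter.eventually_ge_atTop (ratOfCode b), ih] with x hx hx' h
        exact h.elim (fun h => absurd (((mem_intervalOfCode _ _).1 h).2 b rfl) hx.not_gt) hx'

/-- A greatest element would be disjoint from every moved unit interval and contain every fixed one.
Both kinds occur arbitrarily far out, which contradicts eventual constancy. -/
theorem not_isGreatest_hereditarilyFixed {f : computablePerm {charFun D} ℕ}
    (hf : {n | f.1 n ≠ n}.Infinite) (hf' : {n | f.1 n = n}.Infinite) (S : intervalAlgebra) :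
    ¬ IsGreatest (hereditarilyFixed (autIntervalAlgebraOfPerm D f).1) S := by
  intro hS
  have hself : ∀ n : ℕ, (n : ℚ) ∈ Set.Ico (n : ℚ) (n + 1) := fun n => by simp
  rcases intervalAlgebra_eventually_const S with h | h <;>
    obtain ⟨N, hN⟩ := Filter.eventually_atTop.1 h
  · obtain ⟨n, hn, hNn⟩ := hf.exists_gt ⌈N⌉₊
    exact Set.disjoint_left.1 (mem_hereditarilyFixed.1 hS.1 n hn)
      (hN n (Nat.ceil_le.1 hNn.le)) (hself n)
  · obtain ⟨n, hn, hNn⟩ := hf'.exists_gt ⌈N⌉₊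
    have hle : unitIco n ≤ S := hS.2 ?_
    · exact hN n (Nat.ceil_le.1 hNn.le) (hle (hself n))
    refine mem_hereditarilyFixed.2 fun m hm => Set.disjoint_left.2 fun x hx hx' => hm ?_
    have h0 := (Nat.cast_nonneg (α := ℚ) _).trans hx.1
    obtain rfl : n = m := ((Nat.floor_eq_iff h0).2 hx).symm.trans ((Nat.floor_eq_iff h0).2 hx')
    exact hn

theorem not_semiconjBy_autIntervalAlgebraOfPerm (f f' : computablePerm {charFun D} ℕ)
    (φ : autIntervalAlgebra D)
    (h : SemiconjBy φ (autIntervalAlgebraOfPerm D f) (autIntervalAlgebraOfPerm D f'))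
    (hf : {n | f.1 n ≠ n}.Finite) (hf' : {n | f'.1 n ≠ n}.Infinite)
    (hf'' : {n | f'.1 n = n}.Infinite) : False := by
  obtain ⟨S, hS⟩ := exists_isGreatest_hereditarilyFixed hf
  exact not_isGreatest_hereditarilyFixed hf' hf'' _
    (isGreatest_hereditarilyFixed_of_semiconjBy (congrArg Subtype.val h.eq) hS)

end FloorPermComputable

/-! ### Universal statements about programs, decided by the second jump. -/

namespace OracleCode

theorem mem_eval_comp {O : ℕ →. ℕ} {c d : OracleCode} {x z : ℕ} :
    z ∈ (comp c d).eval O x ↔ ∃ y ∈ d.eval O x, z ∈ c.eval O y := by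
  rw [eval_comp]
  exact Part.mem_bind_iff

theorem mem_eval_pair {O : ℕ →. ℕ} {c d : OracleCode} {x z : ℕ} :
    z ∈ (pair c d).eval O x ↔ ∃ y ∈ c.eval O x, ∃ y' ∈ d.eval O x, z = Nat.pair y y' := by
  simp only [eval, Seq.seq, Part.map_eq_map, Part.mem_bind_iff, Part.mem_map_iff]
  constructor
  · rintro ⟨_, ⟨y, hy, rfl⟩, y', hy', rfl⟩
    exact ⟨y, hy, y', hy', rfl⟩
  · rintro ⟨y, hy, y', hy', rfl⟩
    exact ⟨_, ⟨y, hy, rfl⟩, y', hy', rfl⟩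

/-- The program with number `e` returns `y` on the input `x`. -/
def Outputs (D : Set ℕ) (e x y : ℕ) : Prop :=
  ∃ c : OracleCode, c.number = e ∧ y ∈ c.eval (charFun D) x

theorem outputs_number {D : Set ℕ} {c : OracleCode} {x y : ℕ} :
    Outputs D c.number x y ↔ y ∈ c.eval (charFun D) x :=
  ⟨fun ⟨_, h, hc⟩ => number_injective h ▸ hc, fun h => ⟨c, rfl, h⟩⟩

theorem Outputs.unique {D : Set ℕ} {e x y y' : ℕ} (h : Outputs D e x y) (h' : Outputs D e x y') :
    y = y' := by
  obtain ⟨c, rfl, hc⟩ := h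
  exact Part.mem_unique hc (outputs_number.1 h')

theorem exists_outputs {D : Set ℕ} {f : ℕ → ℕ} (hf : ComputableIn {charFun D} f) :
    ∃ e, ∀ x y, Outputs D e x y ↔ y = f x := by
  obtain ⟨c, hc⟩ := exists_eval_eq (ComputableIn.of_nat_iff.1 hf)
  refine ⟨c.number, fun x y => ?_⟩
  rw [outputs_number, hc]
  exact Part.mem_some_iff

theorem exists_computableIn_of_outputs {D : Set ℕ} {e : ℕ} (h : ∀ x, ∃ y, Outputs D e x y) :
    ∃ f : ℕ → ℕ, ComputableIn {charFun D} f ∧ ∀ x y, Outputs D e x y ↔ y = f x := by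
  choose f hf using h
  have hf' : ∀ x y, Outputs D e x y ↔ y = f x := fun x y =>
    ⟨fun h => h.unique (hf x), fun h => h ▸ hf x⟩
  refine ⟨f, ?_, hf'⟩
  obtain ⟨c, rfl, -⟩ := hf 0
  refine ComputableIn.of_nat_iff.2 ((recursiveIn_eval _ c).of_eq fun x => ?_)
  exact Part.ext fun y => outputs_number.symm.trans ((hf' x y).trans Part.mem_some_iff.symm)

variable {α : Type*} [Primcodable α]

/-- The graphs `R a` belong to partial functions computable in `D`, whose programs can be computed
from `a` relative to `O`. -/
def UniformlyComputable (O : Set (ℕ →. ℕ)) (D : Set ℕ) (R : α → ℕ → ℕ → Prop) : Prop :=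
  ∃ n : α → ℕ, ComputableIn O n ∧ ∀ a x y, R a x y ↔ Outputs D (n a) x y

namespace UniformlyComputable

variable {O : Set (ℕ →. ℕ)} {D : Set ℕ} {R S : α → ℕ → ℕ → Prop}

theorem outputs {e : α → ℕ} (he : ComputableIn O e) :
    UniformlyComputable O D fun a x y => Outputs D (e a) x y :=
  ⟨e, he, fun _ _ _ => Iff.rfl⟩

theorem of_recursiveIn {f : ℕ →. ℕ} (hf : Nat.RecursiveIn {charFun D} f) :
    UniformlyComputable O D fun (_ : α) x y => y ∈ f x := by
  obtain ⟨c, rfl⟩ := exists_eval_eq hf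
  exact ⟨fun _ => c.number, .const _, fun _ _ _ => outputs_number.symm⟩

theorem of_computableIn {f : ℕ → ℕ} (hf : ComputableIn {charFun D} f) :
    UniformlyComputable O D fun (_ : α) x y => y = f x := by
  obtain ⟨n, hn, h⟩ := of_recursiveIn (α := α) (O := O) (ComputableIn.of_nat_iff.1 hf)
  exact ⟨n, hn, fun a x y => Part.mem_some_iff.symm.trans (h a x y)⟩

theorem comp (hR : UniformlyComputable O D R) (hS : UniformlyComputable O D S) :
    UniformlyComputable O D fun a x z => ∃ y, S a x y ∧ R a y z := by
  obtain ⟨m, hm, hR⟩ := hR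
  obtain ⟨n, hn, hS⟩ := hS
  refine ⟨fun a => Nat.pair 6 (Nat.pair (m a) (n a)), by fun_prop, fun a x z => ?_⟩
  simp only [hR, hS]
  constructor
  · rintro ⟨y, ⟨d, hd, hy⟩, c, hc, hz⟩
    exact ⟨.comp c d, by rw [number, hc, hd], mem_eval_comp.2 ⟨y, hy, hz⟩⟩
  · rintro ⟨c, hc, h⟩
    cases c <;> simp only [number, Nat.pair_eq_pair] at hc <;> try omega
    obtain ⟨y, hy, hz⟩ := mem_eval_comp.1 h
    exact ⟨y, ⟨_, hc.2.2, hy⟩, _, hc.2.1, hz⟩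

theorem pair (hR : UniformlyComputable O D R) (hS : UniformlyComputable O D S) :
    UniformlyComputable O D fun a x z => ∃ y, R a x y ∧ ∃ y', S a x y' ∧ z = Nat.pair y y' := by
  obtain ⟨m, hm, hR⟩ := hR
  obtain ⟨n, hn, hS⟩ := hS
  refine ⟨fun a => Nat.pair 5 (Nat.pair (m a) (n a)), by fun_prop, fun a x z => ?_⟩
  simp only [hR, hS]
  constructor
  · rintro ⟨y, ⟨c, hc, hy⟩, y', ⟨d, hd, hy'⟩, h⟩
    exact ⟨.pair c d, by rw [number, hc, hd], mem_eval_pair.2 ⟨y, hy, y', hy', h⟩⟩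
  · rintro ⟨c, hc, h⟩
    cases c <;> simp only [number, Nat.pair_eq_pair] at hc <;> try omega
    obtain ⟨y, hy, y', hy', h⟩ := mem_eval_pair.1 h
    exact ⟨y, ⟨_, hc.2.1, hy⟩, y', ⟨_, hc.2.2, hy'⟩, h⟩

/-- Halting is decidable in the first jump, so totality is co-enumerable relative to it and
decidable in the second. -/
theorem decidableIn_forall_exists {R : α → ℕ → ℕ → Prop}
    (hR : UniformlyComputable {charFun (jump (jump D))} D R) :
    DecidableIn {charFun (jump (jump D))} fun a => ∀ x, ∃ y, R a x y := by
  obtain ⟨n, hn, h⟩ := hR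
  refine ((decidableIn_jump_forall (decidableIn_halts D)).comp hn).of_iff fun a =>
    forall_congr' fun x => ?_
  simp only [h, Halts, Outputs, Part.dom_iff_mem]
  constructor
  · rintro ⟨c, hc, y, hy⟩
    exact ⟨y, c, hc, hy⟩
  · rintro ⟨y, c, hc, hy⟩
    exact ⟨c, hc, y, hy⟩

end UniformlyComputable

/-- Whether all values of four programs at computable arguments are defined and satisfy a decidable
relation is decidable relative to the second jump. -/
theorem decidableIn_forall_outputs {D : Set ℕ} {T : ℕ → ℕ → ℕ → ℕ → ℕ → Prop}
    (hT : DecidableIn {charFun D} fun t : ℕ × ℕ × ℕ × ℕ × ℕ => T t.1 t.2.1 t.2.2.1 t.2.2.2.1 t.2.2.2.2)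
    {q₁ q₂ q₃ q₄ : ℕ → ℕ} (h₁ : ComputableIn {charFun D} q₁) (h₂ : ComputableIn {charFun D} q₂)
    (h₃ : ComputableIn {charFun D} q₃) (h₄ : ComputableIn {charFun D} q₄) {e₁ e₂ e₃ e₄ : α → ℕ}
    (he₁ : ComputableIn {charFun (jump (jump D))} e₁)
    (he₂ : ComputableIn {charFun (jump (jump D))} e₂)
    (he₃ : ComputableIn {charFun (jump (jump D))} e₃)
    (he₄ : ComputableIn {charFun (jump (jump D))} e₄) :
    DecidableIn {charFun (jump (jump D))} fun a => ∀ x, ∃ y₁ y₂ y₃ y₄,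
      Outputs D (e₁ a) (q₁ x) y₁ ∧ Outputs D (e₂ a) (q₂ x) y₂ ∧ Outputs D (e₃ a) (q₃ x) y₃ ∧
        Outputs D (e₄ a) (q₄ x) y₄ ∧ T x y₁ y₂ y₃ y₄ := by
  obtain ⟨f, hf, hfT⟩ := hT
  let g : ℕ → Bool := fun z => f (z.unpair.1, z.unpair.2.unpair.1, z.unpair.2.unpair.2.unpair.1,
    z.unpair.2.unpair.2.unpair.2.unpair.1, z.unpair.2.unpair.2.unpair.2.unpair.2)
  have hg : ComputableIn {charFun D} g := hf.comp (by fun_prop)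
  have hgT : ∀ z, g z = true ↔ T z.unpair.1 z.unpair.2.unpair.1 z.unpair.2.unpair.2.unpair.1
      z.unpair.2.unpair.2.unpair.2.unpair.1 z.unpair.2.unpair.2.unpair.2.unpair.2 := fun z =>
    hfT (z.unpair.1, z.unpair.2.unpair.1, z.unpair.2.unpair.2.unpair.1,
      z.unpair.2.unpair.2.unpair.2.unpair.1, z.unpair.2.unpair.2.unpair.2.unpair.2)
  clear_value g
  have hq : ∀ {q : ℕ → ℕ} {e : α → ℕ}, ComputableIn {charFun D} q →
      ComputableIn {charFun (jump (jump D))} e → UniformlyComputable {charFun (jump (jump D))} D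
        fun a x y => ∃ z, z = q x ∧ Outputs D (e a) z y := fun hq he =>
    .comp (.outputs he) (.of_computableIn hq)
  -- The search tests a condition independent of its variable, so it halts at once or never.
  -- Appended to the four computations, it turns the truth of `T` into halting, and the whole
  -- statement into totality of one program with computable number.
  have := (UniformlyComputable.comp (.of_recursiveIn (ComputableIn.rfind (f := fun z _ => g z)
    (hg.comp ComputableIn.fst)))
    ((UniformlyComputable.of_computableIn ComputableIn.id').pair ((hq h₁ he₁).pair
      ((hq h₂ he₂).pair ((hq h₃ he₃).pair (hq h₄ he₄)))))).decidableIn_forall_exists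
  refine this.of_iff fun a => forall_congr' fun x => ?_
  have hr : ∀ z, (∃ y, y ∈ Nat.rfind fun _ => Part.some (g z)) ↔ T z.unpair.1 z.unpair.2.unpair.1
      z.unpair.2.unpair.2.unpair.1 z.unpair.2.unpair.2.unpair.2.unpair.1
      z.unpair.2.unpair.2.unpair.2.unpair.2 := fun z => by
    refine Iff.trans ?_ (hgT z)
    refine Part.dom_iff_mem.symm.trans (Nat.rfind_dom.trans ?_)
    simp
  constructor
  · rintro ⟨y, z, ⟨_, rfl, w, ⟨y₁, ⟨_, rfl, h₁⟩, w, ⟨y₂, ⟨_, rfl, h₂⟩, w, ⟨y₃, ⟨_, rfl, h₃⟩, y₄,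
      ⟨_, rfl, h₄⟩, rfl⟩, rfl⟩, rfl⟩, rfl⟩, hy⟩
    have := (hr _).1 ⟨y, hy⟩
    simp only [Nat.unpair_pair] at this
    exact ⟨y₁, y₂, y₃, y₄, h₁, h₂, h₃, h₄, this⟩
  · rintro ⟨y₁, y₂, y₃, y₄, h₁, h₂, h₃, h₄, h⟩
    obtain ⟨y, hy⟩ := (hr (Nat.pair x (Nat.pair y₁ (Nat.pair y₂ (Nat.pair y₃ y₄))))).2
      (by simpa only [Nat.unpair_pair] using h)
    exact ⟨y, _, ⟨_, rfl, _, ⟨y₁, ⟨_, rfl, h₁⟩, _, ⟨y₂, ⟨_, rfl, h₂⟩, _, ⟨y₃, ⟨_, rfl, h₃⟩, y₄,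
      ⟨_, rfl, h₄⟩, rfl⟩, rfl⟩, rfl⟩, rfl⟩, hy⟩

end OracleCode

/-! ### Copies of a group built from names. -/

section Copy

variable {G : Type*} [Group G] {E : Set ℕ}

/-- A group whose multiplication is decidable relative to `E` on names has a copy whose atomic
diagram is computable relative to `E`. -/
theorem exists_mem_degreeSpectrum_le {p : ℕ → G} (hp : Function.Surjective p)
    (hmul : DecidableIn {charFun E} fun x : ℕ × ℕ × ℕ => p x.1 * p x.2.1 = p x.2.2) :
    ∃ a ∈ degreeSpectrum G, a ≤ deg E := by
  classical
  obtain ⟨i, hi⟩ := hp 1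
  have heq : DecidableIn {charFun E} fun x : ℕ × ℕ => p x.1 = p x.2 :=
    (hmul.comp (f := fun x : ℕ × ℕ => (x.1, i, x.2)) (by fun_prop)).of_iff fun x => by simp [hi]
  -- The universe consists of the least names. Equality of names is decidable because it is a
  -- product with a name of `1`.
  let A : Set ℕ := {n | ∀ m < n, ¬ p m = p n}
  have hA : DecidableIn {charFun E} fun n => n ∈ A :=
    (DecidableIn.forall_lt (p := fun n m => ¬ p m = p n) (f := fun n : ℕ => n)
      (heq.comp (f := fun x : ℕ × ℕ => (x.2, x.1)) (by fun_prop)).not (by fun_prop))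
  let φ : A ≃ G := Equiv.ofBijective (fun n => p n) ⟨fun m n h => by
      rcases lt_trichotomy m.1 n.1 with hlt | heq | hlt
      · exact absurd h (n.2 _ hlt)
      · exact Subtype.ext heq
      · exact absurd h.symm (m.2 _ hlt), fun x =>
    ⟨⟨Nat.find (hp x), fun m hm h => Nat.find_min (hp x) hm (h.trans (Nat.find_spec (hp x)))⟩,
      Nat.find_spec (hp x)⟩⟩
  let _ : Group A := φ.group
  have hφ : ∀ a b c : A, a * b = c ↔ p a * p b = p c := fun a b c => by
    rw [← φ.injective.eq_iff]
    exact Eq.congr_left ((φ.mulEquiv).map_mul a b)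
  refine ⟨_, ⟨A, _, ⟨φ.mulEquiv.symm⟩, rfl⟩, deg_le_deg_iff.2 ?_⟩
  refine (DecidableIn.or
    ((DecidableIn.eq (f := fun n : ℕ => n.unpair.1) (g := fun _ => 0) (by fun_prop)
      (by fun_prop)).and ((DecidableIn.eq (f := fun n : ℕ => n.unpair.2.unpair.1)
        (g := fun n => n.unpair.2.unpair.2) (by fun_prop) (by fun_prop)).and
          (hA.comp (f := fun n : ℕ => n.unpair.2.unpair.1) (by fun_prop))))
    ((DecidableIn.eq (f := fun n : ℕ => n.unpair.1) (g := fun _ => 1) (by fun_prop)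
      (by fun_prop)).and ((hA.comp (f := fun n : ℕ => n.unpair.2.unpair.1) (by fun_prop)).and
        ((hA.comp (f := fun n : ℕ => n.unpair.2.unpair.2.unpair.1) (by fun_prop)).and
          ((hA.comp (f := fun n : ℕ => n.unpair.2.unpair.2.unpair.2) (by fun_prop)).and
            (hmul.comp (f := fun n : ℕ => (n.unpair.2.unpair.1, n.unpair.2.unpair.2.unpair.1,
              n.unpair.2.unpair.2.unpair.2)) (by fun_prop))))))).of_iff fun n => ?_
  constructor
  · rintro (⟨h₁, h₂, h₃⟩ | ⟨h₁, ha, hb, hc, h⟩)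
    · refine Or.inl ⟨⟨_, h₃⟩, ⟨_, h₃⟩, rfl, ?_⟩
      change n = Nat.pair 0 (Nat.pair n.unpair.2.unpair.1 n.unpair.2.unpair.1)
      conv_rhs => enter [2, 2]; rw [h₂]
      rw [Nat.pair_unpair, ← h₁, Nat.pair_unpair]
    · refine Or.inr ⟨⟨_, ha⟩, ⟨_, hb⟩, ⟨_, hc⟩, (hφ _ _ _).2 h, ?_⟩
      rw [Nat.pair_unpair, Nat.pair_unpair, ← h₁, Nat.pair_unpair]
  · rintro (⟨a, b, rfl, rfl⟩ | ⟨a, b, c, h, rfl⟩)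
    · simp
    · simp [(hφ _ _ _).1 h]

/-- The same for a partial numbering with a decidable set of names. -/
theorem exists_mem_degreeSpectrum_le_of_names {R : ℕ → G → Prop} (hR : ∀ x, ∃ e, R e x)
    (hR' : ∀ e x y, R e x → R e y → x = y) (hdom : DecidableIn {charFun E} fun e => ∃ x, R e x)
    {M : ℕ → ℕ → ℕ → Prop} (hM : DecidableIn {charFun E} fun t : ℕ × ℕ × ℕ => M t.1 t.2.1 t.2.2)
    (hMR : ∀ a b c x y z, R a x → R b y → R c z → (M a b c ↔ x * y = z)) :
    ∃ a ∈ degreeSpectrum G, a ≤ deg E := by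
  classical
  obtain ⟨i, hi⟩ := hR 1
  -- Numbers that name nothing are made names of `1`, which turns the partial numbering into a total
  -- one.
  let r : ℕ → ℕ := fun e => if ∃ x, R e x then e else i
  have hr : ∀ e, ∃ x, R (r e) x := fun e => by
    by_cases h : ∃ x, R e x
    · simp [r, h]
    · exact ⟨1, by simpa [r, h] using hi⟩
  have hrc : ComputableIn {charFun E} r := .ite' hdom (by fun_prop) (by fun_prop)
  choose p hp using hr
  refine exists_mem_degreeSpectrum_le (p := p) (fun x => ?_) ?_
  · obtain ⟨e, he⟩ := hR x
    have hre : r e = e := if_pos ⟨x, he⟩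
    exact ⟨e, hR' _ _ _ (hp e) (hre.symm ▸ he)⟩
  · exact (hM.comp (f := fun t : ℕ × ℕ × ℕ => (r t.1, r t.2.1, r t.2.2)) (by fun_prop)).of_iff
      fun t => hMR _ _ _ _ _ _ (hp _) (hp _) (hp _)

end Copy

theorem DecidableIn.imp {α : Type*} [Primcodable α] {O : Set (ℕ →. ℕ)} {p q : α → Prop}
    (hp : DecidableIn O p) (hq : DecidableIn O q) : DecidableIn O fun a => p a → q a :=
  (hp.not.or hq).of_iff fun _ => imp_iff_not_or.symm

theorem DecidableIn.iff {α : Type*} [Primcodable α] {O : Set (ℕ →. ℕ)} {p q : α → Prop}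
    (hp : DecidableIn O p) (hq : DecidableIn O q) : DecidableIn O fun a => p a ↔ q a :=
  ((hp.imp hq).and (hq.imp hp)).of_iff fun _ => iff_def.symm

namespace OracleCode

variable {D : Set ℕ} {e : ℕ}

/-- The program with number `e` halts on every input. -/
def Total (D : Set ℕ) (e : ℕ) : Prop := ∀ x, ∃ y, Outputs D e x y

open Classical in
/-- The output of the program with number `e` on the input `x`, if any. -/
noncomputable def value (D : Set ℕ) (e x : ℕ) : ℕ :=
  if h : ∃ y, Outputs D e x y then h.choose else 0

theorem Total.outputs_value (he : Total D e) (x : ℕ) : Outputs D e x (value D e x) := by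
  rw [value, dif_pos (he x)]
  exact (he x).choose_spec

theorem Total.outputs_iff (he : Total D e) {x y : ℕ} : Outputs D e x y ↔ y = value D e x :=
  ⟨fun h => h.unique (he.outputs_value x), fun h => h ▸ he.outputs_value x⟩

theorem Total.computableIn_value (he : Total D e) : ComputableIn {charFun D} (value D e) := by
  obtain ⟨f, hf, h⟩ := exists_computableIn_of_outputs he
  exact hf.of_eq fun x => ((h x _).1 (he.outputs_value x)).symm

theorem exists_total_value_eq {f : ℕ → ℕ} (hf : ComputableIn {charFun D} f) :
    ∃ e, Total D e ∧ ∀ x, value D e x = f x := by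
  obtain ⟨e, he⟩ := exists_outputs hf
  have ht : Total D e := fun x => ⟨f x, (he x _).2 rfl⟩
  exact ⟨e, ht, fun x => (he x _).1 (ht.outputs_value x)⟩

/-- A universal statement about the values of four programs at computable arguments is decidable
relative to the second jump. -/
theorem decidableIn_forall_value {α : Type*} [Primcodable α] {T : ℕ → ℕ → ℕ → ℕ → ℕ → Prop}
    (hT : DecidableIn {charFun D} fun t : ℕ × ℕ × ℕ × ℕ × ℕ => T t.1 t.2.1 t.2.2.1 t.2.2.2.1 t.2.2.2.2)
    {q₁ q₂ q₃ q₄ : ℕ → ℕ} (h₁ : ComputableIn {charFun D} q₁) (h₂ : ComputableIn {charFun D} q₂)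
    (h₃ : ComputableIn {charFun D} q₃) (h₄ : ComputableIn {charFun D} q₄) {e₁ e₂ e₃ e₄ : α → ℕ}
    (he₁ : ComputableIn {charFun (jump (jump D))} e₁)
    (he₂ : ComputableIn {charFun (jump (jump D))} e₂)
    (he₃ : ComputableIn {charFun (jump (jump D))} e₃)
    (he₄ : ComputableIn {charFun (jump (jump D))} e₄) :
    DecidableIn {charFun (jump (jump D))} fun a =>
      (Total D (e₁ a) ∧ Total D (e₂ a) ∧ Total D (e₃ a) ∧ Total D (e₄ a)) ∧
        ∀ x, T x (value D (e₁ a) (q₁ x)) (value D (e₂ a) (q₂ x)) (value D (e₃ a) (q₃ x))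
          (value D (e₄ a) (q₄ x)) := by
  have ht : ∀ {e : α → ℕ}, ComputableIn {charFun (jump (jump D))} e →
      DecidableIn {charFun (jump (jump D))} fun a => Total D (e a) := fun he =>
    (UniformlyComputable.outputs he).decidableIn_forall_exists
  refine (((ht he₁).and ((ht he₂).and ((ht he₃).and (ht he₄)))).and
    (decidableIn_forall_outputs hT h₁ h₂ h₃ h₄ he₁ he₂ he₃ he₄)).of_iff fun a =>
      and_congr_right fun ⟨t₁, t₂, t₃, t₄⟩ => forall_congr' fun x => ?_
  simp only [t₁.outputs_iff, t₂.outputs_iff, t₃.outputs_iff, t₄.outputs_iff]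
  constructor
  · rintro ⟨_, _, _, _, rfl, rfl, rfl, rfl, h⟩
    exact h
  · exact fun h => ⟨_, _, _, _, rfl, rfl, rfl, rfl, h⟩

end OracleCode

open OracleCode

/-! ### Names of permutations. -/

section PermNames

variable {α : Type*} {ν : ℕ → α} {D : Set ℕ}

/-- The sections of `g` at `t` and `t + 1` represent `φ` and its inverse on names. -/
def Represents (ν : ℕ → α) (g : ℕ → ℕ) (t : ℕ) (φ : Equiv.Perm α) : Prop :=
  (∀ m, ν (g (Nat.pair t m)) = φ (ν m)) ∧ ∀ m, ν (g (Nat.pair (t + 1) m)) = φ.symm (ν m)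

theorem Represents.unique (hν : Function.Surjective ν) {g : ℕ → ℕ} {t : ℕ} {φ ψ : Equiv.Perm α}
    (h : Represents ν g t φ) (h' : Represents ν g t ψ) : φ = ψ := by
  refine Equiv.ext fun x => ?_
  obtain ⟨m, rfl⟩ := hν x
  rw [← h.1, h'.1]

/-- One universal equivalence on names expresses that both sections respect equality of names and
that they are mutually inverse. Carrying the inverse along avoids an existential statement of
surjectivity, which would raise the complexity. -/
theorem exists_represents_iff (hν : Function.Surjective ν) {g : ℕ → ℕ} {t : ℕ} :
    (∃ φ, Represents ν g t φ) ↔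
      ∀ x : ℕ, ν (g (Nat.pair t x.unpair.1)) = ν x.unpair.2 ↔
        ν x.unpair.1 = ν (g (Nat.pair (t + 1) x.unpair.2)) := by
  constructor
  · rintro ⟨φ, h₁, h₂⟩ x
    rw [h₁, h₂, Equiv.eq_symm_apply]
  · intro h
    have h' : ∀ m n, ν (g (Nat.pair t m)) = ν n ↔ ν m = ν (g (Nat.pair (t + 1) n)) := fun m n => by
      simpa using h (Nat.pair m n)
    choose c hc using hν
    refine ⟨⟨fun x => ν (g (Nat.pair t (c x))), fun x => ν (g (Nat.pair (t + 1) (c x))),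
      fun x => ?_, fun x => ?_⟩, fun m => ?_, fun m => ?_⟩
    · exact ((h' _ _).1 (hc _).symm).symm.trans (hc x)
    · exact ((h' _ _).2 (hc _)).trans (hc x)
    · exact (h' _ _).2 (((hc (ν m)).symm.trans ((h' _ _).1 rfl)))
    · exact ((h' _ _).1 (((h' _ _).2 rfl).trans (hc (ν m)).symm))

theorem decidableIn_exists_represents (hν : IsDecidableNumbering ν) (t : ℕ) :
    DecidableIn {charFun (jump (jump D))} fun e =>
      Total D e ∧ ∃ φ, Represents ν (value D e) t φ := by
  have heq : DecidableIn {charFun D} fun p : ℕ × ℕ => ν p.1 = ν p.2 := hν.decidable_eq.decidableIn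
  refine (decidableIn_forall_value (D := D)
    (T := fun x y₁ y₂ _ _ => ν y₁ = ν x.unpair.2 ↔ ν x.unpair.1 = ν y₂)
    (q₁ := fun x => Nat.pair t x.unpair.1) (q₂ := fun x => Nat.pair (t + 1) x.unpair.2)
    (q₃ := fun _ => 0) (q₄ := fun _ => 0) (e₁ := fun e => e) (e₂ := fun e => e)
    (e₃ := fun e => e) (e₄ := fun e => e)
    ((heq.comp (f := fun t : ℕ × ℕ × ℕ × ℕ × ℕ => (t.2.1, t.1.unpair.2)) (by fun_prop)).iff
      (heq.comp (f := fun t : ℕ × ℕ × ℕ × ℕ × ℕ => (t.1.unpair.1, t.2.2.1)) (by fun_prop)))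
    (by fun_prop) (by fun_prop) (by fun_prop) (by fun_prop) (by fun_prop) (by fun_prop)
    (by fun_prop) (by fun_prop)).of_iff fun e => ?_
  rw [exists_represents_iff hν.surjective]
  simp only [and_self]

/-- `c` represents the composition of the permutations represented by `a` and `b`. -/
def RepresentsMul (ν : ℕ → α) (D : Set ℕ) (a b c : ℕ) : Prop :=
  (Total D a ∧ Total D b ∧ Total D c) ∧ ∀ x : ℕ,
    -- The intermediate value enters as a further universally quantified name, so that no program is
    -- applied to the output of another.
    ν (value D b (Nat.pair 0 x.unpair.1)) = ν x.unpair.2 →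
      ν (value D a (Nat.pair 0 x.unpair.2)) = ν (value D c (Nat.pair 0 x.unpair.1))

theorem decidableIn_representsMul (hν : IsDecidableNumbering ν) :
    DecidableIn {charFun (jump (jump D))} fun t : ℕ × ℕ × ℕ =>
      RepresentsMul ν D t.1 t.2.1 t.2.2 := by
  have heq : DecidableIn {charFun D} fun p : ℕ × ℕ => ν p.1 = ν p.2 := hν.decidable_eq.decidableIn
  refine (decidableIn_forall_value (D := D)
    (T := fun x y₁ y₂ y₃ _ => ν y₂ = ν x.unpair.2 → ν y₁ = ν y₃)
    (q₁ := fun x => Nat.pair 0 x.unpair.2) (q₂ := fun x => Nat.pair 0 x.unpair.1)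
    (q₃ := fun x => Nat.pair 0 x.unpair.1) (q₄ := fun _ => 0) (e₁ := fun t : ℕ × ℕ × ℕ => t.1)
    (e₂ := fun t => t.2.1) (e₃ := fun t => t.2.2) (e₄ := fun t => t.2.2)
    ((heq.comp (f := fun t : ℕ × ℕ × ℕ × ℕ × ℕ => (t.2.2.1, t.1.unpair.2)) (by fun_prop)).imp
      (heq.comp (f := fun t : ℕ × ℕ × ℕ × ℕ × ℕ => (t.2.1, t.2.2.2.1)) (by fun_prop)))
    (by fun_prop) (by fun_prop) (by fun_prop) (by fun_prop) (by fun_prop) (by fun_prop)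
    (by fun_prop) (by fun_prop)).of_iff fun t => ?_
  simp only [RepresentsMul, and_self]

theorem representsMul_iff (hν : Function.Surjective ν) {a b c : ℕ} (ha : Total D a)
    (hb : Total D b) (hc : Total D c) {φ ψ χ : Equiv.Perm α} (hφ : Represents ν (value D a) 0 φ)
    (hψ : Represents ν (value D b) 0 ψ) (hχ : Represents ν (value D c) 0 χ) :
    RepresentsMul ν D a b c ↔ φ * ψ = χ := by
  simp only [RepresentsMul, ha, hb, hc, and_self, true_and, hφ.1, hψ.1, hχ.1]
  constructor
  · intro h
    refine Equiv.ext fun x => ?_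
    obtain ⟨m, rfl⟩ := hν x
    obtain ⟨n, hn⟩ := hν (ψ (ν m))
    have := h (Nat.pair m n)
    simp only [Nat.unpair_pair] at this
    rw [← this hn.symm, hn]
    rfl
  · rintro rfl x hx
    rw [← hx]
    rfl

/-- Only the sections `t` and `t + 1` matter, so that functions for several permutations can be
glued into one program. -/
theorem exists_total_represents {φ : Equiv.Perm α} (hφ : IsComputableMap D ν φ)
    (hφ' : IsComputableMap D ν φ.symm) (t : ℕ) : ∃ g, ComputableIn {charFun D} g ∧
      ∀ g', (∀ m, g' (Nat.pair t m) = g (Nat.pair t m)) →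
        (∀ m, g' (Nat.pair (t + 1) m) = g (Nat.pair (t + 1) m)) → Represents ν g' t φ := by
  obtain ⟨f, hf, h⟩ := hφ
  obtain ⟨f', hf', h'⟩ := hφ'
  replace hf : ComputableIn {charFun D} f := hf
  replace hf' : ComputableIn {charFun D} f' := hf'
  refine ⟨fun z => if z.unpair.1 = t then f z.unpair.2 else f' z.unpair.2,
    .ite (by fun_prop) (by fun_prop) (by fun_prop), fun g' h₁ h₂ => ⟨fun m => ?_, fun m => ?_⟩⟩
  · simp [h₁, h]
  · simp [h₂, h']

end PermNames

/-! ### The interval algebra: names of automorphisms and the degree. -/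

section AutIntervalAlgebraNames

variable {D : Set ℕ}

theorem decidableIn_intervalNumbering_le (O : Set (ℕ →. ℕ)) :
    DecidableIn O fun p : ℕ × ℕ => intervalNumbering p.1 ≤ intervalNumbering p.2 := by
  have hl : ∀ {f : ℕ × ℕ → ℕ}, ComputableIn O f → ComputableIn O fun p =>
      Denumerable.ofNat (List (Option (ℕ × ℕ × ℕ) × Option (ℕ × ℕ × ℕ))) (f p) := fun hf =>
    (Primrec.ofNat (List (Option (ℕ × ℕ × ℕ) × Option (ℕ × ℕ × ℕ)))).computableIn.comp hf
  have happ : ComputableIn O fun p : ℕ × ℕ => Encodable.encode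
      (Denumerable.ofNat (List (Option (ℕ × ℕ × ℕ) × Option (ℕ × ℕ × ℕ))) p.1 ++
        Denumerable.ofNat (List (Option (ℕ × ℕ × ℕ) × Option (ℕ × ℕ × ℕ))) p.2) :=
    .encode_comp (.list_append (hl (by fun_prop)) (hl (by fun_prop)))
  refine ((intervalNumbering_isDecidable.decidable_eq.decidableIn (O := O)).comp
    (happ.pair ComputableIn.snd)).of_iff fun p => ?_
  -- Inclusion becomes an equality with a join, and joins are computed by concatenating lists.
  rw [← sup_eq_right]
  refine Eq.congr_left (Subtype.ext ?_)
  simp only [intervalNumbering, Denumerable.ofNat_encode, unionOfCodes_append]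
  rfl

/-- `e` is a program for the automorphism `φ` and its inverse. -/
def NamesAut (D : Set ℕ) (e : ℕ) (φ : autIntervalAlgebra D) : Prop :=
  Total D e ∧ Represents intervalNumbering (value D e) 0 φ.1.toEquiv

theorem exists_namesAut (φ : autIntervalAlgebra D) : ∃ e, NamesAut D e φ := by
  obtain ⟨g, hg, h⟩ := exists_total_represents (φ := φ.1.toEquiv) φ.2 (φ⁻¹).2 0
  obtain ⟨e, he, hv⟩ := exists_total_value_eq hg
  exact ⟨e, he, h _ (fun _ => hv _) fun _ => hv _⟩

theorem exists_namesAut_iff {e : ℕ} : (∃ φ, NamesAut D e φ) ↔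
    (Total D e ∧ ∃ φ, Represents intervalNumbering (value D e) 0 φ) ∧ ∀ x : ℕ,
      intervalNumbering x.unpair.1 ≤ intervalNumbering x.unpair.2 ↔
        intervalNumbering (value D e (Nat.pair 0 x.unpair.1)) ≤
          intervalNumbering (value D e (Nat.pair 0 x.unpair.2)) := by
  constructor
  · rintro ⟨φ, he, h⟩
    refine ⟨⟨he, _, h⟩, fun x => ?_⟩
    rw [h.1, h.1]
    exact φ.1.le_iff_le.symm
  · rintro ⟨⟨he, φ, h⟩, hle⟩
    have hc := he.computableIn_value
    refine ⟨⟨⟨φ, fun {a b} => ?_⟩, fun m => value D e (Nat.pair 0 m),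
      (by fun_prop : ComputableIn {charFun D} fun m => value D e (Nat.pair 0 m)), h.1⟩, he, h⟩
    obtain ⟨m, rfl⟩ := intervalNumbering_surjective a
    obtain ⟨n, rfl⟩ := intervalNumbering_surjective b
    simpa [h.1] using (hle (Nat.pair m n)).symm

theorem decidableIn_exists_namesAut (D : Set ℕ) :
    DecidableIn {charFun (jump (jump D))} fun e => ∃ φ, NamesAut D e φ := by
  have hle := decidableIn_intervalNumbering_le {charFun D}
  refine ((decidableIn_exists_represents intervalNumbering_isDecidable 0).and
    (decidableIn_forall_value (D := D)
      (T := fun x y₁ y₂ _ _ => intervalNumbering x.unpair.1 ≤ intervalNumbering x.unpair.2 ↔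
        intervalNumbering y₁ ≤ intervalNumbering y₂)
      (q₁ := fun x => Nat.pair 0 x.unpair.1) (q₂ := fun x => Nat.pair 0 x.unpair.2)
      (q₃ := fun _ => 0) (q₄ := fun _ => 0) (e₁ := fun e => e) (e₂ := fun e => e)
      (e₃ := fun e => e) (e₄ := fun e => e)
      ((hle.comp (f := fun t : ℕ × ℕ × ℕ × ℕ × ℕ => (t.1.unpair.1, t.1.unpair.2))
        (by fun_prop)).iff
        (hle.comp (f := fun t : ℕ × ℕ × ℕ × ℕ × ℕ => (t.2.1, t.2.2.1)) (by fun_prop)))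
      (by fun_prop) (by fun_prop) (by fun_prop) (by fun_prop) (by fun_prop) (by fun_prop)
      (by fun_prop) (by fun_prop))).of_iff fun e => ?_
  rw [exists_namesAut_iff]
  simp only [and_self]
  tauto

theorem isDegreeOfIsomorphismType_autIntervalAlgebra (D : Set ℕ) :
    IsDegreeOfIsomorphismType (autIntervalAlgebra D) (deg (jump (jump D))) := by
  have hlb : ∀ a ∈ degreeSpectrum (autIntervalAlgebra D), deg (jump (jump D)) ≤ a := fun a ha =>
    deg_jump_jump_le (autIntervalAlgebraOfPerm D) autIntervalAlgebraOfPerm_injective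
      not_semiconjBy_autIntervalAlgebraOfPerm ha
  obtain ⟨a, ha, hle⟩ := exists_mem_degreeSpectrum_le_of_names (E := jump (jump D))
    (R := NamesAut D) exists_namesAut
    (fun e φ ψ hφ hψ => Subtype.ext (RelIso.toEquiv_injective
      (hφ.2.unique intervalNumbering_surjective hψ.2)))
    (decidableIn_exists_namesAut D)
    (decidableIn_representsMul intervalNumbering_isDecidable) fun a b c φ ψ χ ha hb hc => by
      rw [representsMul_iff intervalNumbering_surjective ha.1 hb.1 hc.1 ha.2 hb.2 hc.2]
      exact ⟨fun h => Subtype.ext (RelIso.toEquiv_injective h), fun h => h ▸ rfl⟩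
  -- The copy has degree at most `D''`; the lower bound applied to the same copy makes it equal.
  exact ⟨hle.antisymm (hlb a ha) ▸ ha, hlb⟩

end AutIntervalAlgebraNames

/-! ### The semilinear group: names and the degree. -/

section SemilinearNames

variable {F : Type*} [Field F] {ν : ℕ → F} {D : Set ℕ}

/-- Beyond the longest of the three lists all coordinates vanish, so finitely many comparisons in
the field suffice. -/
theorem decidableIn_vecNumbering_eq_add_smul (hν : IsComputableField ν) (O : Set (ℕ →. ℕ)) :
    DecidableIn O fun t : ℕ × ℕ × ℕ × ℕ => vecNumbering ν t.1 =
      vecNumbering ν t.2.1 + ν t.2.2.2 • vecNumbering ν t.2.2.1 := by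
  obtain ⟨z, hz⟩ := hν.surjective 0
  obtain ⟨add, hadd, hadd'⟩ := hν.add
  obtain ⟨mul, hmul, hmul'⟩ := hν.mul
  have hadd₁ : ComputableIn O fun p : ℕ × ℕ => add p.1 p.2 := Computable.computableIn hadd
  have hmul₁ : ComputableIn O fun p : ℕ × ℕ => mul p.1 p.2 := Computable.computableIn hmul
  have heq : DecidableIn O fun p : ℕ × ℕ => ν p.1 = ν p.2 := hν.decidable_eq.decidableIn
  let l : ℕ → List ℕ := Denumerable.ofNat (List ℕ)
  have hl : ComputableIn O l := ComputableIn.ofNat_comp ComputableIn.id'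
  have hg : ∀ {f g : (ℕ × ℕ × ℕ × ℕ) × ℕ → ℕ}, ComputableIn O f → ComputableIn O g →
      ComputableIn O fun x => (l (f x)).getD (g x) z := fun hf hg => by fun_prop
  refine (DecidableIn.forall_lt
    (p := fun (t : ℕ × ℕ × ℕ × ℕ) i => ν ((l t.1).getD i z) =
      ν (add ((l t.2.1).getD i z) (mul t.2.2.2 ((l t.2.2.1).getD i z))))
    (f := fun t => max (l t.1).length (max (l t.2.1).length (l t.2.2.1).length))
    (heq.comp ((hg (by fun_prop) ComputableIn.snd).pair (hadd₁.comp
      ((hg (f := fun x => x.1.2.1) (by fun_prop) ComputableIn.snd).pair (hmul₁.comp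
        ((by fun_prop : ComputableIn O fun x : (ℕ × ℕ × ℕ × ℕ) × ℕ => x.1.2.2.2).pair
          (hg (f := fun x => x.1.2.2.1) (by fun_prop) ComputableIn.snd)))))))
    (by fun_prop)).of_iff fun t => ?_
  rw [Finsupp.ext_iff]
  simp only [Finsupp.add_apply, Finsupp.smul_apply, vecNumbering_apply ν hz, smul_eq_mul, hadd',
    hmul']
  refine ⟨fun h i => ?_, fun h i _ => h i⟩
  by_cases hi : i < max (l t.1).length (max (l t.2.1).length (l t.2.2.1).length)
  · exact h i hi
  · simp only [not_lt, max_le_iff] at hi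
    rw [List.getD_eq_default _ _ hi.1, List.getD_eq_default _ _ hi.2.1,
      List.getD_eq_default _ _ hi.2.2, hz]
    simp

/-- A bijection of a nonzero vector space which is semilinear with respect to a bijection of the
scalars makes the latter an automorphism. -/
theorem exists_ringEquiv_of_semilinear {V : Type*} [AddCommGroup V] [Module F V] [Nontrivial V]
    {μ : Equiv.Perm V} {σ : Equiv.Perm F} (h : ∀ (u v : V) (α : F), μ (u + α • v) = μ u + σ α • μ v) :
    (∃ τ : F ≃+* F, τ.toEquiv = σ) ∧
      ∀ (α β : F) (u v : V), μ (α • u + β • v) = σ α • μ u + σ β • μ v := by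
  obtain ⟨v₀, hv₀⟩ := exists_ne (0 : V)
  obtain ⟨v, rfl⟩ := μ.surjective v₀
  -- The identities follow by specialising `h` and cancelling the nonzero vector `μ v`.
  have h0 : σ 0 = 0 := by
    have := h 0 v 0
    simpa [hv₀] using this
  have hμ0 : μ 0 = 0 := by
    have h₁ := h 0 0 1
    have : σ 1 ≠ 0 := fun h' => one_ne_zero (σ.injective (h'.trans h0.symm))
    simpa [this] using h₁
  have hsmul : ∀ (α : F) (v : V), μ (α • v) = σ α • μ v := fun α v => by
    simpa [hμ0] using h 0 v α
  have h1 : σ 1 = 1 := by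
    have := hsmul 1 v
    rw [one_smul] at this
    exact (smul_left_injective F hv₀ (by simpa using this)).symm
  have hadd : ∀ u v : V, μ (u + v) = μ u + μ v := fun u v => by
    simpa [h1] using h u v 1
  refine ⟨⟨{ σ with
    map_mul' := fun α β => smul_left_injective F hv₀ ?_
    map_add' := fun α β => smul_left_injective F hv₀ ?_ }, rfl⟩, fun α β u v => ?_⟩
  · change σ (α * β) • μ v = (σ α * σ β) • μ v
    rw [← hsmul, mul_smul, mul_smul, hsmul, hsmul]
  · change σ (α + β) • μ v = (σ α + σ β) • μ v
    rw [← hsmul, add_smul, add_smul, hadd, hsmul, hsmul]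
  · rw [hadd, hsmul, hsmul]

/-- `e` is a program for the semilinear transformation `φ` and its inverse. -/
def NamesGSL (ν : ℕ → F) {hν : IsComputableField ν} (D : Set ℕ) (e : ℕ) (φ : GSL ν hν D) : Prop :=
  Total D e ∧ Represents (vecNumbering ν) (value D e) 0 φ.1.1 ∧
    Represents ν (value D e) 2 φ.1.2.toEquiv

variable {hν : IsComputableField ν}

theorem exists_namesGSL (φ : GSL ν hν D) : ∃ e, NamesGSL ν D e φ := by
  obtain ⟨g, hg, h⟩ := exists_total_represents (φ := φ.1.1) φ.2.2.1 (φ⁻¹).2.2.1 0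
  obtain ⟨g', hg', h'⟩ := exists_total_represents (φ := φ.1.2.toEquiv) φ.2.2.2 (φ⁻¹).2.2.2 2
  obtain ⟨e, he, hv⟩ := exists_total_value_eq (D := D)
    (f := fun z => if z.unpair.1 < 2 then g z else g' z)
    (.ite (by fun_prop) (by fun_prop) (by fun_prop))
  exact ⟨e, he, h _ (fun _ => by simp [hv]) fun _ => by simp [hv],
    h' _ (fun _ => by simp [hv]) fun _ => by simp [hv]⟩

/-- The sections `0`, `1` hold `μ` and its inverse, and `2`, `3` hold `σ` and its inverse.
Semilinearity is tested through an additional name for `u + α • v`, which keeps it a universal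
statement about values at computable arguments; that `σ` is a field automorphism then follows from
`exists_ringEquiv_of_semilinear`. -/
theorem exists_namesGSL_iff {e : ℕ} : (∃ φ : GSL ν hν D, NamesGSL ν D e φ) ↔
    ((Total D e ∧ ∃ μ, Represents (vecNumbering ν) (value D e) 0 μ) ∧
      (Total D e ∧ ∃ σ, Represents ν (value D e) 2 σ)) ∧ ∀ x : ℕ,
      vecNumbering ν x.unpair.1 = vecNumbering ν x.unpair.2.unpair.1 +
        ν x.unpair.2.unpair.2.unpair.2 • vecNumbering ν x.unpair.2.unpair.2.unpair.1 →
      vecNumbering ν (value D e (Nat.pair 0 x.unpair.1)) =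
        vecNumbering ν (value D e (Nat.pair 0 x.unpair.2.unpair.1)) +
          ν (value D e (Nat.pair 2 x.unpair.2.unpair.2.unpair.2)) •
            vecNumbering ν (value D e (Nat.pair 0 x.unpair.2.unpair.2.unpair.1)) := by
  constructor
  · rintro ⟨φ, he, h, h'⟩
    refine ⟨⟨⟨he, _, h⟩, he, _, h'⟩, fun x hx => ?_⟩
    rw [h.1, h.1, h.1, h'.1, hx, GSL.map_add φ, GSL.map_smul φ]
    rfl
  · rintro ⟨⟨⟨he, μ, h⟩, -, σ, h'⟩, hlin⟩
    have hc := he.computableIn_value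
    have hlin' : ∀ (u v : ℕ →₀ F) (α : F), μ (u + α • v) = μ u + σ α • μ v := fun u v α => by
      have hs := (vecNumbering_isDecidable hν.toIsDecidableNumbering).surjective
      obtain ⟨m, rfl⟩ := hs u
      obtain ⟨n, rfl⟩ := hs v
      obtain ⟨a, rfl⟩ := hν.surjective α
      obtain ⟨k, hk⟩ := hs (vecNumbering ν m + ν a • vecNumbering ν n)
      have := hlin (Nat.pair k (Nat.pair m (Nat.pair n a)))
      simp only [Nat.unpair_pair] at this
      rw [← hk, ← h.1, ← h.1, ← h.1, ← h'.1]
      exact this hk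
    obtain ⟨⟨τ, rfl⟩, hμ⟩ := exists_ringEquiv_of_semilinear hlin'
    exact ⟨⟨(μ, τ), hμ, ⟨fun m => value D e (Nat.pair 0 m),
      (by fun_prop : ComputableIn {charFun D} fun m => value D e (Nat.pair 0 m)), h.1⟩,
      fun m => value D e (Nat.pair 2 m),
      (by fun_prop : ComputableIn {charFun D} fun m => value D e (Nat.pair 2 m)), h'.1⟩, he, h, h'⟩

variable (hν D) in
theorem decidableIn_exists_namesGSL :
    DecidableIn {charFun (jump (jump D))} fun e => ∃ φ : GSL ν hν D, NamesGSL ν D e φ := by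
  have hlin := decidableIn_vecNumbering_eq_add_smul hν {charFun D}
  refine (((decidableIn_exists_represents
      (vecNumbering_isDecidable hν.toIsDecidableNumbering) 0).and
      (decidableIn_exists_represents hν.toIsDecidableNumbering 2)).and
    (decidableIn_forall_value (D := D)
      (T := fun x y₁ y₂ y₃ y₄ => vecNumbering ν x.unpair.1 =
        vecNumbering ν x.unpair.2.unpair.1 +
          ν x.unpair.2.unpair.2.unpair.2 • vecNumbering ν x.unpair.2.unpair.2.unpair.1 →
        vecNumbering ν y₁ = vecNumbering ν y₂ + ν y₄ • vecNumbering ν y₃)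
      (q₁ := fun x => Nat.pair 0 x.unpair.1) (q₂ := fun x => Nat.pair 0 x.unpair.2.unpair.1)
      (q₃ := fun x => Nat.pair 0 x.unpair.2.unpair.2.unpair.1)
      (q₄ := fun x => Nat.pair 2 x.unpair.2.unpair.2.unpair.2) (e₁ := fun e => e)
      (e₂ := fun e => e) (e₃ := fun e => e) (e₄ := fun e => e)
      ((hlin.comp (f := fun t : ℕ × ℕ × ℕ × ℕ × ℕ => (t.1.unpair.1, t.1.unpair.2.unpair.1,
        t.1.unpair.2.unpair.2.unpair.1, t.1.unpair.2.unpair.2.unpair.2)) (by fun_prop)).imp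
        (hlin.comp (f := fun t : ℕ × ℕ × ℕ × ℕ × ℕ => t.2) (by fun_prop)))
      (by fun_prop) (by fun_prop) (by fun_prop) (by fun_prop) (by fun_prop) (by fun_prop)
      (by fun_prop) (by fun_prop))).of_iff fun e => ?_
  rw [exists_namesGSL_iff]
  simp only [and_self]
  tauto

theorem isDegreeOfIsomorphismType_GSL (hν : IsComputableField ν) (D : Set ℕ) :
    IsDegreeOfIsomorphismType (GSL ν hν D) (deg (jump (jump D))) := by
  have hlb : ∀ a ∈ degreeSpectrum (GSL ν hν D), deg (jump (jump D)) ≤ a := fun a ha =>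
    deg_jump_jump_le (GSL.ofPerm hν) (GSL.ofPerm_injective hν)
      (fun f f' φ h hf hf' _ => GSL.not_semiconjBy_ofPerm f f' φ h hf hf') ha
  have hv := vecNumbering_isDecidable hν.toIsDecidableNumbering
  -- The field automorphism is determined by `μ`, so products need only be compared in the first
  -- component.
  have hμ : ∀ φ ψ : GSL ν hν D, φ.1.1 = ψ.1.1 → φ = ψ := fun φ ψ h => by
    refine Subtype.ext (Prod.ext h (RingEquiv.ext fun α => ?_))
    obtain ⟨v, hv⟩ := φ.1.1.surjective (Finsupp.single 0 1)
    have h₁ := GSL.map_smul φ α v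
    rw [h, GSL.map_smul ψ, ← h, hv] at h₁
    exact (smul_left_injective F (by simp : Finsupp.single 0 (1 : F) ≠ 0) h₁).symm
  obtain ⟨a, ha, hle⟩ := exists_mem_degreeSpectrum_le_of_names (E := jump (jump D))
    (R := NamesGSL ν (hν := hν) D) exists_namesGSL
    (fun e φ ψ hφ hψ => hμ _ _ (hφ.2.1.unique hv.surjective hψ.2.1))
    (decidableIn_exists_namesGSL D hν)
    (decidableIn_representsMul hv) fun a b c φ ψ χ ha hb hc => by
      rw [representsMul_iff hv.surjective ha.1 hb.1 hc.1 ha.2.1 hb.2.1 hc.2.1]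
      exact ⟨fun h => hμ _ _ h, fun h => h ▸ rfl⟩
  exact ⟨hle.antisymm (hlb a ha) ▸ ha, hlb⟩

end SemilinearNames

theorem theorem3 {F : Type*} [Field F] (ν : ℕ → F) (hν : IsComputableField ν) (D : Set ℕ) :
    IsDegreeOfIsomorphismType (GSL ν hν D) (deg (jump (jump D))) ∧
    IsDegreeOfIsomorphismType (autIntervalAlgebra D) (deg (jump (jump D))) :=
  ⟨isDegreeOfIsomorphismType_GSL hν D, isDegreeOfIsomorphismType_autIntervalAlgebra D⟩
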